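/- **Setting.** Fix $n\ge 1$ and a number of strands $N\ge 0$. A word is a sequence $\mathbf i=(i_1,\dots,i_N)$ of labels in $[1,n]$; the label $n$ is called red, the other labels black; $s_k\mathbf i$ is $\mathbf i$ with $i_k,i_{k+1}$ exchanged. Words are compared lexicographically. Let $\tilde T=\tilde T_N$ be the KLRW algebra on $N$ strands (the sum of the blocks $\tilde T_{\mathbf v}$ with $v_1+\dots+v_n=N$; the whole KLRW algebra is $\bigoplus_N\tilde T_N$): the unital $\mathbb C$-algebra generated by $e(\mathbf i)$ ($\mathbf i$ a word), $y_1,\dots,y_N$ and $\psi_1,\dots,\psi_{N-1}$, where the $e(\mathbf i)$ are orthogonal idempotents with sum $1$, the $y_k$ commute with each other and with all $e(\mathbf i)$, $\psi_ke(\mathbf i)=e(s_k\mathbf i)\psi_k$, $\psi_ke(\mathbf i)=0$ if $i_k=i_{k+1}=n$ (red strands do not cross), $\psi_ky_l=y_l\psi_k$ for $l\ne k,k+1$, $\psi_k\psi_l=\psi_l\psi_k$ for $|k-l|>1$, and - $y_k\psi_ke(\mathbf i)=\psi_ky_{k+1}e(\mathbf i)$ and $y_{k+1}\psi_ke(\mathbf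 i)=\psi_ky_ke(\mathbf i)$ if $i_k\neq i_{k+1}$; $(y_k\psi_k-\psi_ky_{k+1})e(\mathbf i)=e(\mathbf i)=(\psi_ky_k-y_{k+1}\psi_k)e(\mathbf i)$ if $i_k=i_{k+1}\ne n$; - $\psi_k^2e(\mathbf i)$ equals $0$ if $i_k=i_{k+1}$; $(y_{k+1}-y_k)e(\mathbf i)$ if $i_k=i_{k+1}-1$; $(y_k-y_{k+1})e(\mathbf i)$ if $i_k=i_{k+1}+1$; and $e(\mathbf i)$ otherwise; - whenever at most one of $i_k,i_{k+1},i_{k+2}$ is red, $(\psi_k\psi_{k+1}\psi_k-\psi_{k+1}\psi_k\psi_{k+1})e(\mathbf i)$ equals $e(\mathbf i)$ if $i_k=i_{k+2}=i_{k+1}+1$, $-e(\mathbf i)$ if $i_k=i_{k+2}=i_{k+1}-1$, and $0$ otherwise. It is graded by $\deg e(\mathbf i)=0$, $\deg y_k=2$, and $\deg\psi_ke(\mathbf i)=-2,1,0$ according to whether $|i_k-i_{k+1}|$ is $0$, $1$ or $>1$. Below, a *simple $\tilde T$-module* means a simple left $\tilde T$-module that admits a compatible $\mathbb Z$-grading.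 A word $\mathbf i$ is *red-good* if there is a simple $\tilde T$-module $L$ such that $\mathbf i$ is lexicographically minimal among the words $\mathbf j$ with $e(\mathbf j)L\ne0$. The *standard module* $\bar\Delta(\mathbf i)$ is the left $\tilde T$-module generated by a vector $v$ subject to the relations $$e(\mathbf i)v=v,\qquad \psi_kv=0\ \text{ for all $k$ with } i_k-1=i_{k+1},\qquad y_kv=0\ \text{ for all }k.\tag{$*$}$$ The *polynomial representation* is $\mathcal P=\bigoplus_{\mathbf i}\mathbb C[Y_1,\dots,Y_N]\,e(\mathbf i)$, where $e(\mathbf i)$ acts by projection, $y_k$ by multiplication by $Y_k$, and $\psi_k$ sends $f\,e(\mathbf i)$ to $g\,e(s_k\mathbf i)$ with $g=\frac{f^{(k,k+1)}-f}{Y_{k+1}-Y_k}$ if $i_k=i_{k+1}\neq n$, $g=0$ if $i_k=i_{k+1}=n$, $g=(Y_k-Y_{k+1})f^{(k,k+1)}$ if $i_k+1=i_{k+1}$, and $g=f^{(k,k+1)}$ otherwise. The dual space $\mathcal P^*$ is a left $\tilde T$-module through the anti-automorphism of $\tilde T$ fixing all the generators. Let $\mathrm{ev}_{\mathbf i}\in\mathcal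 P^*$ be the functional $f\,e(\mathbf j)\mapsto\delta_{\mathbf i,\mathbf j}f(0)$ and $N'(\mathbf i)=\tilde T\,\mathrm{ev}_{\mathbf i}\subset\mathcal P^*$. **Theorem.** 1. For every word $\mathbf i$, the module $N'(\mathbf i)$ has a unique simple quotient. This quotient is denoted $N(\mathbf i)$ and called a *canonical module*. 2. Let $\mathbf i$ be red-good. Then the image of $\mathrm{ev}_{\mathbf i}$ in $N(\mathbf i)$ satisfies the relations $(*)$. The module $\bar\Delta(\mathbf i)$ has a unique simple quotient $L(\mathbf i)$, and there is an isomorphism of $\tilde T$-modules $L(\mathbf i)\cong N(\mathbf i)$ that sends the image of $v$ to the image of $\mathrm{ev}_{\mathbf i}$. 3. Every simple $\tilde T$-module is isomorphic to $N(\mathbf i)$ for some red-good word $\mathbf i$; in particular it is a canonical module. -/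

import Mathlib

namespace KLRW

/-- Words of length `N` in an alphabet of `n` letters.  The letter `a : Fin n` stands for the label
`a + 1` in `[1, n]`; a word labels `N` strands from left to right. -/
abbrev Word (n N : ℕ) : Type := Fin N → Fin n

/-- A label is red if it is the largest label, all the others are black. -/
def IsRed {n : ℕ} (a : Fin n) : Prop := (a : ℕ) + 1 = n

/-- `a + 1 = b` for labels. -/
def IsSucc {n : ℕ} (a b : Fin n) : Prop := (a : ℕ) + 1 = b

instance {n : ℕ} : DecidablePred (IsRed (n := n)) := fun _ => Nat.decEq _ _

instance {n : ℕ} (a b : Fin n) : Decidable (IsSucc a b) := Nat.decEq _ _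

/-- The left one of the two adjacent strands `k`, `k + 1`. -/
def lo {N : ℕ} (k : Fin (N - 1)) : Fin N := ⟨k, by omega⟩

/-- The right one of the two adjacent strands `k`, `k + 1`. -/
def hi {N : ℕ} (k : Fin (N - 1)) : Fin N := ⟨k + 1, by omega⟩

/-- The transposition of the positions `k` and `k + 1`. -/
def adj {N : ℕ} (k : Fin (N - 1)) : Equiv.Perm (Fin N) := Equiv.swap (lo k) (hi k)

/-- The word `s_k w` obtained from `w` by exchanging its `k`th and `(k+1)`st letters. -/
def Word.swap {n N : ℕ} (k : Fin (N - 1)) (w : Word n N) : Word n N := w ∘ adj k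

/-- Generators of the algebra of diagrams on `N` strands: the crossingless dotless diagrams `e w`,
a dot on the `k`th strand (summed over all words), and the crossing of the strands `k`, `k + 1`
(summed over all words for which that crossing exists, that is, the two strands are not both
red). -/
inductive Gen (n N : ℕ) : Type
  | e (w : Word n N)
  | y (k : Fin N)
  | psi (k : Fin (N - 1))

/-- The free algebra on the generators. -/
abbrev Free (n N : ℕ) : Type := FreeAlgebra ℂ (Gen n N)

/-- The idempotent `e w` in the free algebra. -/
def fe {n N : ℕ} (w : Word n N) : Free n N := FreeAlgebra.ι ℂ (Gen.e w)

/-- The dot `y k` in the free algebra. -/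
def fy {n N : ℕ} (k : Fin N) : Free n N := FreeAlgebra.ι ℂ (Gen.y k)

/-- The crossing `psi k` in the free algebra. -/
def fpsi {n N : ℕ} (k : Fin (N - 1)) : Free n N := FreeAlgebra.ι ℂ (Gen.psi k)

/-- The scalar on the right-hand side of the triple point relation for three strands whose labels
at the bottom are `a`, `b`, `c` from left to right. -/
def braidCoeff {n : ℕ} (a b c : Fin n) : ℂ :=
  if a = c ∧ IsSucc b a then 1 else if a = c ∧ IsSucc a b then -1 else 0

/-- The defining relations.  A product `x * y` is the diagram `x` stacked on top of `y`, so in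
`x * e w` the word `w` is read at the bottom of `x`.  The first nine are isotopies and the
composition rule of diagrams (with the absence of crossings of two red strands); the others are
the local relations. -/
inductive Rel (n N : ℕ) : Free n N → Free n N → Prop
  | e_mul_self (w : Word n N) : Rel n N (fe w * fe w) (fe w)
  | e_mul_ne (w w' : Word n N) (h : w ≠ w') : Rel n N (fe w * fe w') 0
  | e_sum : Rel n N (∑ w : Word n N, fe w) 1
  | y_e (k : Fin N) (w : Word n N) : Rel n N (fy k * fe w) (fe w * fy k)
  | psi_e (k : Fin (N - 1)) (w : Word n N) : Rel n N (fpsi k * fe w) (fe (w.swap k) * fpsi k)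
  | psi_red (k : Fin (N - 1)) (w : Word n N) (h : w (lo k) = w (hi k)) (hr : IsRed (w (lo k))) :
      Rel n N (fpsi k * fe w) 0
  | y_y (k l : Fin N) : Rel n N (fy k * fy l) (fy l * fy k)
  | psi_y_far (k : Fin (N - 1)) (l : Fin N) (h : l ≠ lo k) (h' : l ≠ hi k) :
      Rel n N (fpsi k * fy l) (fy l * fpsi k)
  | psi_psi_far (k l : Fin (N - 1)) (h : (k : ℕ) + 1 < l) :
      Rel n N (fpsi k * fpsi l) (fpsi l * fpsi k)
  | slide_lo (k : Fin (N - 1)) (w : Word n N) (h : w (lo k) ≠ w (hi k)) :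
      Rel n N (fy (lo k) * fpsi k * fe w) (fpsi k * fy (hi k) * fe w)
  | slide_hi (k : Fin (N - 1)) (w : Word n N) (h : w (lo k) ≠ w (hi k)) :
      Rel n N (fy (hi k) * fpsi k * fe w) (fpsi k * fy (lo k) * fe w)
  | nil_lo (k : Fin (N - 1)) (w : Word n N) (h : w (lo k) = w (hi k)) (hr : ¬ IsRed (w (lo k))) :
      Rel n N ((fy (lo k) * fpsi k - fpsi k * fy (hi k)) * fe w) (fe w)
  | nil_hi (k : Fin (N - 1)) (w : Word n N) (h : w (lo k) = w (hi k)) (hr : ¬ IsRed (w (lo k))) :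
      Rel n N ((fpsi k * fy (lo k) - fy (hi k) * fpsi k) * fe w) (fe w)
  | bigon_eq (k : Fin (N - 1)) (w : Word n N) (h : w (lo k) = w (hi k)) :
      Rel n N (fpsi k * fpsi k * fe w) 0
  | bigon_far (k : Fin (N - 1)) (w : Word n N) (h : w (lo k) ≠ w (hi k))
      (h₁ : ¬ IsSucc (w (lo k)) (w (hi k))) (h₂ : ¬ IsSucc (w (hi k)) (w (lo k))) :
      Rel n N (fpsi k * fpsi k * fe w) (fe w)
  | bigon_up (k : Fin (N - 1)) (w : Word n N) (h : IsSucc (w (lo k)) (w (hi k))) :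
      Rel n N (fpsi k * fpsi k * fe w) ((fy (hi k) - fy (lo k)) * fe w)
  | bigon_down (k : Fin (N - 1)) (w : Word n N) (h : IsSucc (w (hi k)) (w (lo k))) :
      Rel n N (fpsi k * fpsi k * fe w) ((fy (lo k) - fy (hi k)) * fe w)
  | triple (k l : Fin (N - 1)) (hkl : (k : ℕ) + 1 = l) (w : Word n N)
      (h₁ : ¬ (w (lo k) = w (lo l) ∧ IsRed (w (lo k))))
      (h₂ : ¬ (w (lo k) = w (hi l) ∧ IsRed (w (lo k))))
      (h₃ : ¬ (w (lo l) = w (hi l) ∧ IsRed (w (lo l)))) :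
      Rel n N ((fpsi k * fpsi l * fpsi k - fpsi l * fpsi k * fpsi l) * fe w)
        (braidCoeff (w (lo k)) (w (lo l)) (w (hi l)) • fe w)

end KLRW

/-- The algebra of diagrams on `N` strands with labels in `[1, n]`, the strands labelled `n` being
red: the direct sum of the blocks with `v_1 + ... + v_n = N`. -/
def KLRW (n N : ℕ) : Type := RingQuot (KLRW.Rel n N)

namespace KLRW

noncomputable instance (n N : ℕ) : Ring (KLRW n N) := inferInstanceAs (Ring (RingQuot (Rel n N)))

noncomputable instance (n N : ℕ) : Algebra ℂ (KLRW n N) :=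
  inferInstanceAs (Algebra ℂ (RingQuot (Rel n N)))

/-- The quotient map from the free algebra. -/
noncomputable def mk (n N : ℕ) : Free n N →ₐ[ℂ] KLRW n N := RingQuot.mkAlgHom ℂ (Rel n N)

variable {n N : ℕ}

/-- The idempotent of a word. -/
noncomputable def e (w : Word n N) : KLRW n N := mk n N (fe w)

/-- The dot on the `k`th strand. -/
noncomputable def y (n : ℕ) {N : ℕ} (k : Fin N) : KLRW n N := mk n N (fy k)

/-- The crossing of the strands `k` and `k + 1`. -/
noncomputable def psi (n : ℕ) {N : ℕ} (k : Fin (N - 1)) : KLRW n N := mk n N (fpsi k)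

theorem mk_rel {a b : Free n N} (h : Rel n N a b) : mk n N a = mk n N b :=
  RingQuot.mkAlgHom_rel ℂ h

theorem lo_ne_hi (k : Fin (N - 1)) : lo k ≠ hi k := by
  simp [lo, hi, Fin.ext_iff]

theorem lo_eq_hi {k l : Fin (N - 1)} (h : (k : ℕ) + 1 = l) : lo l = hi k := by
  simp [lo, hi, h]

@[simp] theorem swap_lo (k : Fin (N - 1)) (w : Word n N) : w.swap k (lo k) = w (hi k) := by
  simp [Word.swap, adj]

@[simp] theorem swap_hi (k : Fin (N - 1)) (w : Word n N) : w.swap k (hi k) = w (lo k) := by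
  simp [Word.swap, adj]

@[simp] theorem swap_swap (k : Fin (N - 1)) (w : Word n N) : (w.swap k).swap k = w := by
  ext x
  simp [Word.swap, adj]

theorem swap_of_ne (k : Fin (N - 1)) (w : Word n N) (x : Fin N) (h : x ≠ lo k) (h' : x ≠ hi k) :
    w.swap k x = w x := by
  simp [Word.swap, adj, Equiv.swap_apply_of_ne_of_ne h h']

theorem swap_eq_self (k : Fin (N - 1)) (w : Word n N) (h : w (lo k) = w (hi k)) :
    w.swap k = w := by
  ext x
  by_cases h1 : x = lo k
  · subst h1; simp [h]
  by_cases h2 : x = hi k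
  · subst h2; simp [h]
  rw [swap_of_ne k w x h1 h2]

theorem adj_braid {k l : Fin (N - 1)} (h : (k : ℕ) + 1 = l) :
    adj k * adj l * adj k = adj l * adj k * adj l := by
  have h1 : lo l = hi k := lo_eq_hi h
  have hne : lo k ≠ hi l := by simp [lo, hi, Fin.ext_iff]; omega
  have h2 : lo k ≠ hi k := lo_ne_hi k
  have h3 : hi k ≠ hi l := by rw [← h1]; exact lo_ne_hi l
  have e1 := Equiv.swap_mul_swap_mul_swap h2 hne
  have e2 := Equiv.swap_mul_swap_mul_swap h3.symm hne.symm
  rw [Equiv.swap_comm (hi l) (hi k), Equiv.swap_comm (hi k) (lo k)] at e2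
  simp only [adj, h1]
  rw [e2, e1, Equiv.swap_comm]

theorem swap_braid {k l : Fin (N - 1)} (h : (k : ℕ) + 1 = l) (w : Word n N) :
    ((w.swap k).swap l).swap k = ((w.swap l).swap k).swap l := by
  have := adj_braid h
  funext x
  have hx := congrArg (fun p : Equiv.Perm (Fin N) => w (p x)) this
  simpa [Word.swap, Function.comp] using hx

theorem swap_far {k l : Fin (N - 1)} (h : (k : ℕ) + 1 < l) (w : Word n N) :
    (w.swap k).swap l = (w.swap l).swap k := by
  funext x
  have a1 : lo k ≠ lo l := by simp [lo, Fin.ext_iff]; omega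
  have a2 : lo k ≠ hi l := by simp [lo, hi, Fin.ext_iff]; omega
  have a3 : hi k ≠ lo l := by simp [lo, hi, Fin.ext_iff]; omega
  have a4 : hi k ≠ hi l := by simp [hi, Fin.ext_iff]; omega
  have : adj k * adj l = adj l * adj k := by
    apply (Equiv.Perm.Disjoint.commute _).eq
    intro z
    by_cases z1 : z = lo k
    · right; subst z1; exact Equiv.swap_apply_of_ne_of_ne a1 a2
    by_cases z2 : z = hi k
    · right; subst z2; exact Equiv.swap_apply_of_ne_of_ne a3 a4
    left; exact Equiv.swap_apply_of_ne_of_ne z1 z2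
  have hx := congrArg (fun p : Equiv.Perm (Fin N) => w (p x)) this
  simpa [Word.swap, Function.comp] using hx

theorem e_mul_e (w w' : Word n N) : e w * e w' = if w = w' then e w else 0 := by
  split_ifs with h
  · subst h
    simpa [e] using mk_rel (Rel.e_mul_self w)
  · simpa [e] using mk_rel (Rel.e_mul_ne w w' h)

theorem sum_e : ∑ w : Word n N, e w = 1 := by
  simpa [e] using mk_rel (Rel.e_sum (n := n) (N := N))

theorem y_mul_e (k : Fin N) (w : Word n N) : y n k * e w = e w * y n k := by
  simpa [e, y] using mk_rel (Rel.y_e k w)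

theorem psi_mul_e (k : Fin (N - 1)) (w : Word n N) :
    psi n k * e w = e (w.swap k) * psi n k := by
  simpa [e, psi] using mk_rel (Rel.psi_e k w)

theorem e_mul_psi (k : Fin (N - 1)) (w : Word n N) :
    e w * psi n k = psi n k * e (w.swap k) := by
  rw [psi_mul_e, swap_swap]

theorem mk_fe (w : Word n N) : mk n N (fe w) = e w := rfl

theorem mk_fy (k : Fin N) : mk n N (fy k) = y n k := rfl

theorem mk_fpsi (k : Fin (N - 1)) : mk n N (fpsi k) = psi n k := rfl

theorem e_mul_psi_mul (k : Fin (N - 1)) (w : Word n N) (z : KLRW n N) :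
    e w * (psi n k * z) = psi n k * (e (w.swap k) * z) := by
  rw [← mul_assoc, e_mul_psi, mul_assoc]

theorem e_mul_y (k : Fin N) (w : Word n N) : e w * y n k = y n k * e w := (y_mul_e k w).symm

theorem e_mul_y_mul (k : Fin N) (w : Word n N) (z : KLRW n N) :
    e w * (y n k * z) = y n k * (e w * z) := by
  rw [← mul_assoc, e_mul_y, mul_assoc]

/-- The values of the reflection on the generators. -/
noncomputable def flipGen : Gen n N → (KLRW n N)ᵐᵒᵖ
  | Gen.e w => MulOpposite.op (e w)
  | Gen.y k => MulOpposite.op (y n k)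
  | Gen.psi k => MulOpposite.op (psi n k)

theorem flip_rel {a b : Free n N} (h : Rel n N a b) :
    FreeAlgebra.lift ℂ (flipGen (n := n) (N := N)) a = FreeAlgebra.lift ℂ flipGen b := by
  have hE : ∀ w : Word n N, FreeAlgebra.lift ℂ flipGen (fe w) = MulOpposite.op (e w) := fun w => by
    simp [fe, flipGen]
  have hY : ∀ k : Fin N, FreeAlgebra.lift ℂ (flipGen (n := n)) (fy k) = MulOpposite.op (y n k) :=
    fun k => by simp [fy, flipGen]
  have hP : ∀ k : Fin (N - 1),
      FreeAlgebra.lift ℂ (flipGen (n := n)) (fpsi k) = MulOpposite.op (psi n k) := fun k => by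
    simp [fpsi, flipGen]
  have hlo : ∀ (k : Fin (N - 1)) (w : Word n N), w (lo k) = w (hi k) → w.swap k = w :=
    fun k w => swap_eq_self k w
  apply MulOpposite.unop_injective
  cases h with
  | e_mul_self w =>
    simp [map_mul, hE, e_mul_e]
  | e_mul_ne w w' h =>
    simp [map_mul, hE, e_mul_e, if_neg h.symm]
  | e_sum =>
    simp only [map_sum, hE, map_one]
    rw [← Finset.op_sum, sum_e, MulOpposite.op_one]
  | y_e k w =>
    simp [map_mul, hE, hY, y_mul_e]
  | psi_e k w =>
    simp [map_mul, hE, hP, e_mul_psi]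
  | psi_red k w h hr =>
    have := mk_rel (Rel.psi_red k w h hr)
    simpa [hE, hP, e_mul_psi, hlo k w h, mk_fe, mk_fpsi] using this
  | y_y k l =>
    have := mk_rel (Rel.y_y (n := n) l k)
    simpa [hY, mk_fy] using this
  | psi_y_far k l h h' =>
    have := mk_rel (Rel.psi_y_far (n := n) k l h h')
    simpa [hY, hP, mk_fy, mk_fpsi] using this.symm
  | psi_psi_far k l h =>
    have := mk_rel (Rel.psi_psi_far (n := n) k l h)
    simpa [hP, mk_fpsi] using this.symm
  | slide_lo k w h =>
    have := mk_rel (Rel.slide_hi k (w.swap k) (by simpa using h.symm))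
    simpa [hE, hY, hP, mk_fe, mk_fy, mk_fpsi, mul_assoc, e_mul_psi, e_mul_psi_mul, e_mul_y,
      e_mul_y_mul] using this.symm
  | slide_hi k w h =>
    have := mk_rel (Rel.slide_lo k (w.swap k) (by simpa using h.symm))
    simpa [hE, hY, hP, mk_fe, mk_fy, mk_fpsi, mul_assoc, e_mul_psi, e_mul_psi_mul, e_mul_y,
      e_mul_y_mul] using this.symm
  | nil_lo k w h hr =>
    have := mk_rel (Rel.nil_hi k w h hr)
    simpa [hE, hY, hP, mk_fe, mk_fy, mk_fpsi, mul_assoc, e_mul_psi, e_mul_psi_mul, e_mul_y,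
      e_mul_y_mul, mul_sub, sub_mul, hlo k w h] using this
  | nil_hi k w h hr =>
    have := mk_rel (Rel.nil_lo k w h hr)
    simpa [hE, hY, hP, mk_fe, mk_fy, mk_fpsi, mul_assoc, e_mul_psi, e_mul_psi_mul, e_mul_y,
      e_mul_y_mul, mul_sub, sub_mul, hlo k w h] using this
  | bigon_eq k w h =>
    have := mk_rel (Rel.bigon_eq k w h)
    simpa [hE, hP, mk_fe, mk_fpsi, mul_assoc, e_mul_psi, e_mul_psi_mul] using this
  | bigon_far k w h h₁ h₂ =>
    have := mk_rel (Rel.bigon_far k w h h₁ h₂)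
    simpa [hE, hP, mk_fe, mk_fpsi, mul_assoc, e_mul_psi, e_mul_psi_mul] using this
  | bigon_up k w h =>
    have := mk_rel (Rel.bigon_up k w h)
    simpa [hE, hY, hP, mk_fe, mk_fy, mk_fpsi, mul_assoc, e_mul_psi, e_mul_psi_mul, e_mul_y,
      mul_sub, sub_mul] using this
  | bigon_down k w h =>
    have := mk_rel (Rel.bigon_down k w h)
    simpa [hE, hY, hP, mk_fe, mk_fy, mk_fpsi, mul_assoc, e_mul_psi, e_mul_psi_mul, e_mul_y,
      mul_sub, sub_mul] using this
  | triple k l hkl w h₁ h₂ h₃ =>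
    have hl : lo l = hi k := lo_eq_hi hkl
    have d1 : lo k ≠ hi l := by simp [lo, hi, Fin.ext_iff]; omega
    have d2 : hi k ≠ hi l := by rw [← hl]; exact lo_ne_hi l
    set w' := ((w.swap k).swap l).swap k with hw'
    have a1 : w' (lo k) = w (hi l) := by
      rw [hw', swap_lo, ← hl, swap_lo, swap_of_ne k w _ d1.symm d2.symm]
    have a2 : w' (lo l) = w (lo l) := by
      rw [hw', hl, swap_hi, swap_of_ne l _ _ (by rw [hl]; exact lo_ne_hi k) d1, swap_lo]
    have a3 : w' (hi l) = w (lo k) := by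
      rw [hw', swap_of_ne k _ _ d1.symm d2.symm, swap_hi, hl, swap_hi]
    have := mk_rel (Rel.triple k l hkl w'
      (by rw [a1, a2]; rintro ⟨p, q⟩; exact h₃ ⟨p.symm, p ▸ q⟩)
      (by rw [a1, a3]; rintro ⟨p, q⟩; exact h₂ ⟨p.symm, p ▸ q⟩)
      (by rw [a2, a3]; rintro ⟨p, q⟩; exact h₁ ⟨p.symm, p ▸ q⟩))
    rw [a1, a2, a3] at this
    have hc : braidCoeff (w (hi l)) (w (lo l)) (w (lo k)) • e w'
        = braidCoeff (w (lo k)) (w (lo l)) (w (hi l)) • e w := by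
      by_cases hac : w (lo k) = w (hi l)
      · have : w' = w := by
          rw [hw']
          funext x
          by_cases x1 : x = lo k
          · subst x1; rw [← hw', a1, hac]
          by_cases x2 : x = lo l
          · subst x2; rw [← hw', a2]
          by_cases x3 : x = hi l
          · subst x3; rw [← hw', a3, hac]
          rw [swap_of_ne k _ _ x1 (hl ▸ x2), swap_of_ne l _ _ x2 x3,
            swap_of_ne k _ _ x1 (hl ▸ x2)]
        rw [this, hac]
      · have hca : ¬ w (hi l) = w (lo k) := fun h => hac h.symm
        simp [braidCoeff, hac, hca]
    simp only [map_mul, map_sub, map_smul, mk_fe, mk_fpsi, hc] at this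
    simp only [map_mul, map_sub, map_smul, hE, hP, MulOpposite.unop_mul, MulOpposite.unop_sub,
      MulOpposite.unop_op, MulOpposite.unop_smul, mul_sub, mul_assoc, e_mul_psi, e_mul_psi_mul]
    rw [← swap_braid hkl, ← hw', ← this]
    simp only [sub_mul, mul_assoc]

/-- The reflection of diagrams in a horizontal line, an anti-automorphism of the algebra which
fixes the generators. -/
noncomputable def flip (n N : ℕ) : KLRW n N →ₐ[ℂ] (KLRW n N)ᵐᵒᵖ :=
  RingQuot.liftAlgHom ℂ ⟨FreeAlgebra.lift ℂ flipGen, fun _ _ h => flip_rel h⟩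

/-- Exchanging the variables `Y_p` and `Y_q` in a polynomial. -/
noncomputable def swapVar (p q : Fin N) : MvPolynomial (Fin N) ℂ →ₐ[ℂ] MvPolynomial (Fin N) ℂ :=
  MvPolynomial.rename (Equiv.swap p q)

theorem swapVar_X (p q i : Fin N) :
    swapVar p q (MvPolynomial.X i) = MvPolynomial.X (Equiv.swap p q i) :=
  MvPolynomial.rename_X _ _

theorem swapVar_swapVar (p q : Fin N) (f : MvPolynomial (Fin N) ℂ) :
    swapVar p q (swapVar p q f) = f := by
  simp only [swapVar, MvPolynomial.rename_rename]
  have : (Equiv.swap p q : Fin N → Fin N) ∘ (Equiv.swap p q) = id := by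
    funext x; simp
  rw [this, MvPolynomial.rename_id_apply]

theorem swapVar_far {p q p' q' : Fin N} (h1 : p ≠ p') (h2 : p ≠ q') (h3 : q ≠ p') (h4 : q ≠ q')
    (f : MvPolynomial (Fin N) ℂ) :
    swapVar p q (swapVar p' q' f) = swapVar p' q' (swapVar p q f) := by
  simp only [swapVar, MvPolynomial.rename_rename]
  have : (Equiv.swap p q : Equiv.Perm (Fin N)) * (Equiv.swap p' q') =
      (Equiv.swap p' q') * (Equiv.swap p q) := by
    apply (Equiv.Perm.Disjoint.commute _).eq
    intro z
    by_cases z1 : z = p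
    · right; subst z1; exact Equiv.swap_apply_of_ne_of_ne h1 h2
    by_cases z2 : z = q
    · right; subst z2; exact Equiv.swap_apply_of_ne_of_ne h3 h4
    left; exact Equiv.swap_apply_of_ne_of_ne z1 z2
  have h := congrArg (fun u : Equiv.Perm (Fin N) => (u : Fin N → Fin N)) this
  simp only [Equiv.Perm.coe_mul] at h
  rw [h]

theorem swapVar_braid {p q r : Fin N} (h1 : p ≠ q) (h2 : p ≠ r) (h3 : q ≠ r)
    (f : MvPolynomial (Fin N) ℂ) :
    swapVar p q (swapVar q r (swapVar p q f)) = swapVar q r (swapVar p q (swapVar q r f)) := by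
  simp only [swapVar, MvPolynomial.rename_rename]
  have e1 := Equiv.swap_mul_swap_mul_swap h1 h2
  have e2 := Equiv.swap_mul_swap_mul_swap h3.symm h2.symm
  rw [Equiv.swap_comm r q, Equiv.swap_comm q p] at e2
  have : Equiv.swap p q * Equiv.swap q r * Equiv.swap p q =
      Equiv.swap q r * Equiv.swap p q * Equiv.swap q r := by
    rw [e2, e1, Equiv.swap_comm]
  have h := congrArg (fun u : Equiv.Perm (Fin N) => (u : Fin N → Fin N)) this
  simp only [Equiv.Perm.coe_mul] at h
  simp only [Function.comp_assoc] at h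
  rw [h]

theorem X_sub_X_ne_zero {p q : Fin N} (h : p ≠ q) :
    (MvPolynomial.X q - MvPolynomial.X p : MvPolynomial (Fin N) ℂ) ≠ 0 := by
  rw [sub_ne_zero]
  exact fun e => h (MvPolynomial.X_injective e).symm

theorem exists_divDiff_apply (p q : Fin N) (f : MvPolynomial (Fin N) ℂ) :
    ∃ g, (MvPolynomial.X q - MvPolynomial.X p) * g = swapVar p q f - f := by
  induction f using MvPolynomial.induction_on with
  | C a => exact ⟨0, by simp [swapVar]⟩
  | add f g hf hg =>
    obtain ⟨a, ha⟩ := hf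
    obtain ⟨b, hb⟩ := hg
    exact ⟨a + b, by rw [mul_add, ha, hb, map_add]; ring⟩
  | mul_X f i hf =>
    obtain ⟨a, ha⟩ := hf
    have hi : ∃ c, (MvPolynomial.X q - MvPolynomial.X p : MvPolynomial (Fin N) ℂ) * c =
        MvPolynomial.X (Equiv.swap p q i) - MvPolynomial.X i := by
      by_cases h1 : i = p
      · exact ⟨1, by simp [h1]⟩
      by_cases h2 : i = q
      · exact ⟨-1, by simp [h2]⟩
      exact ⟨0, by simp [Equiv.swap_apply_of_ne_of_ne h1 h2]⟩
    obtain ⟨c, hc⟩ := hi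
    refine ⟨a * MvPolynomial.X (Equiv.swap p q i) + f * c, ?_⟩
    rw [map_mul, swapVar_X]
    linear_combination MvPolynomial.X (Equiv.swap p q i) * ha + f * hc

theorem exists_divDiff (p q : Fin N) :
    ∃ D : MvPolynomial (Fin N) ℂ →ₗ[ℂ] MvPolynomial (Fin N) ℂ,
      ∀ f, (MvPolynomial.X q - MvPolynomial.X p) * D f = swapVar p q f - f := by
  by_cases h : p = q
  · refine ⟨0, fun f => ?_⟩
    have : swapVar p p f = f := by simp [swapVar]
    simp [← h, this]
  · choose g hg using exists_divDiff_apply p q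
    have hX := X_sub_X_ne_zero h
    refine ⟨⟨⟨g, fun a b => mul_left_cancel₀ hX ?_⟩, fun c a => mul_left_cancel₀ hX ?_⟩, hg⟩
    · rw [mul_add, hg, hg, hg, map_add]; ring
    · rw [RingHom.id_apply, mul_smul_comm, hg, hg, map_smul, smul_sub]

/-- The divided difference operator `f ↦ (f^(p,q) - f) / (Y_q - Y_p)`, which is determined by
`divDiff_spec` if `p ≠ q`. -/
noncomputable def divDiff (p q : Fin N) : MvPolynomial (Fin N) ℂ →ₗ[ℂ] MvPolynomial (Fin N) ℂ :=
  (exists_divDiff p q).choose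

theorem divDiff_spec (p q : Fin N) (f : MvPolynomial (Fin N) ℂ) :
    (MvPolynomial.X q - MvPolynomial.X p) * divDiff p q f = swapVar p q f - f :=
  (exists_divDiff p q).choose_spec f

/-- The action on polynomials of a crossing of two strands in positions `p`, `q` (from left to
right) whose labels at the bottom are `a`, `b`. -/
noncomputable def cross (a b : Fin n) (p q : Fin N) :
    MvPolynomial (Fin N) ℂ →ₗ[ℂ] MvPolynomial (Fin N) ℂ :=
  if a = b then (if IsRed a then 0 else divDiff p q)
  else if IsSucc a b then
    LinearMap.mulLeft ℂ (MvPolynomial.X p - MvPolynomial.X q) ∘ₗ (swapVar p q).toLinearMap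
  else (swapVar p q).toLinearMap

theorem cross_same {a : Fin n} (h : ¬ IsRed a) (p q : Fin N) (f : MvPolynomial (Fin N) ℂ) :
    cross a a p q f = divDiff p q f := by
  simp [cross, h]

theorem cross_red {a : Fin n} (h : IsRed a) (p q : Fin N) (f : MvPolynomial (Fin N) ℂ) :
    cross a a p q f = 0 := by
  simp [cross, h]

/-- The factor by which a crossing of strands with different labels differs from a
transposition. -/
noncomputable def factor (a b : Fin n) (p q : Fin N) : MvPolynomial (Fin N) ℂ :=
  if IsSucc a b then MvPolynomial.X p - MvPolynomial.X q else 1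

theorem cross_diff {a b : Fin n} (h : a ≠ b) (p q : Fin N) (f : MvPolynomial (Fin N) ℂ) :
    cross a b p q f = factor a b p q * swapVar p q f := by
  rw [cross, if_neg h, factor]
  split_ifs <;> simp

theorem swapVar_factor (a b : Fin n) (p q i j : Fin N) :
    swapVar p q (factor a b i j) = factor a b (Equiv.swap p q i) (Equiv.swap p q j) := by
  rw [factor, factor]
  split_ifs <;> simp [swapVar_X]

theorem divDiff_mul {p q : Fin N} (h : p ≠ q) (f g : MvPolynomial (Fin N) ℂ) :
    divDiff p q (f * g) = swapVar p q f * divDiff p q g + divDiff p q f * g := by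
  apply mul_left_cancel₀ (X_sub_X_ne_zero h)
  rw [divDiff_spec, map_mul]
  linear_combination (-swapVar p q f) * divDiff_spec p q g - g * divDiff_spec p q f

theorem divDiff_of_symm {p q : Fin N} (h : p ≠ q) {f : MvPolynomial (Fin N) ℂ}
    (hf : swapVar p q f = f) : divDiff p q f = 0 := by
  apply mul_left_cancel₀ (X_sub_X_ne_zero h)
  rw [divDiff_spec, hf, mul_zero, sub_self]

theorem divDiff_X_left {p q : Fin N} (h : p ≠ q) : divDiff p q (MvPolynomial.X p) = 1 := by
  apply mul_left_cancel₀ (X_sub_X_ne_zero h)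
  rw [divDiff_spec, swapVar_X]; simp

theorem divDiff_X_right {p q : Fin N} (h : p ≠ q) : divDiff p q (MvPolynomial.X q) = -1 := by
  apply mul_left_cancel₀ (X_sub_X_ne_zero h)
  rw [divDiff_spec, swapVar_X]; simp

theorem swapVar_divDiff {p q : Fin N} (h : p ≠ q) (f : MvPolynomial (Fin N) ℂ) :
    swapVar p q (divDiff p q f) = divDiff p q f := by
  apply mul_left_cancel₀ (X_sub_X_ne_zero h)
  have := congrArg (swapVar p q) (divDiff_spec p q f)
  simp only [map_mul, map_sub, swapVar_X, swapVar_swapVar, Equiv.swap_apply_left,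
    Equiv.swap_apply_right] at this
  rw [divDiff_spec]
  linear_combination -this

theorem divDiff_divDiff {p q : Fin N} (h : p ≠ q) (f : MvPolynomial (Fin N) ℂ) :
    divDiff p q (divDiff p q f) = 0 :=
  divDiff_of_symm h (swapVar_divDiff h f)

/-- Conjugating a divided difference by two transpositions. -/
theorem conj_divDiff {p q r : Fin N} (h1 : p ≠ q) (h2 : p ≠ r) (h3 : q ≠ r)
    (f : MvPolynomial (Fin N) ℂ) :
    swapVar p q (swapVar q r (divDiff p q f)) = divDiff q r (swapVar p q (swapVar q r f)) := by
  apply mul_left_cancel₀ (X_sub_X_ne_zero h3)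
  rw [divDiff_spec]
  have := congrArg (fun g => swapVar p q (swapVar q r g)) (divDiff_spec p q f)
  simp only [map_mul, map_sub, swapVar_X, Equiv.swap_apply_left,
    Equiv.swap_apply_of_ne_of_ne h1 h2,
    Equiv.swap_apply_of_ne_of_ne h2.symm h3.symm, swapVar_braid h1 h2 h3] at this
  exact this

theorem conj_divDiff' {p q r : Fin N} (h1 : p ≠ q) (h2 : p ≠ r) (h3 : q ≠ r)
    (f : MvPolynomial (Fin N) ℂ) :
    swapVar q r (swapVar p q (divDiff q r f)) = divDiff p q (swapVar q r (swapVar p q f)) := by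
  apply mul_left_cancel₀ (X_sub_X_ne_zero h1)
  rw [divDiff_spec]
  have := congrArg (fun g => swapVar q r (swapVar p q g)) (divDiff_spec q r f)
  simp only [map_mul, map_sub, swapVar_X,
    Equiv.swap_apply_right, Equiv.swap_apply_of_ne_of_ne h1 h2,
    Equiv.swap_apply_of_ne_of_ne h2.symm h3.symm, ← swapVar_braid h1 h2 h3] at this
  exact this

/-- Conjugating a divided difference by one transposition. -/
theorem mul_swapVar_divDiff {p q r : Fin N} (h1 : p ≠ q) (h2 : p ≠ r)
    (f : MvPolynomial (Fin N) ℂ) :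
    (MvPolynomial.X r - MvPolynomial.X p) * swapVar q r (divDiff p q f) =
      swapVar q r (swapVar p q f) - swapVar q r f := by
  have := congrArg (swapVar q r) (divDiff_spec p q f)
  simpa only [map_mul, map_sub, swapVar_X, Equiv.swap_apply_left,
    Equiv.swap_apply_of_ne_of_ne h1 h2] using this

theorem mul_swapVar_divDiff' {p q r : Fin N} (h2 : p ≠ r) (h3 : q ≠ r)
    (f : MvPolynomial (Fin N) ℂ) :
    (MvPolynomial.X r - MvPolynomial.X p) * swapVar p q (divDiff q r f) =
      swapVar p q (swapVar q r f) - swapVar p q f := by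
  have := congrArg (swapVar p q) (divDiff_spec q r f)
  simpa only [map_mul, map_sub, swapVar_X, Equiv.swap_apply_right,
    Equiv.swap_apply_of_ne_of_ne h2.symm h3.symm] using this

theorem divDiff_braid {p q r : Fin N} (h1 : p ≠ q) (h2 : p ≠ r) (h3 : q ≠ r)
    (f : MvPolynomial (Fin N) ℂ) :
    divDiff p q (divDiff q r (divDiff p q f)) = divDiff q r (divDiff p q (divDiff q r f)) := by
  have n1 := X_sub_X_ne_zero h1
  have n2 := X_sub_X_ne_zero h2
  have n3 := X_sub_X_ne_zero h3
  apply mul_left_cancel₀ (mul_ne_zero (mul_ne_zero n1 n2) n3)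
  have a1 := divDiff_spec p q f
  have a2 := divDiff_spec q r (divDiff p q f)
  have a3 := divDiff_spec p q (divDiff q r (divDiff p q f))
  have a4 := mul_swapVar_divDiff h1 h2 f
  have a5 := mul_swapVar_divDiff' (p := p) h2 h3 (divDiff p q f)
  have a6 := conj_divDiff h1 h2 h3 f
  have a7 := divDiff_spec q r (swapVar p q (swapVar q r f))
  rw [swapVar_divDiff h1] at a5
  rw [a6] at a5
  have b1 := divDiff_spec q r f
  have b2 := divDiff_spec p q (divDiff q r f)
  have b3 := divDiff_spec q r (divDiff p q (divDiff q r f))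
  have b4 := mul_swapVar_divDiff' (p := p) h2 h3 f
  have b5 := mul_swapVar_divDiff h1 h2 (divDiff q r f)
  have b6 := conj_divDiff' h1 h2 h3 f
  have b7 := divDiff_spec p q (swapVar q r (swapVar p q f))
  rw [swapVar_divDiff h3] at b5
  rw [b6] at b5
  rw [swapVar_braid h1 h2 h3] at b7
  set P : MvPolynomial (Fin N) ℂ := MvPolynomial.X p
  set Q : MvPolynomial (Fin N) ℂ := MvPolynomial.X q
  set R : MvPolynomial (Fin N) ℂ := MvPolynomial.X r
  linear_combination (R - P) * (R - Q) * a3 + (R - Q) * a5 + a7 - (R - P) * a2 - a4 + a1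
    - (Q - P) * (R - P) * b3 - (Q - P) * b5 - b7 + (R - P) * b2 + b4 - b1

theorem cross_braid {p q r : Fin N} (h1 : p ≠ q) (h2 : p ≠ r) (h3 : q ≠ r) (a b c : Fin n)
    (r₁ : ¬ (a = b ∧ IsRed a)) (r₂ : ¬ (a = c ∧ IsRed a)) (r₃ : ¬ (b = c ∧ IsRed b))
    (f : MvPolynomial (Fin N) ℂ) :
    cross b c p q (cross a c q r (cross a b p q f)) -
      cross a b q r (cross a c p q (cross b c q r f)) = braidCoeff a b c • f := by
  by_cases hab : a = b
  · subst hab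
    have hra : ¬ IsRed a := fun h => r₁ ⟨rfl, h⟩
    by_cases hac : a = c
    · subst hac
      have : ¬ IsSucc a a := by simp [IsSucc]
      simp only [cross_same hra, divDiff_braid h1 h2 h3, braidCoeff, this]
      simp
    · have hc : braidCoeff a a c = 0 := by simp [braidCoeff, hac]
      rw [hc, zero_smul, cross_same hra, cross_same hra, sub_eq_zero]
      simp only [cross_diff hac, map_mul, swapVar_factor,
        Equiv.swap_apply_right, Equiv.swap_apply_of_ne_of_ne h2.symm h3.symm,
        conj_divDiff h1 h2 h3]
      rw [← mul_assoc, ← mul_assoc, divDiff_mul h3 (factor a c p q * factor a c p r),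
        divDiff_of_symm h3 (f := factor a c p q * factor a c p r)]
      · simp [swapVar_factor, Equiv.swap_apply_of_ne_of_ne h1 h2, mul_comm]
      · simp [swapVar_factor, Equiv.swap_apply_of_ne_of_ne h1 h2, mul_comm]
  · by_cases hbc : b = c
    · subst hbc
      have hrb : ¬ IsRed b := fun h => r₃ ⟨rfl, h⟩
      have hc : braidCoeff a b b = 0 := by simp [braidCoeff, hab]
      rw [hc, zero_smul, cross_same hrb, cross_same hrb, sub_eq_zero]
      simp only [cross_diff hab, map_mul, swapVar_factor, Equiv.swap_apply_left,
        Equiv.swap_apply_of_ne_of_ne h1 h2,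
        conj_divDiff' h1 h2 h3]
      rw [← mul_assoc, ← mul_assoc, divDiff_mul h1 (factor a b q r * factor a b p r),
        divDiff_of_symm h1 (f := factor a b q r * factor a b p r)]
      · simp [swapVar_factor, Equiv.swap_apply_of_ne_of_ne h2.symm h3.symm, mul_comm]
      · simp [swapVar_factor, Equiv.swap_apply_of_ne_of_ne h2.symm h3.symm, mul_comm]
    · by_cases hac : a = c
      · subst hac
        have hra : ¬ IsRed a := fun h => r₂ ⟨rfl, h⟩
        rw [cross_same hra, cross_same hra, cross_diff hab, cross_diff hbc, cross_diff hab,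
          cross_diff hbc]
        have key : swapVar p q (divDiff q r (swapVar p q f)) =
            swapVar q r (divDiff p q (swapVar q r f)) := by
          apply mul_left_cancel₀ (X_sub_X_ne_zero h2)
          rw [mul_swapVar_divDiff' h2 h3, mul_swapVar_divDiff h1 h2, swapVar_braid h1 h2 h3,
            swapVar_swapVar, swapVar_swapVar]
        have d1 : divDiff q r (MvPolynomial.X p) = 0 :=
          divDiff_of_symm h3 (by rw [swapVar_X, Equiv.swap_apply_of_ne_of_ne h1 h2])
        have d2 : divDiff p q (MvPolynomial.X r) = 0 :=
          divDiff_of_symm h1 (by rw [swapVar_X, Equiv.swap_apply_of_ne_of_ne h2.symm h3.symm])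
        by_cases s1 : IsSucc a b
        · have s2 : ¬ IsSucc b a := by simp only [IsSucc] at *; omega
          simp only [factor, one_mul, divDiff_mul h3, map_sub, map_add,
            map_mul, swapVar_X, Equiv.swap_apply_left, Equiv.swap_apply_of_ne_of_ne h1 h2,
            Equiv.swap_apply_of_ne_of_ne h2.symm h3.symm, d1, divDiff_X_left h3, key, map_zero,
            map_one, swapVar_swapVar, braidCoeff, s2, and_false, if_false, s1, and_self, if_true]
          rw [neg_one_smul]
          ring
        · by_cases s2 : IsSucc b a
          · simp only [factor, if_neg s1, one_mul, divDiff_mul h1, map_sub, map_add,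
              map_mul, swapVar_X, Equiv.swap_apply_right,
              Equiv.swap_apply_of_ne_of_ne h1 h2,
              Equiv.swap_apply_of_ne_of_ne h2.symm h3.symm, d2, divDiff_X_right h1, key, map_zero,
              map_one, map_neg, swapVar_swapVar, braidCoeff, s2, and_self, if_true]
            rw [one_smul]
            ring
          · simp only [factor, one_mul, key, braidCoeff, s1, s2, and_false,
              if_false, zero_smul, sub_self]
      · have hc : braidCoeff a b c = 0 := by simp [braidCoeff, hac]
        rw [hc, zero_smul, sub_eq_zero]
        simp only [cross_diff hac, cross_diff hab, cross_diff hbc, map_mul, swapVar_factor,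
          Equiv.swap_apply_left, Equiv.swap_apply_right, Equiv.swap_apply_of_ne_of_ne h2.symm h3.symm,
          Equiv.swap_apply_of_ne_of_ne h1 h2, swapVar_braid h1 h2 h3]
        ring

/-- The vector space of the polynomial representation: a polynomial in the variables
`Y_1, ..., Y_N` for every word. -/
def Poly (n N : ℕ) : Type := Word n N → MvPolynomial (Fin N) ℂ

noncomputable instance (n N : ℕ) : AddCommGroup (Poly n N) :=
  inferInstanceAs (AddCommGroup (Word n N → MvPolynomial (Fin N) ℂ))

noncomputable instance (n N : ℕ) : Module ℂ (Poly n N) :=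
  inferInstanceAs (Module ℂ (Word n N → MvPolynomial (Fin N) ℂ))

/-- The inclusion of the summand of a word, `f ↦ f e(w)`. -/
noncomputable def Poly.single (w : Word n N) : MvPolynomial (Fin N) ℂ →ₗ[ℂ] Poly n N :=
  LinearMap.single ℂ (fun _ : Word n N => MvPolynomial (Fin N) ℂ) w

/-- The projection to the summand of a word. -/
noncomputable def Poly.coeff (w : Word n N) : Poly n N →ₗ[ℂ] MvPolynomial (Fin N) ℂ :=
  LinearMap.proj (φ := fun _ : Word n N => MvPolynomial (Fin N) ℂ) w

/-- The action of the generators on the polynomial representation. -/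
noncomputable def polyGen : Gen n N → Module.End ℂ (Poly n N)
  | Gen.e w => Poly.single w ∘ₗ Poly.coeff w
  | Gen.y k => ∑ w : Word n N,
      Poly.single w ∘ₗ LinearMap.mulLeft ℂ (MvPolynomial.X k) ∘ₗ Poly.coeff w
  | Gen.psi k => ∑ w : Word n N,
      Poly.single (w.swap k) ∘ₗ cross (w (lo k)) (w (hi k)) (lo k) (hi k) ∘ₗ Poly.coeff w

theorem Poly.coeff_single (w v : Word n N) (f : MvPolynomial (Fin N) ℂ) :
    Poly.coeff w (Poly.single v f) = if w = v then f else 0 := by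
  exact Pi.single_apply (M := MvPolynomial (Fin N) ℂ) v f w

theorem Poly.hom_ext {g h : Module.End ℂ (Poly n N)}
    (H : ∀ v f, g (Poly.single v f) = h (Poly.single v f)) : g = h :=
  LinearMap.pi_ext (φ := fun _ : Word n N => MvPolynomial (Fin N) ℂ) H

theorem polyGen_e (w v : Word n N) (f : MvPolynomial (Fin N) ℂ) :
    polyGen (Gen.e w) (Poly.single v f) = if w = v then Poly.single v f else 0 := by
  simp only [polyGen, LinearMap.comp_apply, Poly.coeff_single]
  split_ifs with h <;> simp [h]

theorem polyGen_y (k : Fin N) (v : Word n N) (f : MvPolynomial (Fin N) ℂ) :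
    polyGen (Gen.y k) (Poly.single v f) = Poly.single v (MvPolynomial.X k * f) := by
  simp only [polyGen, LinearMap.sum_apply, LinearMap.comp_apply, Poly.coeff_single]
  rw [Finset.sum_eq_single v]
  · simp
  · intro b _ hb; simp [hb]
  · simp

theorem polyGen_psi (k : Fin (N - 1)) (v : Word n N) (f : MvPolynomial (Fin N) ℂ) :
    polyGen (Gen.psi k) (Poly.single v f) =
      Poly.single (v.swap k) (cross (v (lo k)) (v (hi k)) (lo k) (hi k) f) := by
  simp only [polyGen, LinearMap.sum_apply, LinearMap.comp_apply, Poly.coeff_single]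
  rw [Finset.sum_eq_single v]
  · simp
  · intro b _ hb; simp [hb]
  · simp

theorem cross_X_mul_far {p q l : Fin N} (h0 : p ≠ q) (h1 : l ≠ p) (h2 : l ≠ q) (a b : Fin n)
    (f : MvPolynomial (Fin N) ℂ) :
    cross a b p q (MvPolynomial.X l * f) = MvPolynomial.X l * cross a b p q f := by
  by_cases hab : a = b
  · subst hab
    by_cases hr : IsRed a
    · simp [cross_red hr]
    · have hs : swapVar p q (MvPolynomial.X l) = MvPolynomial.X l := by
        rw [swapVar_X, Equiv.swap_apply_of_ne_of_ne h1 h2]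
      rw [cross_same hr, cross_same hr, divDiff_mul h0, hs, divDiff_of_symm h0 hs]
      ring
  · rw [cross_diff hab, cross_diff hab, map_mul, swapVar_X, Equiv.swap_apply_of_ne_of_ne h1 h2]
    ring

theorem swapVar_divDiff_far {p q p' q' : Fin N} (h0 : p ≠ q) (h1 : p ≠ p') (h2 : p ≠ q')
    (h3 : q ≠ p') (h4 : q ≠ q') (f : MvPolynomial (Fin N) ℂ) :
    swapVar p' q' (divDiff p q f) = divDiff p q (swapVar p' q' f) := by
  apply mul_left_cancel₀ (X_sub_X_ne_zero h0)
  have := congrArg (swapVar p' q') (divDiff_spec p q f)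
  simp only [map_mul, map_sub, swapVar_X, Equiv.swap_apply_of_ne_of_ne h1 h2,
    Equiv.swap_apply_of_ne_of_ne h3 h4] at this
  rw [this, divDiff_spec, swapVar_far h1 h2 h3 h4]

theorem divDiff_far {p q p' q' : Fin N} (h0 : p ≠ q) (h0' : p' ≠ q') (h1 : p ≠ p') (h2 : p ≠ q')
    (h3 : q ≠ p') (h4 : q ≠ q') (f : MvPolynomial (Fin N) ℂ) :
    divDiff p q (divDiff p' q' f) = divDiff p' q' (divDiff p q f) := by
  apply mul_left_cancel₀ (mul_ne_zero (X_sub_X_ne_zero h0) (X_sub_X_ne_zero h0'))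
  have a1 := divDiff_spec p q (divDiff p' q' f)
  have a2 := divDiff_spec p' q' (divDiff p q f)
  rw [swapVar_divDiff_far h0' h1.symm h3.symm h2.symm h4.symm] at a1
  rw [swapVar_divDiff_far h0 h1 h2 h3 h4] at a2
  have a3 := divDiff_spec p' q' (swapVar p q f)
  have a4 := divDiff_spec p q (swapVar p' q' f)
  have a5 := divDiff_spec p' q' f
  have a6 := divDiff_spec p q f
  rw [swapVar_far h1 h2 h3 h4] at a4
  linear_combination (MvPolynomial.X q' - MvPolynomial.X p') * a1
    - (MvPolynomial.X q - MvPolynomial.X p) * a2 + a3 - a4 - a5 + a6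

theorem cross_far {p q p' q' : Fin N} (h0 : p ≠ q) (h0' : p' ≠ q') (h1 : p ≠ p') (h2 : p ≠ q')
    (h3 : q ≠ p') (h4 : q ≠ q') (a b a' b' : Fin n) (f : MvPolynomial (Fin N) ℂ) :
    cross a b p q (cross a' b' p' q' f) = cross a' b' p' q' (cross a b p q f) := by
  have s1 : swapVar p q (factor a' b' p' q') = factor a' b' p' q' := by
    rw [swapVar_factor, Equiv.swap_apply_of_ne_of_ne h1.symm h3.symm,
      Equiv.swap_apply_of_ne_of_ne h2.symm h4.symm]
  have s2 : swapVar p' q' (factor a b p q) = factor a b p q := by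
    rw [swapVar_factor, Equiv.swap_apply_of_ne_of_ne h1 h2, Equiv.swap_apply_of_ne_of_ne h3 h4]
  by_cases hab : a = b
  · subst hab
    by_cases hr : IsRed a
    · simp [cross_red hr]
    by_cases hab' : a' = b'
    · subst hab'
      by_cases hr' : IsRed a'
      · simp [cross_red hr']
      simp only [cross_same hr, cross_same hr', divDiff_far h0 h0' h1 h2 h3 h4]
    · simp only [cross_same hr, cross_diff hab']
      rw [divDiff_mul h0, s1, divDiff_of_symm h0 s1, swapVar_divDiff_far h0 h1 h2 h3 h4]
      ring
  · by_cases hab' : a' = b'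
    · subst hab'
      by_cases hr' : IsRed a'
      · simp [cross_red hr']
      simp only [cross_same hr', cross_diff hab]
      rw [divDiff_mul h0', s2, divDiff_of_symm h0' s2,
        swapVar_divDiff_far h0' h1.symm h3.symm h2.symm h4.symm]
      ring
    · simp only [cross_diff hab, cross_diff hab', map_mul, s1, s2, swapVar_far h1 h2 h3 h4]
      ring

theorem poly_rel {a b : Free n N} (h : Rel n N a b) :
    FreeAlgebra.lift ℂ (polyGen (n := n) (N := N)) a = FreeAlgebra.lift ℂ polyGen b := by
  have hE : ∀ w : Word n N, FreeAlgebra.lift ℂ polyGen (fe w) = polyGen (Gen.e w) := fun w => by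
    simp [fe]
  have hY : ∀ k : Fin N,
      FreeAlgebra.lift ℂ (polyGen (n := n)) (fy k) = polyGen (Gen.y k) := fun k => by
    simp [fy]
  have hP : ∀ k : Fin (N - 1),
      FreeAlgebra.lift ℂ (polyGen (n := n)) (fpsi k) = polyGen (Gen.psi k) := fun k => by
    simp [fpsi]
  have ap : ∀ (g h : Module.End ℂ (Poly n N)) (x : Poly n N), (g * h) x = g (h x) :=
    fun _ _ _ => rfl
  apply Poly.hom_ext
  intro v f
  -- it is enough to check the local relations on the summand of the word at the bottom
  have red : ∀ (g h : Module.End ℂ (Poly n N)) (w : Word n N),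
      (w = v → g (Poly.single v f) = h (Poly.single v f)) →
      (g * polyGen (Gen.e w)) (Poly.single v f) = (h * polyGen (Gen.e w)) (Poly.single v f) := by
    intro g h w H
    rw [ap, ap, polyGen_e]
    split_ifs with hw
    · exact H hw
    · rw [map_zero, map_zero]
  cases h with
  | e_mul_self w =>
    rw [map_mul, hE, ap, polyGen_e]
    split_ifs with hw <;> simp [polyGen_e, hw]
  | e_mul_ne w w' h =>
    rw [map_mul, hE, hE, ap, polyGen_e, map_zero]
    split_ifs with hw
    · subst hw; simp [polyGen_e, h]
    · simp
  | e_sum =>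
    simp only [map_sum, hE, map_one, LinearMap.sum_apply, polyGen_e]
    simp
  | y_e k w =>
    rw [map_mul, map_mul, hE, hY, ap, ap, polyGen_e, polyGen_y, polyGen_e]
    split_ifs <;> simp [polyGen_y]
  | psi_e k w =>
    rw [map_mul, map_mul, hE, hE, hP, ap, ap, polyGen_e, polyGen_psi, polyGen_e]
    by_cases hw : w = v
    · subst hw; simp [polyGen_psi]
    · have : w.swap k ≠ v.swap k := fun h => hw (by simpa using congrArg (Word.swap k) h)
      simp [hw, this]
  | psi_red k w h hr =>
    rw [map_mul, hE, hP, map_zero, ap, polyGen_e]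
    split_ifs with hw
    · subst hw
      rw [polyGen_psi, ← h, cross_red hr]
      simp
    · simp
  | y_y k l =>
    simp only [map_mul, hY, ap, polyGen_y]
    congr 1; ring
  | psi_y_far k l h h' =>
    simp only [map_mul, hY, hP, ap, polyGen_y, polyGen_psi]
    rw [cross_X_mul_far (lo_ne_hi k) h h']
  | psi_psi_far k l h =>
    have a1 : lo k ≠ lo l := by simp [lo, Fin.ext_iff]; omega
    have a2 : lo k ≠ hi l := by simp [lo, hi, Fin.ext_iff]; omega
    have a3 : hi k ≠ lo l := by simp [lo, hi, Fin.ext_iff]; omega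
    have a4 : hi k ≠ hi l := by simp [hi, Fin.ext_iff]; omega
    simp only [map_mul, hP, ap, polyGen_psi]
    rw [swap_of_ne l v (lo k) a1 a2, swap_of_ne l v (hi k) a3 a4, swap_of_ne k v (lo l) a1.symm
      a3.symm, swap_of_ne k v (hi l) a2.symm a4.symm, swap_far h,
      cross_far (lo_ne_hi k) (lo_ne_hi l) a1 a2 a3 a4]
  | slide_lo k w h =>
    simp only [map_mul, hE, hY, hP]
    refine red _ _ w fun hw => ?_
    subst hw
    simp only [ap, polyGen_y, polyGen_psi, cross_diff h, map_mul, swapVar_X,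
      Equiv.swap_apply_right]
    congr 1; ring
  | slide_hi k w h =>
    simp only [map_mul, hE, hY, hP]
    refine red _ _ w fun hw => ?_
    subst hw
    simp only [ap, polyGen_y, polyGen_psi, cross_diff h, map_mul, swapVar_X,
      Equiv.swap_apply_left]
    congr 1; ring
  | nil_lo k w h hr =>
    rw [map_mul, hE, ← one_mul (polyGen (Gen.e w))]
    rw [← mul_assoc]
    refine red _ _ w fun hw => ?_
    subst hw
    simp only [map_sub, map_mul, hY, hP, mul_one, LinearMap.sub_apply, ap, polyGen_y, polyGen_psi,
      ← h, cross_same hr, swap_eq_self k w h, divDiff_mul (lo_ne_hi k), swapVar_X,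
      Equiv.swap_apply_right, divDiff_X_right (lo_ne_hi k), Module.End.one_apply]
    rw [← map_sub]
    congr 1; ring
  | nil_hi k w h hr =>
    rw [map_mul, hE, ← one_mul (polyGen (Gen.e w))]
    rw [← mul_assoc]
    refine red _ _ w fun hw => ?_
    subst hw
    simp only [map_sub, map_mul, hY, hP, mul_one, LinearMap.sub_apply, ap, polyGen_y, polyGen_psi,
      ← h, cross_same hr, swap_eq_self k w h, divDiff_mul (lo_ne_hi k), swapVar_X,
      Equiv.swap_apply_left, divDiff_X_left (lo_ne_hi k), Module.End.one_apply]
    rw [← map_sub]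
    congr 1; ring
  | bigon_eq k w h =>
    rw [map_zero, ← zero_mul (polyGen (Gen.e w))]
    simp only [map_mul, hE, hP]
    refine red _ _ w fun hw => ?_
    subst hw
    simp only [ap, polyGen_psi, swap_eq_self k w h, ← h]
    by_cases hr : IsRed (w (lo k))
    · simp [cross_red hr]
    · simp [cross_same hr, divDiff_divDiff (lo_ne_hi k)]
  | bigon_far k w h h₁ h₂ =>
    rw [hE, ← one_mul (polyGen (Gen.e w))]
    simp only [map_mul, hE, hP]
    refine red _ _ w fun hw => ?_
    subst hw
    simp only [ap, polyGen_psi, swap_swap, swap_lo, swap_hi, cross_diff h, cross_diff h.symm,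
      factor, h₁, h₂, if_false, one_mul, swapVar_swapVar, Module.End.one_apply]
  | bigon_up k w h =>
    have hne : w (lo k) ≠ w (hi k) := by intro h'; rw [IsSucc, h'] at h; omega
    have h₂ : ¬ IsSucc (w (hi k)) (w (lo k)) := by simp only [IsSucc] at *; omega
    simp only [map_mul, hE, hP]
    refine red _ _ w fun hw => ?_
    subst hw
    simp only [ap, map_sub, hY, LinearMap.sub_apply, polyGen_y, polyGen_psi, swap_swap, swap_lo,
      swap_hi, cross_diff hne, cross_diff hne.symm, factor, h, h₂, if_true, if_false, one_mul,
      map_mul, swapVar_swapVar, swapVar_X, Equiv.swap_apply_left, Equiv.swap_apply_right]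
    rw [← map_sub]
    congr 1; ring
  | bigon_down k w h =>
    have hne : w (lo k) ≠ w (hi k) := by intro h'; rw [IsSucc, h'] at h; omega
    have h₂ : ¬ IsSucc (w (lo k)) (w (hi k)) := by simp only [IsSucc] at *; omega
    simp only [map_mul, hE, hP]
    refine red _ _ w fun hw => ?_
    subst hw
    simp only [ap, map_sub, hY, LinearMap.sub_apply, polyGen_y, polyGen_psi, swap_swap, swap_lo,
      swap_hi, cross_diff hne, cross_diff hne.symm, factor, h, h₂, if_true, if_false, one_mul,
      swapVar_swapVar]
    rw [← map_sub]
    congr 1; ring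
  | triple k l hkl w h₁ h₂ h₃ =>
    have hl : lo l = hi k := lo_eq_hi hkl
    have d1 : lo k ≠ hi l := by simp [lo, hi, Fin.ext_iff]; omega
    have d2 : hi k ≠ hi l := by rw [← hl]; exact lo_ne_hi l
    have d3 : lo k ≠ lo l := by rw [hl]; exact lo_ne_hi k
    rw [map_mul, map_smul, hE, ← smul_one_mul]
    refine red _ _ w fun hw => ?_
    subst hw
    simp only [map_sub, map_mul, hP, LinearMap.sub_apply, ap, polyGen_psi, LinearMap.smul_apply,
      Module.End.one_apply]
    rw [← swap_braid hkl, ← map_sub]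
    have v1 : (w.swap k) (lo l) = w (lo k) := by rw [hl, swap_hi]
    have v2 : (w.swap k) (hi l) = w (hi l) := swap_of_ne k w _ d1.symm d2.symm
    have v3 : ((w.swap k).swap l) (lo k) = w (hi k) := by
      rw [swap_of_ne l _ _ d3 d1, swap_lo]
    have v4 : ((w.swap k).swap l) (hi k) = w (hi l) := by
      rw [← hl, swap_lo, v2]
    have u1 : (w.swap l) (lo k) = w (lo k) := swap_of_ne l w _ d3 d1
    have u2 : (w.swap l) (hi k) = w (hi l) := by rw [← hl, swap_lo]
    have u3 : ((w.swap l).swap k) (lo l) = w (lo k) := by rw [hl, swap_hi, u1]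
    have u4 : ((w.swap l).swap k) (hi l) = w (hi k) := by
      rw [swap_of_ne k _ _ d1.symm d2.symm, swap_hi, hl]
    rw [v1, v2, v3, v4, u1, u2, u3, u4, hl]
    rw [hl] at h₁ h₃
    rw [cross_braid (lo_ne_hi k) d1 d2 _ _ _ h₁ h₂ h₃, map_smul]
    by_cases hac : w (lo k) = w (hi l)
    · suffices hs : ((w.swap k).swap l).swap k = w by rw [hs]
      funext x
      by_cases x1 : x = lo k
      · subst x1; rw [swap_lo, v4, hac]
      by_cases x2 : x = hi k
      · subst x2; rw [swap_hi, v3]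
      by_cases x3 : x = hi l
      · subst x3; rw [swap_of_ne k _ _ x1 x2, swap_hi, v1, hac]
      rw [swap_of_ne k _ _ x1 x2, swap_of_ne l _ _ (hl ▸ x2) x3, swap_of_ne k _ _ x1 x2]
    · simp [braidCoeff, hac]

/-- The polynomial representation. -/
noncomputable def polyRep (n N : ℕ) : KLRW n N →ₐ[ℂ] Module.End ℂ (Poly n N) :=
  RingQuot.liftAlgHom ℂ ⟨FreeAlgebra.lift ℂ polyGen, fun _ _ h => poly_rel h⟩

/-- The full dual space of the polynomial representation.  It is a left module through the
reflection: `(a • ξ) p = ξ (flip a · p)`. -/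
def PolyDual (n N : ℕ) : Type := Poly n N →ₗ[ℂ] ℂ

noncomputable instance (n N : ℕ) : AddCommGroup (PolyDual n N) :=
  inferInstanceAs (AddCommGroup (Poly n N →ₗ[ℂ] ℂ))

/-- The transpose action on functionals of an element of the algebra. -/
noncomputable def dualAct (a : KLRW n N) (ξ : PolyDual n N) : PolyDual n N :=
  LinearMap.comp (ξ : Poly n N →ₗ[ℂ] ℂ) (polyRep n N (MulOpposite.unop (flip n N a)))

noncomputable instance (n N : ℕ) : Module (KLRW n N) (PolyDual n N) where
  smul := dualAct
  one_smul ξ := by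
    change dualAct 1 ξ = ξ
    rw [dualAct, map_one, MulOpposite.unop_one, map_one]
    rfl
  mul_smul a b ξ := by
    change dualAct (a * b) ξ = dualAct a (dualAct b ξ)
    rw [dualAct, map_mul, MulOpposite.unop_mul, map_mul]
    rfl
  smul_zero a := LinearMap.zero_comp _
  smul_add a ξ η := LinearMap.add_comp _ _ _
  add_smul a b ξ := by
    change dualAct (a + b) ξ = dualAct a ξ + dualAct b ξ
    rw [dualAct, map_add, MulOpposite.unop_add, map_add]
    exact LinearMap.comp_add _ _ _
  zero_smul ξ := by
    change dualAct 0 ξ = 0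
    rw [dualAct, map_zero, MulOpposite.unop_zero, map_zero]
    exact LinearMap.comp_zero _

/-- The evaluation functional of a word: it sends `f e(i)` to the value of `f` at the origin and
vanishes on all the other summands. -/
noncomputable def ev (i : Word n N) : PolyDual n N :=
  ((MvPolynomial.aeval (fun _ : Fin N => (0 : ℂ))).toLinearMap ∘ₗ Poly.coeff i :
    Poly n N →ₗ[ℂ] ℂ)

/-- There is exactly one submodule with a simple quotient. -/
def HasUniqueSimpleQuotient (R M : Type*) [Ring R] [AddCommGroup M] [Module R M] : Prop :=
  ∃! K : Submodule R M, IsSimpleModule R (M ⧸ K)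

/-- The quotient of a module by the intersection of its maximal submodules; if the module has a
unique simple quotient, then this is that simple quotient. -/
abbrev Head (R M : Type*) [Ring R] [AddCommGroup M] [Module R M] : Type _ :=
  M ⧸ Module.jacobson R M

/-- The module `N'(i)` generated by the evaluation functional.  (The functional lies in the
restricted dual, which is a submodule of the full dual, so it generates the same submodule of
both.) -/
noncomputable def preCanonical (i : Word n N) : Submodule (KLRW n N) (PolyDual n N) :=
  Submodule.span (KLRW n N) {ev i}

/-- The evaluation functional as an element of `N'(i)`. -/
noncomputable def preCanonicalGen (i : Word n N) : preCanonical i :=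
  ⟨ev i, Submodule.mem_span_singleton_self _⟩

/-- The canonical module `N(i)`, the unique simple quotient of `N'(i)`. -/
abbrev Canonical (i : Word n N) : Type := Head (KLRW n N) (preCanonical i)

/-- The image of the evaluation functional in `N(i)`. -/
noncomputable def canonicalGen (i : Word n N) : Canonical i :=
  Submodule.Quotient.mk (preCanonicalGen i)

/-- The vector `v` satisfies the defining relations of the standard module of `i`:
`e(i) v = v`, `psi_k v = 0` whenever `i_k - 1 = i_{k+1}`, and `y_k v = 0` for all `k`. -/
def SatisfiesStandardRelations {M : Type*} [AddCommGroup M] [Module (KLRW n N) M]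
    (i : Word n N) (v : M) : Prop :=
  e i • v = v ∧ (∀ k : Fin (N - 1), IsSucc (i (hi k)) (i (lo k)) → psi n k • v = 0) ∧
    ∀ k : Fin N, y n k • v = 0

/-- The left ideal generated by the defining relations of the standard module. -/
noncomputable def standardIdeal (i : Word n N) : Submodule (KLRW n N) (KLRW n N) :=
  Submodule.span (KLRW n N)
    ({e i - 1} ∪ {x | ∃ k : Fin (N - 1), IsSucc (i (hi k)) (i (lo k)) ∧ x = psi n k} ∪
      Set.range (y n))

/-- The standard module of `i`: the universal module generated by one vector subject to the
defining relations. -/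
abbrev Standard (i : Word n N) : Type := KLRW n N ⧸ standardIdeal i

/-- The module `L(i)`, the unique simple quotient of the standard module (for red-good `i`). -/
abbrev SimpleHead (i : Word n N) : Type := Head (KLRW n N) (Standard i)

/-- The image in `L(i)` of the generating vector of the standard module. -/
noncomputable def simpleHeadGen (i : Word n N) : SimpleHead i :=
  Submodule.Quotient.mk (Submodule.Quotient.mk 1)

/-- The degree of a crossing of strands labelled `a` and `b`. -/
def crossDeg (a b : Fin n) : ℤ := if a = b then -2 else if IsSucc a b ∨ IsSucc b a then 1 else 0

/-- A module is gradeable if it admits a `ℤ`-grading by complex subspaces for which the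
idempotents have degree `0`, the dots degree `2`, and crossings the degree `crossDeg`. -/
def Gradeable (n N : ℕ) (M : Type*) [AddCommGroup M] [Module (KLRW n N) M] : Prop :=
  ∃ A : ℤ → AddSubgroup M, DirectSum.IsInternal A ∧
    (∀ (d : ℤ) (c : ℂ), ∀ m ∈ A d, algebraMap ℂ (KLRW n N) c • m ∈ A d) ∧
    (∀ (d : ℤ) (w : Word n N), ∀ m ∈ A d, e w • m ∈ A d) ∧
    (∀ (d : ℤ) (k : Fin N), ∀ m ∈ A d, y n k • m ∈ A (d + 2)) ∧
    ∀ (d : ℤ) (k : Fin (N - 1)) (w : Word n N), ∀ m ∈ A d,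
      (psi n k * e w) • m ∈ A (d + crossDeg (w (lo k)) (w (hi k)))

/-- A simple module which admits a grading. -/
def IsGradeableSimple (n N : ℕ) (M : Type*) [AddCommGroup M] [Module (KLRW n N) M] : Prop :=
  IsSimpleModule (KLRW n N) M ∧ Gradeable n N M

/-- The word `w` occurs in `M`, that is, `e(w) M ≠ 0`. -/
def Occurs (M : Type*) [AddCommGroup M] [Module (KLRW n N) M] (w : Word n N) : Prop :=
  ∃ m : M, e w • m ≠ 0

/-- A word is red-good if it is the lexicographically smallest word occurring in some simple
module. -/
def RedGood (i : Word n N) : Prop :=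
  ∃ (M : Type) (_ : AddCommGroup M) (_ : Module (KLRW n N) M), IsGradeableSimple n N M ∧
    Occurs M i ∧ ∀ j : Word n N, Occurs M j → toLex i ≤ toLex j

end KLRW

/-!
Both `N'(i)` and the standard module of `i` are generated by a vector of the word `i` satisfying
the relations `(*)` of `SatisfiesStandardRelations`.  In each case uniqueness of the simple quotient
means that the sum of all proper submodules is proper, and it is enough to look at the intersection
of a submodule with the part of the word `i` (`hasUniqueSimpleQuotient_of_smul_mem`).

*The modules `N'(i)`.*  The functional `ev_i` satisfies the relations `(*)` for every word `i`
(`satisfiesStandardRelations_ev`), and up to scalars it is the only functional on the summand of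
`i` killed by all dots (`eq_smul_ev`).  A functional in `N'(i)` vanishes on polynomials of high
order, so the dots act nilpotently on each element of `N'(i)`.  Hence every submodule `K` with
`e(i) K ≠ 0` contains the generator `ev_i`, and the sum of all proper submodules is proper.

*Minimal words are sorted.*  The bigon and triple point relations give Serre-type implications
between the words which occur in a module.  By means of these one shows that the smallest word of a
module is a concatenation of segments `b, b - 1, ..., a` with weakly increasing `b`, where `a` is
weakly increasing as well for black segments with the same `b` (`isSorted_of_minimal`).

*Standard modules of sorted words.*  Let `v` satisfy `(*)` for a sorted word `i`.  Up to diagrams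
with fewer crossings, a product of crossings depends only on the underlying permutation, so the
diagrams with reduced words applied to `v` span, and a diagram whose permutation inverts a link
`i_k - 1 = i_{k+1}` of a segment, or the order of two red strands, can be omitted
(`psiProd_smul_mem_span`).  A permutation which preserves a sorted word and inverts none of these
pairs is the identity or has negative degree (`IsShuffle.sum_crossDeg_neg`).  So the part of the
word `i` of the module generated by `v` is spanned by `v` and vectors of negative degree, and since
degrees are bounded below, elements of negative degree act nilpotently on `v`.  Therefore any
vector with a nonzero coefficient at `v` generates the module, and the simple quotient is unique
(`hasUniqueSimpleQuotient_of_isSorted`).  Note that no grading of the module is used.  Consequently,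
two simple modules with nonzero vectors satisfying `(*)` for the same sorted word are isomorphic.

*Simple modules.*  Symmetric polynomials in the dots are central.  On a gradeable simple module
those without constant term act by zero, since they raise degrees (`smul_eq_zero_of_shift`), and
thus the dots are nilpotent.  If `i` is the smallest word of such a module `M`, then `e(i) M`
contains a nonzero vector killed by the dots; it satisfies `(*)` by minimality of `i`.  Both `M` and
`N(i)` are therefore the simple quotient of the standard module of `i`.
-/

namespace KLRW

variable {n N : ℕ}

/-! ### Modules with a unique simple quotient -/

section UniqueSimpleQuotient

variable {R X Y : Type*} [Ring R] [AddCommGroup X] [Module R X] [AddCommGroup Y] [Module R Y]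

/-- A cyclic module has a unique simple quotient as soon as some operator `a` moves the generator
out of an additive subgroup `S` but moves every proper submodule into `S`: the sum of all proper
submodules is then still proper. -/
theorem hasUniqueSimpleQuotient_of_smul_mem {v : X} (hv : Submodule.span R {v} = ⊤) (a : R)
    (S : AddSubgroup X) (haS : a • v ∉ S)
    (hS : ∀ K : Submodule R X, v ∉ K → ∀ x ∈ K, a • x ∈ S) :
    HasUniqueSimpleQuotient R X := by
  let K₀ : Submodule R X :=
    { carrier := {x | ∀ r : R, a • r • x ∈ S}
      zero_mem' := fun r => by simp [S.zero_mem]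
      add_mem' := fun {x y} hx hy r => by
        rw [smul_add, smul_add]; exact S.add_mem (hx r) (hy r)
      smul_mem' := fun c x hx r => by
        change a • r • c • x ∈ S
        rw [smul_smul r]; exact hx (r * c) }
  have hv₀ : v ∉ K₀ := fun h => haS (by simpa using h 1)
  have hle : ∀ K : Submodule R X, K ≠ ⊤ → K ≤ K₀ := fun K hK x hx r =>
    hS K (fun h => hK (top_le_iff.mp (hv ▸ (Submodule.span_singleton_le_iff_mem _ _).mpr h)))
      _ (K.smul_mem r hx)
  have hco : IsCoatom K₀ :=
    ⟨fun h => hv₀ (h ▸ Submodule.mem_top), fun K hK => by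
      by_contra h
      exact absurd (hle K h) (not_le_of_gt hK)⟩
  refine ⟨K₀, isSimpleModule_iff_isCoatom.mpr hco, fun K hK => ?_⟩
  have hK := isSimpleModule_iff_isCoatom.mp hK
  exact (hK.le_iff_eq hco.1).mp (hle K hK.1) |>.symm

/-- If a module with a unique simple quotient surjects onto a simple module, then the kernel is
the intersection of all maximal submodules. -/
theorem HasUniqueSimpleQuotient.ker_eq_jacobson (h : HasUniqueSimpleQuotient R X)
    [IsSimpleModule R Y] {f : X →ₗ[R] Y} (hf : Function.Surjective f) :
    LinearMap.ker f = Module.jacobson R X := by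
  have hker : IsCoatom (LinearMap.ker f) := LinearMap.isCoatom_ker_of_surjective hf
  refine le_antisymm (le_sInf fun K hK => ?_) (sInf_le hker)
  rw [h.unique (isSimpleModule_iff_isCoatom.mpr hK) (isSimpleModule_iff_isCoatom.mpr hker)]

/-- The simple quotient of `X` is isomorphic to any simple module which `X` surjects onto. -/
theorem HasUniqueSimpleQuotient.exists_head_equiv (h : HasUniqueSimpleQuotient R X)
    [IsSimpleModule R Y] {f : X →ₗ[R] Y} (hf : Function.Surjective f) :
    ∃ φ : Head R X ≃ₗ[R] Y, ∀ x, φ (Submodule.Quotient.mk x) = f x :=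
  ⟨(Submodule.quotEquivOfEq _ _ (h.ker_eq_jacobson hf).symm).trans
    (f.quotKerEquivOfSurjective hf), fun _ => rfl⟩

theorem HasUniqueSimpleQuotient.isSimpleModule_head (h : HasUniqueSimpleQuotient R X) :
    IsSimpleModule R (Head R X) := by
  obtain ⟨K, hK, -⟩ := id h
  have := h.ker_eq_jacobson (f := K.mkQ) K.mkQ_surjective
  rw [Submodule.ker_mkQ] at this
  change IsSimpleModule R (X ⧸ Module.jacobson R X)
  rwa [← this]

end UniqueSimpleQuotient

/-! ### The defining relations as operators on a module -/

section Relations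

variable {X : Type*} [AddCommGroup X] [Module (KLRW n N) X] {w : Word n N} {x : X}

theorem flip_e (w : Word n N) : flip n N (e w) = MulOpposite.op (e w) :=
  (RingQuot.liftAlgHom_mkAlgHom_apply ℂ _ _ _).trans (FreeAlgebra.lift_ι_apply _ _)

theorem flip_y (k : Fin N) : flip n N (y n k) = MulOpposite.op (y n k) :=
  (RingQuot.liftAlgHom_mkAlgHom_apply ℂ _ _ _).trans (FreeAlgebra.lift_ι_apply _ _)

theorem flip_psi (k : Fin (N - 1)) : flip n N (psi n k) = MulOpposite.op (psi n k) :=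
  (RingQuot.liftAlgHom_mkAlgHom_apply ℂ _ _ _).trans (FreeAlgebra.lift_ι_apply _ _)

theorem polyRep_e (w : Word n N) : polyRep n N (e w) = polyGen (Gen.e w) :=
  (RingQuot.liftAlgHom_mkAlgHom_apply ℂ _ _ _).trans (FreeAlgebra.lift_ι_apply _ _)

theorem polyRep_y (k : Fin N) : polyRep n N (y n k) = polyGen (Gen.y k) :=
  (RingQuot.liftAlgHom_mkAlgHom_apply ℂ _ _ _).trans (FreeAlgebra.lift_ι_apply _ _)

theorem polyRep_psi (k : Fin (N - 1)) : polyRep n N (psi n k) = polyGen (Gen.psi k) :=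
  (RingQuot.liftAlgHom_mkAlgHom_apply ℂ _ _ _).trans (FreeAlgebra.lift_ι_apply _ _)

/-- Induction on elements of the algebra. -/
theorem induction_on {P : KLRW n N → Prop} (a : KLRW n N)
    (hC : ∀ c : ℂ, P (algebraMap ℂ (KLRW n N) c)) (he : ∀ w, P (e w)) (hy : ∀ k, P (y n k))
    (hpsi : ∀ k, P (psi n k)) (hadd : ∀ a b, P a → P b → P (a + b))
    (hmul : ∀ a b, P a → P b → P (a * b)) : P a := by
  obtain ⟨b, rfl⟩ := RingQuot.mkAlgHom_surjective ℂ (Rel n N) a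
  induction b using FreeAlgebra.induction with
  | grade0 c => rw [AlgHom.commutes]; exact hC c
  | grade1 g =>
    cases g with
    | e w => exact he w
    | y k => exact hy k
    | psi k => exact hpsi k
  | mul a b ha hb => rw [map_mul]; exact hmul _ _ ha hb
  | add a b ha hb => rw [map_add]; exact hadd _ _ ha hb

/-- An additive subgroup of a module which is stable under scalars and generators is stable under
the algebra. -/
theorem smul_mem_of_generators (S : AddSubgroup X)
    (hC : ∀ (c : ℂ), ∀ x ∈ S, algebraMap ℂ (KLRW n N) c • x ∈ S)
    (he : ∀ (w : Word n N), ∀ x ∈ S, e w • x ∈ S) (hy : ∀ (k : Fin N), ∀ x ∈ S, y n k • x ∈ S)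
    (hpsi : ∀ (k : Fin (N - 1)), ∀ x ∈ S, psi n k • x ∈ S) (a : KLRW n N) (x : X) (hx : x ∈ S) :
    a • x ∈ S := by
  revert x
  induction a using induction_on with
  | hC c => exact hC c
  | he w => exact he w
  | hy k => exact hy k
  | hpsi k => exact hpsi k
  | hadd a b ha hb => intro x hx; rw [add_smul]; exact S.add_mem (ha x hx) (hb x hx)
  | hmul a b ha hb => intro x hx; rw [mul_smul]; exact ha _ (hb x hx)

theorem commute_of_generators {z : KLRW n N} (he : ∀ w : Word n N, Commute (e w) z)
    (hy : ∀ k, Commute (y n k) z) (hpsi : ∀ k, Commute (psi n k) z) (a : KLRW n N) :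
    Commute a z := by
  induction a using induction_on with
  | hC c => exact Algebra.commutes c z
  | he w => exact he w
  | hy k => exact hy k
  | hpsi k => exact hpsi k
  | hadd a b ha hb => exact ha.add_left hb
  | hmul a b ha hb => exact ha.mul_left hb

/-- A relation of the form `a e(w) = b e(w)` says that `a` and `b` agree on vectors fixed by
`e(w)`. -/
theorem smul_eq_smul_of_rel {a b : Free n N} (h : Rel n N (a * fe w) (b * fe w))
    (hx : e w • x = x) : mk n N a • x = mk n N b • x := by
  have h := congrArg (· • x) (mk_rel h)
  simpa only [map_mul, mk_fe, mul_smul, hx] using h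

theorem e_smul_of_ne {w' : Word n N} (hx : e w • x = x) (h : w' ≠ w) : e w' • x = 0 := by
  rw [← hx, smul_smul, e_mul_e, if_neg h, zero_smul]

theorem e_smul_e_smul (w : Word n N) (x : X) : e w • e w • x = e w • x := by
  rw [smul_smul, e_mul_e, if_pos rfl]

theorem e_smul_psi_smul (k : Fin (N - 1)) (hx : e w • x = x) :
    e (w.swap k) • psi n k • x = psi n k • x := by
  rw [smul_smul, ← psi_mul_e, mul_smul, hx]

theorem e_smul_y_smul (k : Fin N) (hx : e w • x = x) : e w • y n k • x = y n k • x := by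
  rw [smul_smul, e_mul_y, mul_smul, hx]

theorem psi_smul_of_red {k : Fin (N - 1)} (hx : e w • x = x) (h : w (lo k) = w (hi k))
    (hr : IsRed (w (lo k))) : psi n k • x = 0 := by
  have := congrArg (· • x) (mk_rel (Rel.psi_red k w h hr))
  simpa only [map_mul, mk_fe, mk_fpsi, mul_smul, hx, map_zero, zero_smul] using this

theorem y_smul_y_smul (k l : Fin N) (x : X) : y n k • y n l • x = y n l • y n k • x := by
  have := congrArg (· • x) (mk_rel (Rel.y_y (n := n) k l))
  simpa only [map_mul, mk_fy, mul_smul] using this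

theorem psi_smul_y_smul_far {k : Fin (N - 1)} {l : Fin N} (h : l ≠ lo k) (h' : l ≠ hi k) (x : X) :
    psi n k • y n l • x = y n l • psi n k • x := by
  have := congrArg (· • x) (mk_rel (Rel.psi_y_far (n := n) k l h h'))
  simpa only [map_mul, mk_fy, mk_fpsi, mul_smul] using this

theorem psi_smul_psi_smul_far {k l : Fin (N - 1)} (h : (k : ℕ) + 1 < l) (x : X) :
    psi n k • psi n l • x = psi n l • psi n k • x := by
  have := congrArg (· • x) (mk_rel (Rel.psi_psi_far (n := n) k l h))
  simpa only [map_mul, mk_fpsi, mul_smul] using this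

theorem y_lo_smul_psi_smul_of_ne {k : Fin (N - 1)} (hx : e w • x = x) (h : w (lo k) ≠ w (hi k)) :
    y n (lo k) • psi n k • x = psi n k • y n (hi k) • x := by
  simpa only [map_mul, mk_fy, mk_fpsi, mul_smul] using smul_eq_smul_of_rel (Rel.slide_lo k w h) hx

theorem y_hi_smul_psi_smul_of_ne {k : Fin (N - 1)} (hx : e w • x = x) (h : w (lo k) ≠ w (hi k)) :
    y n (hi k) • psi n k • x = psi n k • y n (lo k) • x := by
  simpa only [map_mul, mk_fy, mk_fpsi, mul_smul] using smul_eq_smul_of_rel (Rel.slide_hi k w h) hx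

theorem y_lo_smul_psi_smul_of_eq {k : Fin (N - 1)} (hx : e w • x = x) (h : w (lo k) = w (hi k))
    (hr : ¬ IsRed (w (lo k))) :
    y n (lo k) • psi n k • x = psi n k • y n (hi k) • x + x := by
  have := congrArg (· • x) (mk_rel (Rel.nil_lo k w h hr))
  simp only [map_mul, map_sub, mk_fe, mk_fy, mk_fpsi, mul_smul, hx, sub_smul] at this
  rw [← sub_eq_iff_eq_add', this]

theorem y_hi_smul_psi_smul_of_eq {k : Fin (N - 1)} (hx : e w • x = x) (h : w (lo k) = w (hi k))
    (hr : ¬ IsRed (w (lo k))) :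
    y n (hi k) • psi n k • x = psi n k • y n (lo k) • x - x := by
  have := congrArg (· • x) (mk_rel (Rel.nil_hi k w h hr))
  simp only [map_mul, map_sub, mk_fe, mk_fy, mk_fpsi, mul_smul, hx, sub_smul] at this
  rw [eq_sub_iff_add_eq', ← eq_sub_iff_add_eq, this]

theorem psi_smul_psi_smul_of_eq {k : Fin (N - 1)} (hx : e w • x = x) (h : w (lo k) = w (hi k)) :
    psi n k • psi n k • x = 0 := by
  have := congrArg (· • x) (mk_rel (Rel.bigon_eq k w h))
  simpa only [map_mul, mk_fe, mk_fpsi, mul_smul, hx, map_zero, zero_smul] using this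

theorem psi_smul_psi_smul_of_far {k : Fin (N - 1)} (hx : e w • x = x) (h : w (lo k) ≠ w (hi k))
    (h₁ : ¬ IsSucc (w (lo k)) (w (hi k))) (h₂ : ¬ IsSucc (w (hi k)) (w (lo k))) :
    psi n k • psi n k • x = x := by
  have := congrArg (· • x) (mk_rel (Rel.bigon_far k w h h₁ h₂))
  simpa only [map_mul, mk_fe, mk_fpsi, mul_smul, hx] using this

theorem psi_smul_psi_smul_of_up {k : Fin (N - 1)} (hx : e w • x = x)
    (h : IsSucc (w (lo k)) (w (hi k))) :
    psi n k • psi n k • x = y n (hi k) • x - y n (lo k) • x := by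
  simpa only [map_mul, map_sub, mk_fy, mk_fpsi, mul_smul, sub_smul] using
    smul_eq_smul_of_rel (Rel.bigon_up k w h) hx

theorem psi_smul_psi_smul_of_down {k : Fin (N - 1)} (hx : e w • x = x)
    (h : IsSucc (w (hi k)) (w (lo k))) :
    psi n k • psi n k • x = y n (lo k) • x - y n (hi k) • x := by
  simpa only [map_mul, map_sub, mk_fy, mk_fpsi, mul_smul, sub_smul] using
    smul_eq_smul_of_rel (Rel.bigon_down k w h) hx

theorem psi_braid_smul {k l : Fin (N - 1)} (hkl : (k : ℕ) + 1 = l) (hx : e w • x = x)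
    (h₁ : ¬ (w (lo k) = w (lo l) ∧ IsRed (w (lo k))))
    (h₂ : ¬ (w (lo k) = w (hi l) ∧ IsRed (w (lo k))))
    (h₃ : ¬ (w (lo l) = w (hi l) ∧ IsRed (w (lo l)))) :
    psi n k • psi n l • psi n k • x - psi n l • psi n k • psi n l • x =
      algebraMap ℂ (KLRW n N) (braidCoeff (w (lo k)) (w (lo l)) (w (hi l))) • x := by
  have := congrArg (· • x) (mk_rel (Rel.triple k l hkl w h₁ h₂ h₃))
  simpa only [map_mul, map_sub, mk_fe, mk_fpsi, mul_smul, hx, sub_smul,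
    Algebra.smul_def, AlgHom.commutes] using this

end Relations

/-! ### Words on which a module vanishes -/

/-- The closure properties of the set `Z` of words `w` with `e(w) M = 0`, for any module `M`:
letters that differ by at least two commute, and for `|c - d| = 1` and `c` different from the red
letter `r` there are the implications that a Serre relation `2 cdc = ccd + dcc` between the
dimensions of the spaces `e(w) M` would give. -/
structure IsVanishing (r : ℕ) (Z : List ℕ → Prop) : Prop where
  swap : ∀ (P S : List ℕ) (a b : ℕ), a + 1 < b ∨ b + 1 < a →
    Z (P ++ a :: b :: S) → Z (P ++ b :: a :: S)
  left : ∀ (P S : List ℕ) (c d : ℕ), c ≠ r → c + 1 = d ∨ d + 1 = c →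
    Z (P ++ c :: d :: c :: S) → Z (P ++ c :: c :: d :: S)
  right : ∀ (P S : List ℕ) (c d : ℕ), c ≠ r → c + 1 = d ∨ d + 1 = c →
    Z (P ++ c :: d :: c :: S) → Z (P ++ d :: c :: c :: S)
  middle : ∀ (P S : List ℕ) (c d : ℕ), c ≠ r → c + 1 = d ∨ d + 1 = c →
    Z (P ++ c :: c :: d :: S) → Z (P ++ d :: c :: c :: S) → Z (P ++ c :: d :: c :: S)

/-- The segment `a + l - 1, ..., a + 1, a`, which decreases in steps of one and has length `l`. -/
def segment (a : ℕ) : ℕ → List ℕ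
  | 0 => []
  | l + 1 => (a + l) :: segment a l

theorem mem_segment {a l x : ℕ} : x ∈ segment a l ↔ a ≤ x ∧ x < a + l := by
  induction l with
  | zero => simp [segment]
  | succ l ih => rw [segment, List.mem_cons, ih]; omega

theorem segment_add (a k l : ℕ) : segment a (l + k) = segment (a + l) k ++ segment a l := by
  induction k with
  | zero => simp [segment]
  | succ k ih => rw [← add_assoc, segment, segment, ih, List.cons_append, add_assoc]

theorem segment_succ' (a l : ℕ) : segment a (l + 1) = segment (a + 1) l ++ [a] := by
  rw [add_comm, segment_add]; rfl

namespace IsVanishing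

variable {r : ℕ} {Z : List ℕ → Prop} (hZ : IsVanishing r Z)
include hZ

/-- A letter commutes with a list of letters that are not adjacent to it. -/
theorem move_right {x : ℕ} {L : List ℕ} (hL : ∀ z ∈ L, x + 1 < z ∨ z + 1 < x) (P S : List ℕ) :
    Z (P ++ x :: (L ++ S)) → Z (P ++ (L ++ x :: S)) := by
  induction L generalizing P with
  | nil => exact id
  | cons z L ih =>
    intro h
    have h := hZ.swap P (L ++ S) x z (hL z (by simp)) h
    simpa using ih (fun z hz => hL z (by simp [hz])) (P ++ [z]) (by simpa using h)

theorem move_left {x : ℕ} {L : List ℕ} (hL : ∀ z ∈ L, x + 1 < z ∨ z + 1 < x) (P S : List ℕ) :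
    Z (P ++ (L ++ x :: S)) → Z (P ++ x :: (L ++ S)) := by
  induction L generalizing P with
  | nil => exact id
  | cons z L ih =>
    intro h
    have h := ih (fun z hz => hL z (by simp [hz])) (P ++ [z]) (by simpa using h)
    exact hZ.swap P (L ++ S) z x (hL z (by simp)).symm (by simpa using h)

/-- If a segment is followed by a smaller letter that is not adjacent to it, the letter may be
moved to the front. -/
theorem of_segment_far {P S : List ℕ} {a l x : ℕ} (hx : x + 1 < a)
    (hmin : ∀ T, Z (P ++ x :: T)) : Z (P ++ (segment a l ++ x :: S)) :=
  hZ.move_right (fun z hz => Or.inl (by have := mem_segment.mp hz; omega)) P S (hmin _)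

/-- A segment from `c + 1` down to `a` cannot be followed by the letter `c ≥ a`. -/
theorem of_segment_near {P S : List ℕ} {a l : ℕ} (hr : a + l ≠ r)
    (hmin : ∀ x ≤ a + l, ∀ T, Z (P ++ x :: T)) :
    Z (P ++ (segment a (l + 2) ++ (a + l) :: S)) := by
  -- for `c = a + l` the word `c + 1, c, c` is excluded by the smaller word `c, c + 1, c`
  have key : ∀ T, Z (P ++ (a + l + 1) :: (a + l) :: (a + l) :: T) := fun T =>
    hZ.right P T (a + l) (a + l + 1) hr (Or.inl rfl) (hmin _ le_rfl _)
  cases l with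
  | zero => exact key S
  | succ l =>
    have h : Z ((P ++ [a + l + 2]) ++ (a + l + 1) :: (a + l) :: (a + l + 1) ::
        (segment a l ++ S)) := by
      refine hZ.middle _ _ _ _ hr (Or.inr rfl) ?_ ?_
      · simpa [add_assoc] using key _
      · -- the letter `c - 1` commutes with `c + 1`, which gives a smaller word
        have h1 := hZ.swap P ((a + l + 1) :: (a + l + 1) :: (segment a l ++ S)) (a + l)
          (a + l + 2) (Or.inl (by omega)) (hmin _ (by omega) _)
        simpa using h1
    have h := hZ.move_right (x := a + l + 1) (L := segment a l)
      (fun z hz => Or.inr (by have := mem_segment.mp hz; omega))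
      (P ++ [a + l + 2, a + l + 1, a + l]) S (by simpa using h)
    simpa [segment, add_assoc] using h

/-- Two adjacent segments with the same top, of lengths `l + 1` and `l`, can be exchanged. The
induction splits off the pair of top letters `c`: the list `Q` collects these pairs. -/
theorem segment_swap {P S : List ℕ} {a b : ℕ} (hmin : ∀ x < b, ∀ T, Z (P ++ x :: T)) (hb : b < r)
    (l : ℕ) (hl : a + l ≤ b) (Q : List ℕ) (hQ : ∀ z ∈ Q, a + l < z)
    (h : Z ((P ++ Q) ++ (segment a (l + 1) ++ (segment (a + 1) l ++ S)))) :
    Z ((P ++ Q) ++ (segment (a + 1) l ++ (segment a (l + 1) ++ S))) := by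
  induction l generalizing Q with
  | zero => simpa [segment] using h
  | succ l ih =>
    have hr : a + l + 1 ≠ r := by omega
    cases l with
    | zero =>
      have h := hZ.left (P ++ Q) S (a + 1) a hr (Or.inr rfl) (by simpa [segment] using h)
      simpa [segment] using h
    | succ l =>
      have hfar : ∀ L : List ℕ, (∀ z ∈ L, z ∈ segment a (l + 1) ∨ z ∈ segment (a + 1) l) → ∀ z ∈ L,
          a + l + 2 + 1 < z ∨ z + 1 < a + l + 2 := fun L hL z hz => Or.inr (by
        rcases hL z hz with h | h <;> have := mem_segment.mp h <;> omega)
      have h1 := hZ.move_left (x := a + l + 2) (L := segment a (l + 1))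
        (hfar _ fun z hz => Or.inl hz) ((P ++ Q) ++ [a + l + 2, a + l + 1])
        (segment (a + 1) (l + 1) ++ S)
        (by
          rw [show segment (a + 1) (l + 1 + 1) = (a + l + 2) :: segment (a + 1) (l + 1) by
            rw [segment]; congr 1; omega] at h
          simpa [segment, add_assoc] using h)
      have h2 := hZ.left (P ++ Q) (segment a (l + 1) ++ (segment (a + 1) (l + 1) ++ S))
        (a + l + 2) (a + l + 1) hr (Or.inr rfl) (by simpa using h1)
      have h3 := ih (by omega) (Q ++ [a + l + 2, a + l + 2])
        (fun z hz => by
          rcases List.mem_append.mp hz with hz | hz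
          · have := hQ z hz; omega
          · simp at hz; omega)
        (by simpa [segment, add_assoc] using h2)
      -- the word with `c - 1` in front of the pair `c, c` is excluded by a smaller word
      have h4 := hZ.move_right (x := a + l + 1) (L := Q)
        (fun z hz => Or.inl (by have := hQ z hz; omega)) P
        ((a + l + 2) :: (a + l + 2) :: (segment (a + 1) l ++ (segment a (l + 2) ++ S)))
        (hmin _ (by omega) _)
      have e1 : a + 1 + l = a + l + 1 := by omega
      have h5 := hZ.middle (P ++ Q) (segment (a + 1) l ++ (segment a (l + 2) ++ S)) (a + l + 2)
        (a + l + 1) hr (Or.inr rfl) (by simpa [segment, add_assoc, e1] using h3)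
        (by simpa using h4)
      have h6 := hZ.move_right (x := a + l + 2) (L := segment (a + 1) l)
        (hfar _ fun z hz => Or.inr hz) ((P ++ Q) ++ [a + l + 2, a + l + 1])
        (segment a (l + 2) ++ S) (by simpa using h5)
      rw [show segment (a + 1) (l + 1 + 1) = (a + l + 2) :: (a + l + 1) :: segment (a + 1) l by
        rw [segment, segment, e1, show a + 1 + (l + 1) = a + l + 2 by omega]]
      simpa [segment, add_assoc] using h6

/-- If two adjacent segments have the same top, then the second one does not extend further down
than the first one. -/
theorem of_segment_segment {P S : List ℕ} {a l k : ℕ} (hb : a + k + 1 + l < r)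
    (hmin : ∀ x < a + k + 1 + l, ∀ T, Z (P ++ x :: T))
    (hmin' : ∀ x < a + k + 1 + l, ∀ T, Z (P ++ (segment (a + k + 1) (l + 1) ++ x :: T))) :
    Z (P ++ (segment (a + k + 1) (l + 1) ++ (segment a (l + k + 2) ++ S))) := by
  have h := hZ.segment_swap (a := a + k) (S := segment a k ++ S) hmin hb (l + 1) (by omega) []
    (by simp) (by
      have := hmin' (a + k) (by omega) (segment (a + k + 1) (l + 1) ++ (segment a k ++ S))
      rw [segment_succ' (a + k) (l + 1)]
      simpa using this)
  rw [show l + k + 2 = k + (l + 2) by omega, segment_add a (l + 2) k]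
  simpa using h

end IsVanishing

/-- The list of the letters of a word, as natural numbers. -/
def Word.letters (w : Word n N) : List ℕ := List.ofFn fun k => (w k : ℕ)

theorem Word.length_letters (w : Word n N) : w.letters.length = N := by simp [letters]

theorem Word.getElem_letters (w : Word n N) (p : ℕ) (hp : p < w.letters.length) :
    w.letters[p] = (w ⟨p, w.length_letters ▸ hp⟩ : ℕ) := by simp [letters]

/-- The words with `e(w) M = 0`. -/
def Vanishes (n N : ℕ) (M : Type*) [AddCommGroup M] [Module (KLRW n N) M] (l : List ℕ) : Prop :=
  ∀ w : Word n N, w.letters = l → ∀ x : M, e w • x = x → x = 0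

/-- Two adjacent letters of the list are the letters at a pair of adjacent positions of the word,
and `Word.swap` exchanges them. -/
theorem exists_position {w : Word n N} {P S : List ℕ} {a b : ℕ} (h : w.letters = P ++ a :: b :: S) :
    ∃ k : Fin (N - 1), (k : ℕ) = P.length ∧ (w (lo k) : ℕ) = a ∧ (w (hi k) : ℕ) = b ∧
      (w.swap k).letters = P ++ b :: a :: S := by
  have hlen : N = P.length + (S.length + 1 + 1) := by
    rw [← w.length_letters, h]; simp
  have hget : ∀ p (hp : p < N), (w ⟨p, hp⟩ : ℕ) = (P ++ a :: b :: S)[p]'(by simp; omega) := by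
    intro p hp
    have := w.getElem_letters p (by rwa [w.length_letters])
    rw [← this]
    simp only [h]
  refine ⟨⟨P.length, by omega⟩, rfl, ?_, ?_, ?_⟩
  · rw [lo, hget]; simp
  · rw [hi, hget]; simp
  · apply List.ext_getElem
    · rw [Word.length_letters]; simp; omega
    intro p hp hp'
    rw [Word.getElem_letters]
    rw [Word.length_letters] at hp
    by_cases h1 : p = P.length
    · have : (⟨p, hp⟩ : Fin N) = lo ⟨P.length, by omega⟩ := by simp [lo, h1]
      rw [this, swap_lo, hi, hget]; simp [h1]
    by_cases h2 : p = P.length + 1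
    · have : (⟨p, hp⟩ : Fin N) = hi ⟨P.length, by omega⟩ := by simp [hi, h2]
      rw [this, swap_hi, lo, hget]; simp [h2]
    rw [swap_of_ne _ _ _ (by simpa [lo] using h1) (by simpa [hi] using h2), hget]
    rcases lt_or_gt_of_ne h1 with h3 | h3
    · rw [List.getElem_append_left h3, List.getElem_append_left h3]
    · obtain ⟨q, rfl⟩ : ∃ q, p = P.length + 2 + q := ⟨p - (P.length + 2), by omega⟩
      rw [List.getElem_append_right (by omega), List.getElem_append_right (by omega)]
      simp [show P.length + 2 + q - P.length = q + 2 by omega]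

section Moves

variable {M : Type*} [AddCommGroup M] [Module (KLRW n N) M] {w : Word n N}

/-- If the strands `k`, `k + 1` carry the same black label in `w`, then on `e(w) M ≠ 0` no dot on
one of them can agree with a dot on a third strand: otherwise the nilHecke relation would write
every vector as `ψ_k u`, which is impossible as `ψ_k² = 0`. -/
theorem eq_zero_of_dot_eq {k : Fin (N - 1)} {q : Fin N} (h : w (lo k) = w (hi k))
    (hr : ¬ IsRed (w (lo k))) (n1 : q ≠ lo k) (n2 : q ≠ hi k)
    (hfix : (∀ z : M, e w • z = z → y n (hi k) • z = y n q • z) ∨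
      (∀ z : M, e w • z = z → y n (lo k) • z = y n q • z)) (x : M) (hx : e w • x = x) : x = 0 := by
  have hpsi : ∀ z : M, e w • z = z → e w • psi n k • z = psi n k • z := by
    intro z hz
    have := e_smul_psi_smul k hz
    rwa [swap_eq_self k w h] at this
  have hu : ∀ z : M, e w • z = z → e w • (y n (lo k) • z - y n (hi k) • z) =
      y n (lo k) • z - y n (hi k) • z := by
    intro z hz
    rw [smul_sub, e_smul_y_smul _ hz, e_smul_y_smul _ hz]
  have key : ∀ z : M, e w • z = z → z = psi n k • (y n (lo k) • z - y n (hi k) • z) := by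
    intro z hz
    rcases hfix with hfix | hfix
    · have h1 := y_hi_smul_psi_smul_of_eq hz h hr
      rw [hfix _ (hpsi z hz), ← psi_smul_y_smul_far n1 n2, ← hfix z hz] at h1
      rw [smul_sub, h1]; abel
    · have h1 := y_lo_smul_psi_smul_of_eq hz h hr
      rw [hfix _ (hpsi z hz), ← psi_smul_y_smul_far n1 n2, ← hfix z hz] at h1
      rw [smul_sub, h1]; abel
  have hzero : ∀ z : M, e w • z = z → psi n k • z = 0 := by
    intro z hz
    rw [key z hz]
    exact psi_smul_psi_smul_of_eq (hu z hz) h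
  rw [key x hx, hzero _ (hu x hx)]

theorem dots_eq_of_swap {k : Fin (N - 1)}
    (hd : IsSucc (w (lo k)) (w (hi k)) ∨ IsSucc (w (hi k)) (w (lo k)))
    (hM : ∀ x : M, e (w.swap k) • x = x → x = 0) (z : M) (hz : e w • z = z) :
    y n (hi k) • z = y n (lo k) • z := by
  have h0 : psi n k • z = 0 := hM _ (e_smul_psi_smul k hz)
  rcases hd with hd | hd
  · have := psi_smul_psi_smul_of_up hz hd
    rw [h0, smul_zero] at this
    exact sub_eq_zero.mp this.symm
  · have := psi_smul_psi_smul_of_down hz hd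
    rw [h0, smul_zero] at this
    exact (sub_eq_zero.mp this.symm).symm

/-- Commuting letters: `ψ_k²` is the identity.  From `cdc` to `ccd` and `dcc`: the bigon relation
equates the dots of `c` and `d`, and the nilHecke relation for the two strands `c` then gives zero.
Back to `cdc`: both sides of the triple point relation vanish, and its error term is a nonzero
scalar. -/
theorem isVanishing_vanishes (n N : ℕ) (M : Type*) [AddCommGroup M] [Module (KLRW n N) M] :
    IsVanishing (n - 1) (Vanishes n N M) where
  swap := by
    intro P S a b hab hZ w hw x hx
    obtain ⟨k, -, ha, hb, hk⟩ := exists_position hw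
    have h0 : psi n k • x = 0 := hZ _ hk _ (e_smul_psi_smul k hx)
    rw [← psi_smul_psi_smul_of_far (k := k) hx, h0, smul_zero]
    · intro h; rw [h] at ha; omega
    · simp only [IsSucc]; omega
    · simp only [IsSucc]; omega
  left := by
    intro P S c d hc hcd hZ w hw x hx
    obtain ⟨k, hk0, hk1, hk2, -⟩ := exists_position hw
    obtain ⟨l, hl0, hl1, hl2, hl⟩ :=
      exists_position (P := P ++ [c]) (a := c) (b := d) (S := S) (by simpa using hw)
    have hkl : (k : ℕ) + 1 = l := by simp [hk0, hl0]
    refine eq_zero_of_dot_eq (k := k) (q := hi l) (Fin.ext (hk1.trans hk2.symm)) ?_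
      (by simp [lo, hi, Fin.ext_iff]; omega) (by simp [hi, Fin.ext_iff]; omega)
      (Or.inl fun z hz => ?_) x hx
    · simp only [IsRed]; omega
    · rw [← lo_eq_hi hkl]
      exact (dots_eq_of_swap (by simp only [IsSucc]; omega)
        (hZ (w.swap l) (by simpa using hl)) z hz).symm
  right := by
    intro P S c d hc hcd hZ w hw x hx
    obtain ⟨k, hk0, hk1, hk2, hk⟩ := exists_position hw
    obtain ⟨l, hl0, hl1, hl2, -⟩ :=
      exists_position (P := P ++ [d]) (a := c) (b := c) (S := S) (by simpa using hw)
    have hkl : (k : ℕ) + 1 = l := by simp [hk0, hl0]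
    refine eq_zero_of_dot_eq (k := l) (q := lo k) (Fin.ext (hl1.trans hl2.symm)) ?_
      (by simp [lo, Fin.ext_iff]; omega) (by simp [lo, hi, Fin.ext_iff]; omega)
      (Or.inr fun z hz => ?_) x hx
    · simp only [IsRed]; omega
    · rw [lo_eq_hi hkl]
      exact dots_eq_of_swap (by simp only [IsSucc]; omega) (hZ (w.swap k) hk) z hz
  middle := by
    intro P S c d hc hcd hZ₁ hZ₂ w hw x hx
    obtain ⟨k, hk0, hk1, hk2, hk⟩ := exists_position hw
    obtain ⟨l, hl0, hl1, hl2, hl⟩ :=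
      exists_position (P := P ++ [c]) (a := d) (b := c) (S := S) (by simpa using hw)
    have hkl : (k : ℕ) + 1 = l := by simp [hk0, hl0]
    have h1 : psi n k • x = 0 := hZ₂ _ hk _ (e_smul_psi_smul k hx)
    have h2 : psi n l • x = 0 := hZ₁ _ (by simpa using hl) _ (e_smul_psi_smul l hx)
    have hac : w (lo k) = w (hi l) := Fin.ext (hk1.trans hl2.symm)
    have h3 := psi_braid_smul hkl hx (fun h => by have := congrArg Fin.val h.1; omega)
      (fun h => by have := h.2; simp only [IsRed] at this; omega)
      (fun h => by have := congrArg Fin.val h.1; omega)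
    simp only [h1, h2, smul_zero, sub_zero] at h3
    rcases hcd with hcd | hcd
    · have s1 : ¬ IsSucc (w (lo l)) (w (lo k)) := by simp only [IsSucc]; omega
      have s2 : IsSucc (w (lo k)) (w (lo l)) := by simp only [IsSucc]; omega
      simpa [braidCoeff, hac, hac ▸ s1, hac ▸ s2] using h3
    · have s2 : IsSucc (w (lo l)) (w (lo k)) := by simp only [IsSucc]; omega
      simpa [braidCoeff, hac, hac ▸ s2, eq_comm] using h3

end Moves

/-! ### The smallest word of a module is sorted -/

/-- The letter at position `p` as a natural number, and `0` beyond the end of the word. -/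
def Word.letter (w : Word n N) (p : ℕ) : ℕ := if h : p < N then w ⟨p, h⟩ else 0

theorem Word.letter_coe (w : Word n N) (p : Fin N) : w.letter p = w p := by
  simp [letter]

/-- A word is cut into its maximal segments decreasing in steps of one; this is the first letter
of the segment which contains the position `p`. -/
def segTop (f : ℕ → ℕ) : ℕ → ℕ
  | 0 => f 0
  | p + 1 => if f (p + 1) + 1 = f p then segTop f p else f (p + 1)

/-- The last letter of the segment which contains the position `p`, if there are `d` positions to
the right of `p`. -/
def segBotAux (f : ℕ → ℕ) : ℕ → ℕ → ℕ
  | p, 0 => f p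
  | p, d + 1 => if f (p + 1) + 1 = f p then segBotAux f (p + 1) d else f p

/-- The last letter of the segment which contains the position `p` of a word of length `N`. -/
def segBot (f : ℕ → ℕ) (N p : ℕ) : ℕ := segBotAux f p (N - 1 - p)

theorem segTop_link {f : ℕ → ℕ} {p : ℕ} (h : f (p + 1) + 1 = f p) :
    segTop f (p + 1) = segTop f p := if_pos h

theorem segTop_start {f : ℕ → ℕ} {p : ℕ} (h : f (p + 1) + 1 ≠ f p) :
    segTop f (p + 1) = f (p + 1) := if_neg h

theorem segBot_link {f : ℕ → ℕ} {p : ℕ} (hp : p + 1 < N) (h : f (p + 1) + 1 = f p) :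
    segBot f N (p + 1) = segBot f N p := by
  rw [segBot, segBot, show N - 1 - p = (N - 1 - (p + 1)) + 1 by omega, segBotAux, if_pos h]

theorem segBot_end {f : ℕ → ℕ} {p : ℕ} (h : f (p + 1) + 1 ≠ f p) : segBot f N p = f p := by
  rw [segBot]
  cases N - 1 - p with
  | zero => rfl
  | succ d => rw [segBotAux, if_neg h]

theorem segBot_last {f : ℕ → ℕ} {p : ℕ} (h : p + 1 = N) : segBot f N p = f p := by
  rw [segBot, show N - 1 - p = 0 by omega, segBotAux]

/-- The segments of the word are weakly increasing: their first letters weakly increase, and among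
segments with the same black first letter the last letters weakly increase. -/
structure IsSorted (w : Word n N) : Prop where
  top_le : ∀ p, p + 1 < N → segTop w.letter p ≤ segTop w.letter (p + 1)
  bot_le : ∀ p, p + 1 < N → segTop w.letter p = segTop w.letter (p + 1) →
    segTop w.letter p + 1 ≠ n → segBot w.letter N p ≤ segBot w.letter N (p + 1)

theorem Word.getElem_letters_eq (w : Word n N) (p : ℕ) (hp : p < w.letters.length) :
    w.letters[p] = w.letter p := by
  rw [getElem_letters, letter, dif_pos]

theorem Word.letter_lt (w : Word n N) {x : ℕ} (hx : x ∈ w.letters) : x < n := by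
  obtain ⟨k, rfl⟩ := (List.mem_ofFn' _ _).mp hx
  exact (w k).2

/-- The letters up to the position `p` end with the beginning of the segment which contains `p`. -/
theorem Word.take_letters (w : Word n N) {p : ℕ} (hp : p < N) :
    ∃ P l, w.letters.take (p + 1) = P ++ segment (w.letter p) (l + 1) ∧
      segTop w.letter p = w.letter p + l := by
  induction p with
  | zero =>
    refine ⟨[], 0, ?_, rfl⟩
    rw [List.take_succ_eq_append_getElem (by rwa [length_letters]), getElem_letters_eq]
    simp [segment]
  | succ p ih =>
    rw [List.take_succ_eq_append_getElem (by rwa [length_letters]), getElem_letters_eq]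
    by_cases h : w.letter (p + 1) + 1 = w.letter p
    · obtain ⟨P, l, h1, h2⟩ := ih (by omega)
      refine ⟨P, l + 1, ?_, ?_⟩
      · rw [h1, ← h, segment_succ' _ (l + 1), List.append_assoc]
      · rw [segTop_link h, h2, ← h]; omega
    · refine ⟨w.letters.take (p + 1), 0, ?_, segTop_start h⟩
      simp [segment]

/-- The letters from the position `p` on begin with the rest of the segment which contains `p`. -/
theorem Word.drop_letters (w : Word n N) {p : ℕ} (hp : p < N) :
    ∃ S l, w.letters.drop p = segment (segBot w.letter N p) (l + 1) ++ S ∧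
      w.letter p = segBot w.letter N p + l := by
  obtain ⟨d, hd⟩ : ∃ d, p + 1 + d = N := ⟨N - (p + 1), by omega⟩
  induction d generalizing p with
  | zero =>
    rw [List.drop_eq_getElem_cons (by rwa [length_letters]), getElem_letters_eq,
      segBot_last (by omega)]
    exact ⟨_, 0, rfl, rfl⟩
  | succ d ih =>
    rw [List.drop_eq_getElem_cons (by rwa [length_letters]), getElem_letters_eq]
    by_cases h : w.letter (p + 1) + 1 = w.letter p
    · obtain ⟨S, l, h1, h2⟩ := ih (p := p + 1) (by omega) (by omega)
      refine ⟨S, l + 1, ?_, ?_⟩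
      · rw [h1, ← segBot_link (by omega) h, ← h, h2]; rfl
      · rw [← h, h2, segBot_link (by omega) h]; omega
    · rw [segBot_end h]
      exact ⟨_, 0, rfl, rfl⟩

section Minimal

variable {M : Type*} [AddCommGroup M] [Module (KLRW n N) M] {i : Word n N}

theorem vanishes_of_lt (hmin : ∀ j : Word n N, Occurs M j → toLex i ≤ toLex j)
    {P S T : List ℕ} {x y : ℕ} (hi : i.letters = P ++ x :: S) (hy : y < x) :
    Vanishes n N M (P ++ y :: T) := by
  intro j hj m hm
  by_contra hne
  refine absurd (hmin j ⟨m, hm.symm ▸ hne⟩) (not_le_of_gt ?_)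
  have hN : P.length < N := by rw [← i.length_letters, hi]; simp
  have hget : ∀ p : Fin N, (j p : ℕ) = j.letters[(p : ℕ)]'(by rw [j.length_letters]; exact p.2) ∧
      (i p : ℕ) = i.letters[(p : ℕ)]'(by rw [i.length_letters]; exact p.2) := fun p =>
    ⟨by rw [Word.getElem_letters], by rw [Word.getElem_letters]⟩
  refine ⟨⟨P.length, hN⟩, fun p hp => Fin.ext ?_, Fin.lt_def.mpr ?_⟩
  · change (j p : ℕ) = i p
    have hp : (p : ℕ) < P.length := hp
    rw [(hget p).1, (hget p).2]
    simp only [hi, hj]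
    rw [List.getElem_append_left hp, List.getElem_append_left hp]
  · change (j ⟨P.length, hN⟩ : ℕ) < i ⟨P.length, hN⟩
    rw [(hget _).1, (hget _).2]
    simpa [hi, hj] using hy

/-- The lexicographically smallest word of a module is sorted. -/
theorem isSorted_of_minimal (hi : Occurs M i)
    (hmin : ∀ j : Word n N, Occurs M j → toLex i ≤ toLex j) : IsSorted i := by
  have hZ := isVanishing_vanishes n N M
  have hni : ¬ Vanishes n N M i.letters := fun h => by
    obtain ⟨m, hm⟩ := hi
    exact hm (h i rfl _ (e_smul_e_smul i m))
  have hlow : ∀ {P S : List ℕ} {x : ℕ}, i.letters = P ++ x :: S →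
      ∀ y < x, ∀ T, Vanishes n N M (P ++ y :: T) := fun h y hy T => vanishes_of_lt hmin h hy
  have hstart : ∀ p, p + 1 < N → i.letter (p + 1) + 1 ≠ i.letter p →
      segTop i.letter p ≤ i.letter (p + 1) := by
    intro p hp h
    by_contra! hlt
    obtain ⟨P, l, h1, h2⟩ := i.take_letters (p := p) (by omega)
    have hdec : i.letters = P ++ (segment (i.letter p) (l + 1) ++
        i.letter (p + 1) :: i.letters.drop (p + 2)) := by
      rw [← List.append_assoc, ← h1, ← i.getElem_letters_eq _ (by rwa [i.length_letters]),
        ← List.drop_eq_getElem_cons, List.take_append_drop]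
    have hn : i.letter p + l < n := i.letter_lt (by rw [hdec]; simp [segment])
    rcases lt_or_ge (i.letter (p + 1)) (i.letter p) with h3 | h3
    · refine hni ?_
      rw [hdec]
      exact hZ.of_segment_far (by omega) (hlow hdec _ (by omega))
    · obtain ⟨l', hl'⟩ := Nat.exists_eq_add_of_le h3
      obtain ⟨m, rfl⟩ : ∃ m, l = l' + 1 + m := ⟨l - (l' + 1), by omega⟩
      rw [show l' + 1 + m + 1 = (l' + 2) + m by omega, segment_add, List.append_assoc, hl',
        ← List.append_assoc] at hdec
      refine hni ?_
      rw [hdec]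
      exact hZ.of_segment_near (by omega) fun x hx => hlow
        (by rw [hdec]; rfl) x (by omega)
  constructor
  · intro p hp
    by_cases h : i.letter (p + 1) + 1 = i.letter p
    · rw [segTop_link h]
    · rw [segTop_start h]; exact hstart p hp h
  · intro p hp htop hblack
    by_cases h : i.letter (p + 1) + 1 = i.letter p
    · rw [segBot_link hp h]
    rw [segTop_start h] at htop
    rw [segBot_end h]
    by_contra! hlt
    obtain ⟨P, l, h1, h2⟩ := i.take_letters (p := p) (by omega)
    obtain ⟨S, l', h3, h4⟩ := i.drop_letters (p := p + 1) (by omega)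
    have hdec : i.letters = P ++ (segment (i.letter p) (l + 1) ++
        (segment (segBot i.letter N (p + 1)) (l' + 1) ++ S)) := by
      rw [← List.append_assoc, ← h1, ← h3, List.take_append_drop]
    have hn : i.letter p + l < n := i.letter_lt (by rw [hdec]; simp [segment])
    obtain ⟨k, hk⟩ := Nat.exists_eq_add_of_lt hlt
    obtain rfl : l' = l + k + 1 := by omega
    rw [hk] at hdec
    refine hni ?_
    rw [hdec]
    exact hZ.of_segment_segment (by omega) (hlow (by rw [hdec]; rfl))
      fun x hx T => by
        rw [← List.append_assoc]
        exact hlow (by rw [hdec, ← List.append_assoc]; rfl) x (by omega) T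

end Minimal

/-! ### Shuffles of a sorted word -/

theorem segTop_induction {f : ℕ → ℕ} {P : ℕ → Prop} (h₀ : ∀ p < N, segTop f p = f p → P p)
    (h₁ : ∀ p, p + 1 < N → f (p + 1) + 1 = f p → P p → P (p + 1)) (p : ℕ) (hp : p < N) : P p := by
  induction p with
  | zero => exact h₀ 0 hp rfl
  | succ p ih =>
    by_cases h : f (p + 1) + 1 = f p
    · exact h₁ p hp h (ih (by omega))
    · exact h₀ _ hp (segTop_start h)

theorem segBot_induction {f : ℕ → ℕ} {P : ℕ → Prop} (h₀ : ∀ p < N, segBot f N p = f p → P p)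
    (h₁ : ∀ p, p + 1 < N → f (p + 1) + 1 = f p → P (p + 1) → P p) (p : ℕ) (hp : p < N) : P p := by
  obtain ⟨d, hd⟩ : ∃ d, p + 1 + d = N := ⟨N - (p + 1), by omega⟩
  induction d generalizing p with
  | zero => exact h₀ p hp (segBot_last (by omega))
  | succ d ih =>
    by_cases h : f (p + 1) + 1 = f p
    · exact h₁ p (by omega) h (ih (p + 1) (by omega) (by omega))
    · exact h₀ _ hp (segBot_end h)

theorem le_segTop (f : ℕ → ℕ) (p : ℕ) : f p ≤ segTop f p := by
  refine segTop_induction (N := p + 1) (P := fun p => f p ≤ segTop f p) (fun p _ h => h.ge)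
    (fun p _ h ih => ?_) p (Nat.lt_succ_self p)
  rw [segTop_link h]; omega

theorem segBot_le (f : ℕ → ℕ) {p : ℕ} (hp : p < N) : segBot f N p ≤ f p := by
  refine segBot_induction (P := fun p => segBot f N p ≤ f p) (fun p _ h => h.le)
    (fun p hp h ih => ?_) p hp
  rw [← segBot_link hp h]; omega

/-- The position `p` is not the beginning of a segment if and only if its letter is not the first
letter of its segment. -/
theorem segTop_ne_iff {f : ℕ → ℕ} {p : ℕ} : segTop f p ≠ f p ↔ ∃ q, q + 1 = p ∧ f p + 1 = f q := by
  constructor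
  · intro h
    cases p with
    | zero => exact absurd rfl h
    | succ p => exact ⟨p, rfl, by by_contra h'; exact h (segTop_start h')⟩
  · rintro ⟨q, rfl, h⟩
    have := le_segTop f q
    rw [segTop_link h]; omega

theorem segBot_ne_iff {f : ℕ → ℕ} {p : ℕ} (hp : p < N) :
    segBot f N p ≠ f p ↔ p + 1 < N ∧ f (p + 1) + 1 = f p := by
  constructor
  · intro h
    by_cases h1 : p + 1 < N
    · exact ⟨h1, by by_contra h'; exact h (segBot_end h')⟩
    · exact absurd (segBot_last (by omega)) h
  · rintro ⟨h1, h⟩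
    have := segBot_le f h1
    rw [← segBot_link h1 h]; omega

theorem IsSorted.segTop_mono {i : Word n N} (hi : IsSorted i) {p q : ℕ} (hpq : p ≤ q) (hq : q < N) :
    segTop i.letter p ≤ segTop i.letter q := by
  induction q, hpq using Nat.le_induction with
  | base => exact le_rfl
  | succ q hpq ih => exact (ih (by omega)).trans (hi.top_le q hq)

theorem IsSorted.segBot_mono {i : Word n N} (hi : IsSorted i) {p q : ℕ} (hpq : p ≤ q) (hq : q < N)
    (h : segTop i.letter p = segTop i.letter q) (hn : segTop i.letter p + 1 ≠ n) :
    segBot i.letter N p ≤ segBot i.letter N q := by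
  induction q, hpq using Nat.le_induction with
  | base => exact le_rfl
  | succ q hpq ih =>
    have h1 := hi.segTop_mono hpq (by omega)
    have h2 := hi.top_le q hq
    exact (ih (by omega) (by omega)).trans (hi.bot_le q hq (by omega) (by omega))

/-- A permutation which does not decrease a function preserves it, as the sum is unchanged. -/
theorem perm_apply_eq_of_le {w : Equiv.Perm (Fin N)} {g : Fin N → ℕ} (h : ∀ q, g q ≤ g (w q))
    (q : Fin N) : g (w q) = g q := by
  have := (Finset.sum_eq_sum_iff_of_le (s := Finset.univ) fun q _ => h q).mp
    (Equiv.sum_comp w g).symm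
  exact (this q (Finset.mem_univ q)).symm

theorem perm_apply_eq_of_ge {w : Equiv.Perm (Fin N)} {g : Fin N → ℕ} (h : ∀ q, g (w q) ≤ g q)
    (q : Fin N) : g (w q) = g q := by
  have := (Finset.sum_eq_sum_iff_of_le (s := Finset.univ) fun q _ => h q).mp (Equiv.sum_comp w g)
  exact this q (Finset.mem_univ q)

/-- An order-preserving permutation of a set of positions is the identity. -/
theorem perm_apply_eq_self {w : Equiv.Perm (Fin N)} {S : Fin N → Prop} (hS : ∀ p, S (w p) ↔ S p)
    (hw : ∀ p q, S p → S q → p < q → w p < w q) (p : Fin N) (hp : S p) : w p = p := by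
  induction p using WellFoundedLT.induction with
  | ind p ih =>
    by_contra hne
    rcases lt_or_gt_of_ne hne with h | h
    · exact hne (w.injective (ih _ h ((hS p).mpr hp)))
    · have hS' : S (w.symm p) := by rw [← hS]; simpa using hp
      rcases lt_trichotomy (w.symm p) p with h1 | h1 | h1
      · have := ih _ h1 hS'
        rw [Equiv.apply_symm_apply] at this
        exact h1.ne this.symm
      · rw [Equiv.symm_apply_eq] at h1
        exact hne h1.symm
      · have := hw _ _ hp hS' h1
        rw [Equiv.apply_symm_apply] at this
        exact absurd h (not_lt_of_gt this)

/-- The pairs of positions whose order is reversed by a permutation. -/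
def inversions (w : Equiv.Perm (Fin N)) : Finset (Fin N × Fin N) :=
  Finset.univ.filter fun x => x.1 < x.2 ∧ w x.2 < w x.1

theorem mem_inversions {w : Equiv.Perm (Fin N)} {x : Fin N × Fin N} :
    x ∈ inversions w ↔ x.1 < x.2 ∧ w x.2 < w x.1 := by
  simp [inversions]

theorem eq_one_of_inversions_eq_empty {w : Equiv.Perm (Fin N)} (h : inversions w = ∅) : w = 1 := by
  ext p : 1
  refine perm_apply_eq_self (S := fun _ => True) (fun _ => Iff.rfl) (fun p q _ _ hpq => ?_) p trivial
  by_contra hlt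
  have : (p, q) ∈ inversions w :=
    mem_inversions.mpr ⟨hpq, lt_of_le_of_ne (not_lt.mp hlt) (w.injective.ne hpq.ne')⟩
  simp [h] at this

/-- A shuffle of the segments of `i` which produces the word `i` again: a permutation which
preserves the letters, and keeps the order of neighbours in a segment and of red letters. -/
structure IsShuffle (i : Word n N) (w : Equiv.Perm (Fin N)) : Prop where
  letter_eq : ∀ p, i (w p) = i p
  link : ∀ p q : Fin N, (p : ℕ) + 1 = q → IsSucc (i q) (i p) → w p < w q
  red : ∀ p q : Fin N, p < q → IsRed (i p) → IsRed (i q) → w p < w q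

namespace IsShuffle

variable {i : Word n N} {w : Equiv.Perm (Fin N)} (h : IsShuffle i w) (hi : IsSorted i)
include h

theorem letter_apply (p : Fin N) : i.letter (w p) = i.letter p := by
  rw [i.letter_coe, i.letter_coe, h.letter_eq]

theorem link_lt {p : ℕ} (hp : p + 1 < N) (hl : i.letter (p + 1) + 1 = i.letter p) :
    w ⟨p, by omega⟩ < w ⟨p + 1, hp⟩ := by
  refine h.link _ _ rfl ?_
  simpa [IsSucc, Word.letter, hp, show p < N by omega] using hl

include hi

theorem segTop_apply (p : Fin N) : segTop i.letter (w p) = segTop i.letter p := by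
  refine perm_apply_eq_of_le (g := fun p : Fin N => segTop i.letter p) (fun q => ?_) p
  obtain ⟨q, hq⟩ := q
  have := segTop_induction (f := i.letter) (N := N)
    (P := fun q => ∀ hq : q < N, segTop i.letter q ≤ segTop i.letter (w ⟨q, hq⟩)) ?_ ?_ q hq hq
  · exact this
  · intro q _ h0 hq
    rw [h0, ← h.letter_apply ⟨q, hq⟩]
    exact le_segTop _ _
  · intro q hq hl ih _
    rw [segTop_link hl]
    exact (ih (by omega)).trans (hi.segTop_mono (h.link_lt hq hl).le (Fin.is_lt _))

/-- A shuffle fixes the segments that begin with a red letter. -/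
theorem apply_eq_self_of_red (p : Fin N) (hp : segTop i.letter p + 1 = n) : w p = p := by
  have hred : ∀ p : Fin N, IsRed (i p) → w p = p := fun p hp =>
    perm_apply_eq_self (S := fun p => IsRed (i p)) (fun p => by rw [h.letter_eq])
      (fun p q hp hq hpq => h.red p q hpq hp hq) p hp
  have hle : ∀ q (hq : q < N), segTop i.letter q + 1 = n → q ≤ w ⟨q, hq⟩ := by
    intro q hq
    refine segTop_induction (f := i.letter) (N := N)
      (P := fun q => ∀ hq : q < N, segTop i.letter q + 1 = n → q ≤ w ⟨q, hq⟩) ?_ ?_ q hq hq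
    · intro q _ h0 hq hn
      rw [hred ⟨q, hq⟩]
      have e1 : i.letter q = i ⟨q, hq⟩ := i.letter_coe ⟨q, hq⟩
      rw [IsRed]; omega
    · intro q hq hl ih _ hn
      rw [segTop_link hl] at hn
      have h1 := ih (by omega) hn
      have h2 : (w ⟨q, by omega⟩ : ℕ) < w ⟨q + 1, hq⟩ := h.link_lt hq hl
      omega
  have := perm_apply_eq_of_le (w := w)
    (g := fun p : Fin N => if segTop i.letter p + 1 = n then (p : ℕ) else 0) (fun q => by
      simp only [h.segTop_apply hi]
      split_ifs with hq
      · exact hle q q.2 hq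
      · exact le_rfl) p
  simp only [h.segTop_apply hi, if_pos hp] at this
  exact Fin.ext this

theorem segBot_apply (p : Fin N) : segBot i.letter N (w p) = segBot i.letter N p := by
  refine perm_apply_eq_of_ge (g := fun p : Fin N => segBot i.letter N p) (fun q => ?_) p
  obtain ⟨q, hq⟩ := q
  have := segBot_induction (f := i.letter) (N := N)
    (P := fun q => ∀ hq : q < N, segBot i.letter N (w ⟨q, hq⟩) ≤ segBot i.letter N q) ?_ ?_ q hq hq
  · exact this
  · intro q _ h0 hq
    rw [h0, ← h.letter_apply ⟨q, hq⟩]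
    exact segBot_le _ (Fin.is_lt _)
  · intro q hq hl ih hq'
    by_cases hn : segTop i.letter q + 1 = n
    · rw [h.apply_eq_self_of_red hi ⟨q, hq'⟩ hn]
    have h1 := h.segTop_apply hi ⟨q, hq'⟩
    have h2 := h.segTop_apply hi ⟨q + 1, hq⟩
    simp only [segTop_link hl] at h1 h2
    rw [← segBot_link hq hl]
    exact (hi.segBot_mono (h.link_lt hq hl).le (Fin.is_lt _) (h1.trans h2.symm)
      (by rwa [h1])).trans (ih hq)

/-- A shuffle moves segments as a whole: the sum over all pairs of neighbours in a segment of the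
differences of their images does not change. -/
theorem apply_succ {p q : Fin N} (hpq : (p : ℕ) + 1 = q) (hl : IsSucc (i q) (i p)) :
    (w p : ℕ) + 1 = w q := by
  classical
  let L : Finset (Fin N × Fin N) := Finset.univ.filter fun x =>
    (x.1 : ℕ) + 1 = x.2 ∧ IsSucc (i x.2) (i x.1)
  have hL : ∀ x, x ∈ L ↔ (x.1 : ℕ) + 1 = x.2 ∧ IsSucc (i x.2) (i x.1) := fun x => by simp [L]
  let A : Finset (Fin N) := Finset.univ.filter fun q => segTop i.letter q ≠ i.letter q
  let B : Finset (Fin N) := Finset.univ.filter fun p => segBot i.letter N p ≠ i.letter p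
  have hA : ∀ g : Fin N → ℕ, ∑ x ∈ L, g x.2 = ∑ q ∈ A, g q := by
    intro g
    refine Finset.sum_bij (fun x _ => x.2) (fun x hx => ?_) (fun x hx y hy hxy => ?_)
      (fun q hq => ?_) (fun _ _ => rfl)
    · obtain ⟨h1, h2⟩ := (hL x).mp hx
      simp only [A, Finset.mem_filter, Finset.mem_univ, true_and, segTop_ne_iff]
      exact ⟨_, h1, by rw [i.letter_coe, i.letter_coe]; exact h2⟩
    · have h1 := ((hL x).mp hx).1
      have h2 := ((hL y).mp hy).1
      rw [hxy] at h1
      exact Prod.ext (Fin.ext (by omega)) hxy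
    · simp only [A, Finset.mem_filter, Finset.mem_univ, true_and, segTop_ne_iff] at hq
      obtain ⟨p, h1, h2⟩ := hq
      refine ⟨(⟨p, by omega⟩, q), (hL _).mpr ⟨h1, ?_⟩, rfl⟩
      rw [IsSucc, ← i.letter_coe, ← i.letter_coe]
      exact h2
  have hB : ∀ g : Fin N → ℕ, ∑ x ∈ L, g x.1 = ∑ q ∈ B, g q := by
    intro g
    refine Finset.sum_bij (fun x _ => x.1) (fun x hx => ?_) (fun x hx y hy hxy => ?_)
      (fun p hp => ?_) (fun _ _ => rfl)
    · obtain ⟨h1, h2⟩ := (hL x).mp hx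
      simp only [B, Finset.mem_filter, Finset.mem_univ, true_and, segBot_ne_iff x.1.2]
      exact ⟨by omega, by rw [h1, i.letter_coe, i.letter_coe]; exact h2⟩
    · have h1 := ((hL x).mp hx).1
      have h2 := ((hL y).mp hy).1
      rw [hxy] at h1
      exact Prod.ext hxy (Fin.ext (by omega))
    · simp only [B, Finset.mem_filter, Finset.mem_univ, true_and, segBot_ne_iff p.2] at hp
      obtain ⟨h1, h2⟩ := hp
      refine ⟨(p, ⟨p + 1, h1⟩), (hL _).mpr ⟨rfl, ?_⟩, rfl⟩
      rw [IsSucc, ← i.letter_coe, ← i.letter_coe]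
      exact h2
  have hA' : ∑ q ∈ A, (w q : ℕ) = ∑ q ∈ A, (q : ℕ) :=
    Finset.sum_equiv w (fun q => by simp [A, h.segTop_apply hi, h.letter_apply]) (fun _ _ => rfl)
  have hB' : ∑ q ∈ B, (w q : ℕ) = ∑ q ∈ B, (q : ℕ) :=
    Finset.sum_equiv w (fun q => by simp [B, h.segBot_apply hi, h.letter_apply]) (fun _ _ => rfl)
  have hle : ∀ x ∈ L, (w x.1 : ℕ) + 1 ≤ w x.2 := fun x hx =>
    h.link _ _ ((hL x).mp hx).1 ((hL x).mp hx).2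
  refine (Finset.sum_eq_sum_iff_of_le hle).mp ?_ (p, q) ((hL _).mpr ⟨hpq, hl⟩)
  rw [hA fun q => (w q : ℕ), hA', ← hA, Finset.sum_add_distrib, hB fun q => (w q : ℕ), hB', ← hB,
    ← Finset.sum_add_distrib]
  exact Finset.sum_congr rfl fun x hx => ((hL x).mp hx).1

theorem segTop_eq {p q : Fin N} (hpq : p < q) (hw : w q < w p) :
    segTop i.letter p = segTop i.letter q := by
  refine le_antisymm (hi.segTop_mono hpq.le q.2) ?_
  have := hi.segTop_mono hw.le (w p).2
  rwa [h.segTop_apply hi, h.segTop_apply hi] at this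

theorem segBot_eq {p q : Fin N} (hpq : p < q) (hw : w q < w p) :
    segBot i.letter N p = segBot i.letter N q := by
  have ht := h.segTop_eq hi hpq hw
  have hn : segTop i.letter p + 1 ≠ n := fun hn => by
    rw [h.apply_eq_self_of_red hi p hn, h.apply_eq_self_of_red hi q (ht ▸ hn)] at hw
    exact absurd hpq (not_lt_of_gt hw)
  refine le_antisymm (hi.segBot_mono hpq.le q.2 ht hn) ?_
  have := hi.segBot_mono hw.le (w p).2
    (by rw [h.segTop_apply hi, h.segTop_apply hi, ht]) (by rwa [h.segTop_apply hi, ← ht])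
  rwa [h.segBot_apply hi, h.segBot_apply hi] at this

theorem exists_succ {p q : Fin N} (hpq : p < q) (hw : w q < w p) (hl : i q < i p) :
    ∃ p' : Fin N, (p : ℕ) + 1 = p' ∧ IsSucc (i p') (i p) ∧ p' < q ∧ w q < w p' := by
  have h1 := h.segBot_eq hi hpq hw
  have h2 := segBot_le i.letter q.2
  have h3 : (i q : ℕ) < i p := hl
  rw [i.letter_coe] at h2
  obtain ⟨h4, h5⟩ := (segBot_ne_iff (f := i.letter) p.2).mp (by rw [h1, i.letter_coe]; omega)
  have h6 : IsSucc (i ⟨p + 1, h4⟩) (i p) := by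
    rw [IsSucc, ← i.letter_coe, ← i.letter_coe]; exact h5
  have h7 := h.apply_succ hi (p := p) (q := ⟨p + 1, h4⟩) rfl h6
  have hpq' : (p : ℕ) < q := hpq
  have hw' : (w q : ℕ) < w p := hw
  refine ⟨⟨p + 1, h4⟩, rfl, h6, lt_of_le_of_ne (Fin.le_def.mpr hpq') fun he => ?_,
    Fin.lt_def.mpr (by omega)⟩
  rw [he] at h7; omega

theorem exists_pred {p q : Fin N} (hpq : p < q) (hw : w q < w p)
    (hl : (i p : ℕ) ≠ segTop i.letter p) :
    ∃ p' : Fin N, (p' : ℕ) + 1 = p ∧ IsSucc (i p) (i p') ∧ p' < q ∧ w q < w p' := by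
  obtain ⟨r, h4, h5⟩ := (segTop_ne_iff (f := i.letter) (p := p)).mp
    (by rw [i.letter_coe]; exact hl.symm)
  have hr : r < N := by omega
  have h6 : IsSucc (i p) (i ⟨r, hr⟩) := by
    rw [IsSucc, ← i.letter_coe, ← i.letter_coe]; exact h5
  have h7 := h.apply_succ hi (p := ⟨r, hr⟩) (q := p) h4 h6
  have hpq' : (p : ℕ) < q := hpq
  have hw' : (w q : ℕ) < w p := hw
  have hlt : (⟨r, hr⟩ : Fin N) < q := Fin.lt_def.mpr (by simp; omega)
  refine ⟨⟨r, hr⟩, h4, h6, hlt, lt_of_le_of_ne (Fin.le_def.mpr (by omega)) fun he => ?_⟩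
  exact hlt.ne (w.injective he).symm

/-- Among the inversions of a nontrivial shuffle there is one between the beginnings of two equal
segments. -/
theorem exists_start (hw : w ≠ 1) : ∃ p q : Fin N, p < q ∧ w q < w p ∧ i p = i q ∧
    (i p : ℕ) = segTop i.letter p := by
  have hne : (inversions w).Nonempty :=
    Finset.nonempty_iff_ne_empty.mpr fun he => hw (eq_one_of_inversions_eq_empty he)
  -- take an inversion with the smallest sum of positions
  obtain ⟨⟨p, q⟩, hpq, hmin⟩ :=
    (inversions w).exists_min_image (fun x => (x.1 : ℕ) + x.2) hne
  obtain ⟨h1 : p < q, h2 : w q < w p⟩ := mem_inversions.mp hpq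
  have hmin' : ∀ p' q', p' < q' → w q' < w p' → (p : ℕ) + q ≤ p' + q' := fun p' q' h1 h2 =>
    hmin (p', q') (mem_inversions.mpr ⟨h1, h2⟩)
  have hp : (i p : ℕ) = segTop i.letter p := by
    by_contra hne
    obtain ⟨p', e1, -, e2, e3⟩ := h.exists_pred hi h1 h2 hne
    have := hmin' _ _ e2 e3
    omega
  have hq : segTop i.letter q = i q := by
    by_contra hne
    rw [← i.letter_coe, ← ne_eq, segTop_ne_iff] at hne
    obtain ⟨r, h4, h5⟩ := hne
    have hr : r < N := by omega
    have h6 : IsSucc (i q) (i ⟨r, hr⟩) := by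
      rw [IsSucc, ← i.letter_coe, ← i.letter_coe]; exact h5
    have h7 := h.apply_succ hi (p := ⟨r, hr⟩) (q := q) h4 h6
    have h1' : (p : ℕ) < q := h1
    have h2' : (w q : ℕ) < w p := h2
    have hle : p ≤ ⟨r, hr⟩ := Fin.le_def.mpr (by simp; omega)
    rcases hle.eq_or_lt with he | hlt
    · rw [← he] at h7; omega
    · have := hmin' _ _ hlt (Fin.lt_def.mpr (by omega))
      simp at this; omega
  exact ⟨p, q, h1, h2, Fin.ext (by rw [hp, h.segTop_eq hi h1 h2, hq]), hp⟩

/-- A nontrivial shuffle has negative degree. An inversion of two equal letters contributes `-2`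
and an inversion of two letters which differ by one contributes `1`.  Moving the first position
by one step in its segment injects each of the two kinds of the latter, the decreasing and the
increasing ones, into the inversions of equal letters; the first injection misses the inversion of
`exists_start`. -/
theorem sum_crossDeg_neg (hw : w ≠ 1) :
    ∑ x ∈ inversions w, crossDeg (i x.1) (i x.2) < 0 := by
  classical
  let E := (inversions w).filter fun x => i x.1 = i x.2
  let D := (inversions w).filter fun x => IsSucc (i x.2) (i x.1)
  let U := (inversions w).filter fun x => IsSucc (i x.1) (i x.2)
  have hsum : ∑ x ∈ inversions w, crossDeg (i x.1) (i x.2) =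
      -2 * (E.card : ℤ) + D.card + U.card := by
    simp only [E, D, U, Finset.card_filter, Nat.cast_sum, Finset.mul_sum,
      ← Finset.sum_add_distrib]
    refine Finset.sum_congr rfl fun x _ => ?_
    rw [crossDeg]
    by_cases h1 : i x.1 = i x.2
    · have h2 : ¬ IsSucc (i x.2) (i x.2) := by simp [IsSucc]
      simp [h1, h2]
    by_cases h2 : IsSucc (i x.1) (i x.2)
    · have h3 : ¬ IsSucc (i x.2) (i x.1) := by simp only [IsSucc] at *; omega
      simp [h1, h2, h3]
    · by_cases h3 : IsSucc (i x.2) (i x.1) <;> simp [h1, h2, h3]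
  have hD : D.card < E.card := by
    obtain ⟨p₀, q₀, h1, h2, h3, h4⟩ := h.exists_start hi hw
    have h₀ : (p₀, q₀) ∈ E := by simp [E, mem_inversions, h1, h2, h3]
    rw [← Finset.card_erase_add_one h₀, Nat.lt_succ_iff]
    refine Finset.card_le_card_of_injOn
      (fun x => (if hx : (x.1 : ℕ) + 1 < N then ⟨x.1 + 1, hx⟩ else x.1, x.2)) ?_ ?_
    · rintro ⟨p, q⟩ hx
      simp only [D, Finset.coe_filter, Set.mem_ofPred_eq, mem_inversions] at hx
      obtain ⟨⟨e1, e2⟩, e3⟩ := hx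
      obtain ⟨p', f1, f2, f3, f4⟩ := h.exists_succ hi e1 e2 (Fin.lt_def.mpr (by
        rw [IsSucc] at e3; omega))
      have hp' : (p : ℕ) + 1 < N := by omega
      have : (⟨p + 1, hp'⟩ : Fin N) = p' := Fin.ext f1
      simp only [dif_pos hp', this, Finset.coe_erase, Set.mem_sdiff, Set.mem_singleton_iff, E,
        Finset.coe_filter, Set.mem_ofPred_eq, mem_inversions]
      refine ⟨⟨⟨f3, f4⟩, Fin.ext ?_⟩, fun he => ?_⟩
      · rw [IsSucc] at e3 f2; omega
      · -- the shifted position is not the beginning of a segment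
        obtain ⟨rfl, rfl⟩ := Prod.ext_iff.mp he
        refine segTop_ne_iff (f := i.letter).mpr ⟨p, f1, ?_⟩ (by rw [i.letter_coe]; exact h4.symm)
        rw [i.letter_coe, i.letter_coe]; exact f2
    · rintro ⟨p, q⟩ hx ⟨p', q'⟩ hx' he
      simp only [D, Finset.coe_filter, Set.mem_ofPred_eq, mem_inversions] at hx hx'
      obtain ⟨⟨e1, -⟩, -⟩ := hx
      obtain ⟨⟨e1', -⟩, -⟩ := hx'
      have hp : (p : ℕ) + 1 < N := by have : (p : ℕ) < q := e1; omega
      have hp' : (p' : ℕ) + 1 < N := by have : (p' : ℕ) < q' := e1'; omega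
      simp only [dif_pos hp, dif_pos hp', Prod.mk.injEq, Fin.mk.injEq, add_left_inj] at he
      exact Prod.ext (Fin.ext he.1) he.2
  have hU : U.card ≤ E.card := by
    have hmem : ∀ p q, (p, q) ∈ U → ∃ p' : Fin N, (p' : ℕ) + 1 = p ∧ IsSucc (i p) (i p') ∧
        p' < q ∧ w q < w p' := by
      intro p q hx
      simp only [U, Finset.mem_filter, mem_inversions] at hx
      obtain ⟨⟨e1, e2⟩, e3⟩ := hx
      refine h.exists_pred hi e1 e2 ?_
      rw [h.segTop_eq hi e1 e2]
      have := le_segTop i.letter q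
      rw [i.letter_coe] at this
      rw [IsSucc] at e3
      omega
    refine Finset.card_le_card_of_injOn
      (fun x => (⟨x.1 - 1, by omega⟩, x.2)) ?_ ?_
    · rintro ⟨p, q⟩ hx
      obtain ⟨p', f1, f2, f3, f4⟩ := hmem p q hx
      simp only [U, Finset.coe_filter, Set.mem_ofPred_eq] at hx
      have : (⟨p - 1, by omega⟩ : Fin N) = p' := Fin.ext (by simp; omega)
      simp only [this, E, Finset.coe_filter, Set.mem_ofPred_eq, mem_inversions]
      refine ⟨⟨f3, f4⟩, Fin.ext ?_⟩
      have e3 := hx.2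
      rw [IsSucc] at e3 f2; omega
    · rintro ⟨p, q⟩ hx ⟨p', q'⟩ hx' he
      obtain ⟨_, f1, -⟩ := hmem p q hx
      obtain ⟨_, f1', -⟩ := hmem p' q' hx'
      simp only [Prod.mk.injEq, Fin.mk.injEq] at he
      exact Prod.ext (Fin.ext (show (p : ℕ) = p' by omega)) he.2
  rw [hsum]
  omega

end IsShuffle

/-! ### Reduced words in the symmetric group -/

theorem adj_val (k : Fin (N - 1)) (a : Fin N) : (adj k a : ℕ) =
    if (a : ℕ) = k then (k : ℕ) + 1 else if (a : ℕ) = k + 1 then (k : ℕ) else a := by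
  simp only [adj, Equiv.swap_apply_def, lo, hi, Fin.ext_iff]
  split_ifs <;> simp

theorem perm_apply_inv (π : Equiv.Perm (Fin N)) (x : Fin N) : π (π⁻¹ x) = x :=
  π.apply_symm_apply x

theorem perm_inv_apply (π : Equiv.Perm (Fin N)) (x : Fin N) : π⁻¹ (π x) = x :=
  π.symm_apply_apply x

theorem adj_mul_adj_mul (k : Fin (N - 1)) (π : Equiv.Perm (Fin N)) : adj k * (adj k * π) = π := by
  rw [← mul_assoc, adj, Equiv.swap_mul_self, one_mul]

theorem adj_mul_inv_lo (k : Fin (N - 1)) (π : Equiv.Perm (Fin N)) :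
    (adj k * π)⁻¹ (lo k) = π⁻¹ (hi k) := by
  simp [adj]

theorem adj_mul_inv_hi (k : Fin (N - 1)) (π : Equiv.Perm (Fin N)) :
    (adj k * π)⁻¹ (hi k) = π⁻¹ (lo k) := by
  simp [adj]

theorem adj_mul_inv_of_ne {k : Fin (N - 1)} (π : Equiv.Perm (Fin N)) {x : Fin N} (h : x ≠ lo k)
    (h' : x ≠ hi k) : (adj k * π)⁻¹ x = π⁻¹ x := by
  simp [adj, Equiv.swap_apply_of_ne_of_ne h h']

theorem inversions_adj_mul {k : Fin (N - 1)} {π : Equiv.Perm (Fin N)}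
    (h : π⁻¹ (lo k) < π⁻¹ (hi k)) :
    (π⁻¹ (lo k), π⁻¹ (hi k)) ∉ inversions π ∧
      inversions (adj k * π) = insert (π⁻¹ (lo k), π⁻¹ (hi k)) (inversions π) := by
  have hlt : lo k < hi k := by simp [lo, hi, Fin.lt_def]
  refine ⟨fun hm => ?_, ?_⟩
  · have := (mem_inversions.mp hm).2
    rw [perm_apply_inv, perm_apply_inv] at this
    exact absurd hlt (not_lt_of_gt this)
  ext ⟨p, q⟩
  rw [Finset.mem_insert, mem_inversions, mem_inversions, Prod.mk.injEq, Equiv.Perm.eq_inv_iff_eq,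
    Equiv.Perm.eq_inv_iff_eq]
  have hne : p < q → ¬ (π p = hi k ∧ π q = lo k) := by
    rintro hpq ⟨h1, h2⟩
    rw [← h1, ← h2, perm_inv_apply, perm_inv_apply] at h
    exact absurd hpq (not_lt_of_gt h)
  have hlt' : π p = lo k → π q = hi k → p < q := by
    intro h1 h2
    rwa [← h1, ← h2, perm_inv_apply, perm_inv_apply] at h
  have hpq : p < q → π p ≠ π q := fun h => π.injective.ne h.ne
  simp only [Equiv.Perm.mul_apply, Fin.lt_def, adj_val, lo, hi, Fin.ext_iff, ne_eq] at *
  constructor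
  · rintro ⟨h1, h2⟩
    have := hne h1
    have := hpq h1
    split_ifs at h2 <;> omega
  · rintro (⟨h1, h2⟩ | ⟨h1, h2⟩)
    · refine ⟨hlt' h1 h2, ?_⟩
      split_ifs <;> omega
    · have := hne h1
      have := hpq h1
      refine ⟨h1, ?_⟩
      split_ifs <;> omega

/-- The Coxeter length of a permutation. -/
def inv (π : Equiv.Perm (Fin N)) : ℕ := (inversions π).card

theorem inv_adj_mul_of_lt {k : Fin (N - 1)} {π : Equiv.Perm (Fin N)}
    (h : π⁻¹ (lo k) < π⁻¹ (hi k)) : inv (adj k * π) = inv π + 1 := by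
  obtain ⟨h1, h2⟩ := inversions_adj_mul h
  rw [inv, h2, Finset.card_insert_of_notMem h1, inv]

theorem inv_adj_mul_of_gt {k : Fin (N - 1)} {π : Equiv.Perm (Fin N)}
    (h : π⁻¹ (hi k) < π⁻¹ (lo k)) : inv (adj k * π) + 1 = inv π := by
  have := inv_adj_mul_of_lt (k := k) (π := adj k * π) (by rwa [adj_mul_inv_lo, adj_mul_inv_hi])
  rw [adj_mul_adj_mul] at this
  exact this.symm

theorem inv_inv (π : Equiv.Perm (Fin N)) : inv π⁻¹ = inv π := by
  refine Finset.card_bij (fun x _ => (π⁻¹ x.2, π⁻¹ x.1)) ?_ ?_ ?_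
  · intro x hx
    obtain ⟨h1, h2⟩ := mem_inversions.mp hx
    exact mem_inversions.mpr ⟨h2, by simpa using h1⟩
  · intro x _ y _ hxy
    simp only [Prod.mk.injEq, EmbeddingLike.apply_eq_iff_eq] at hxy
    exact Prod.ext hxy.2 hxy.1
  · intro x hx
    obtain ⟨h1, h2⟩ := mem_inversions.mp hx
    exact ⟨(π x.2, π x.1), mem_inversions.mpr ⟨h2, by simpa using h1⟩, by simp⟩

theorem inv_mul_adj_of_gt {k : Fin (N - 1)} {π : Equiv.Perm (Fin N)} (h : π (hi k) < π (lo k)) :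
    inv (π * adj k) + 1 = inv π := by
  have := inv_adj_mul_of_gt (k := k) (π := π⁻¹) (by rwa [_root_.inv_inv])
  rwa [inv_inv, ← inv_inv (adj k * π⁻¹), mul_inv_rev, _root_.inv_inv, adj, Equiv.swap_inv] at this

theorem exists_descent {π : Equiv.Perm (Fin N)} (h : π ≠ 1) :
    ∃ k : Fin (N - 1), π⁻¹ (hi k) < π⁻¹ (lo k) := by
  by_contra! hk
  refine h (inv_eq_one.mp (eq_one_of_inversions_eq_empty (Finset.eq_empty_of_forall_notMem ?_)))
  rintro ⟨p, q⟩ hpq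
  obtain ⟨h1, h2⟩ := mem_inversions.mp hpq
  have key : ∀ (q : ℕ) (hq : q < N), (p : ℕ) ≤ q → π⁻¹ p ≤ π⁻¹ ⟨q, hq⟩ := by
    intro q hq hle
    induction q, hle using Nat.le_induction with
    | base => exact le_rfl
    | succ q hle ih => exact (ih (by omega)).trans (hk ⟨q, by omega⟩)
  exact absurd (key q q.2 h1.le) (not_le_of_gt h2)

/-- The product of the simple transpositions in a list. -/
def wordPerm (K : List (Fin (N - 1))) : Equiv.Perm (Fin N) := (K.map adj).prod

@[simp] theorem wordPerm_nil : wordPerm ([] : List (Fin (N - 1))) = 1 := rfl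

@[simp] theorem wordPerm_cons (k : Fin (N - 1)) (K : List (Fin (N - 1))) :
    wordPerm (k :: K) = adj k * wordPerm K := by simp [wordPerm]

/-- A list of simple transpositions is reduced if its length is the length of its product. -/
def Reduced (K : List (Fin (N - 1))) : Prop := inv (wordPerm K) = K.length

theorem inv_one : inv (1 : Equiv.Perm (Fin N)) = 0 := by
  refine Finset.card_eq_zero.mpr (Finset.eq_empty_of_forall_notMem fun x hx => ?_)
  obtain ⟨h1, h2⟩ := mem_inversions.mp hx
  exact absurd h1 (not_lt_of_gt h2)

theorem inv_lo_ne_inv_hi (π : Equiv.Perm (Fin N)) (k : Fin (N - 1)) : π⁻¹ (lo k) ≠ π⁻¹ (hi k) :=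
  (π⁻¹).injective.ne (lo_ne_hi k)

theorem inv_wordPerm_le (K : List (Fin (N - 1))) : inv (wordPerm K) ≤ K.length := by
  induction K with
  | nil => simp [inv_one]
  | cons k K ih =>
    rw [wordPerm_cons, List.length_cons]
    rcases lt_or_gt_of_ne (inv_lo_ne_inv_hi (wordPerm K) k) with h | h
    · have := inv_adj_mul_of_lt h; omega
    · have := inv_adj_mul_of_gt h; omega

theorem reduced_nil : Reduced ([] : List (Fin (N - 1))) := by simp [Reduced, inv_one]

theorem reduced_cons_iff {k : Fin (N - 1)} {K : List (Fin (N - 1))} : Reduced (k :: K) ↔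
    Reduced K ∧ (wordPerm K)⁻¹ (lo k) < (wordPerm K)⁻¹ (hi k) := by
  have hle := inv_wordPerm_le K
  rw [Reduced, Reduced, wordPerm_cons, List.length_cons]
  rcases lt_or_gt_of_ne (inv_lo_ne_inv_hi (wordPerm K) k) with h | h
  · have := inv_adj_mul_of_lt h
    constructor
    · intro h'; exact ⟨by omega, h⟩
    · rintro ⟨h', -⟩; omega
  · have := inv_adj_mul_of_gt h
    constructor
    · intro h'; omega
    · rintro ⟨-, h'⟩; exact absurd h (not_lt_of_gt h')

theorem exists_reduced (π : Equiv.Perm (Fin N)) :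
    ∃ K : List (Fin (N - 1)), Reduced K ∧ wordPerm K = π := by
  induction hm : inv π generalizing π with
  | zero =>
    exact ⟨[], reduced_nil, (eq_one_of_inversions_eq_empty (Finset.card_eq_zero.mp hm)).symm⟩
  | succ m ih =>
    have hne : π ≠ 1 := by rintro rfl; simp [inv_one] at hm
    obtain ⟨k, hk⟩ := exists_descent hne
    have := inv_adj_mul_of_gt hk
    obtain ⟨K, hK, hK'⟩ := ih (adj k * π) (by omega)
    refine ⟨k :: K, reduced_cons_iff.mpr ⟨hK, ?_⟩, ?_⟩
    · rwa [hK', adj_mul_inv_lo, adj_mul_inv_hi]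
    · rw [wordPerm_cons, hK', adj_mul_adj_mul]

/-- A permutation with a left descent at `k` has a reduced word that begins with `k`. -/
theorem Reduced.cons {k : Fin (N - 1)} {π : Equiv.Perm (Fin N)} (h : π⁻¹ (hi k) < π⁻¹ (lo k))
    {K : List (Fin (N - 1))} (hK : Reduced K) (hK' : wordPerm K = adj k * π) :
    Reduced (k :: K) ∧ wordPerm (k :: K) = π :=
  ⟨reduced_cons_iff.mpr ⟨hK, by rwa [hK', adj_mul_inv_lo, adj_mul_inv_hi]⟩,
    by rw [wordPerm_cons, hK', adj_mul_adj_mul]⟩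

/-- The first letter of a reduced word is a descent. -/
theorem Reduced.descent {k : Fin (N - 1)} {K : List (Fin (N - 1))} (h : Reduced (k :: K)) :
    (wordPerm (k :: K))⁻¹ (hi k) < (wordPerm (k :: K))⁻¹ (lo k) := by
  rw [wordPerm_cons, adj_mul_inv_lo, adj_mul_inv_hi]
  exact (reduced_cons_iff.mp h).2

theorem adj_mul_adj_of_far {k l : Fin (N - 1)} (h : (k : ℕ) + 1 < l) :
    adj k * adj l = adj l * adj k := by
  ext x
  simp only [Equiv.Perm.mul_apply, adj_val]
  split_ifs <;> omega

/-- The word at the top of the diagram `ψ_K e(i)`. -/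
def topWord (i : Word n N) : List (Fin (N - 1)) → Word n N
  | [] => i
  | k :: K => (topWord i K).swap k

/-- The degree of the diagram `ψ_K e(i)`. -/
def degree (i : Word n N) : List (Fin (N - 1)) → ℤ
  | [] => 0
  | k :: K => degree i K + crossDeg (topWord i K (lo k)) (topWord i K (hi k))

theorem topWord_apply (i : Word n N) (K : List (Fin (N - 1))) (p : Fin N) :
    topWord i K (wordPerm K p) = i p := by
  induction K with
  | nil => rfl
  | cons k K ih => simp [topWord, Word.swap, adj, ih]

theorem topWord_eq (i : Word n N) (K : List (Fin (N - 1))) (p : Fin N) :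
    topWord i K p = i ((wordPerm K)⁻¹ p) := by
  rw [← topWord_apply i K, perm_apply_inv]

theorem topWord_congr {i : Word n N} {K K' : List (Fin (N - 1))} (h : wordPerm K = wordPerm K') :
    topWord i K = topWord i K' := by
  funext p; rw [topWord_eq, topWord_eq, h]

theorem Reduced.degree_eq {i : Word n N} {K : List (Fin (N - 1))} (hK : Reduced K) :
    degree i K = ∑ x ∈ inversions (wordPerm K), crossDeg (i x.1) (i x.2) := by
  induction K with
  | nil =>
    rw [wordPerm_nil, Finset.card_eq_zero.mp (inv_one (N := N))]; rfl
  | cons k K ih =>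
    obtain ⟨h1, h2⟩ := reduced_cons_iff.mp hK
    obtain ⟨h3, h4⟩ := inversions_adj_mul h2
    rw [wordPerm_cons, h4, Finset.sum_insert h3, degree, ih h1, topWord_eq, topWord_eq, add_comm]

theorem Reduced.degree_congr {i : Word n N} {K K' : List (Fin (N - 1))} (hK : Reduced K)
    (hK' : Reduced K') (h : wordPerm K = wordPerm K') : degree i K = degree i K' := by
  rw [hK.degree_eq, hK'.degree_eq, h]

theorem degree_append {i : Word n N} (K K' : List (Fin (N - 1))) (h : topWord i K' = i) :
    topWord i (K ++ K') = topWord i K ∧ degree i (K ++ K') = degree i K + degree i K' := by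
  induction K with
  | nil => exact ⟨h, by simp [degree]⟩
  | cons k K ih =>
    rw [List.cons_append, topWord, topWord, degree, degree, ih.1, ih.2]
    exact ⟨rfl, by ring⟩

/-! ### Straightening in a standard module -/

/-- The product of the crossings in a list. -/
noncomputable def psiProd (n : ℕ) {N : ℕ} (K : List (Fin (N - 1))) : KLRW n N :=
  (K.map (psi n)).prod

theorem psiProd_nil : psiProd n ([] : List (Fin (N - 1))) = 1 := rfl

theorem psiProd_cons (k : Fin (N - 1)) (K : List (Fin (N - 1))) :
    psiProd n (k :: K) = psi n k * psiProd n K := by simp [psiProd]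

theorem psiProd_append (K K' : List (Fin (N - 1))) :
    psiProd n (K ++ K') = psiProd n K * psiProd n K' := by simp [psiProd]

theorem e_topWord_smul {X : Type*} [AddCommGroup X] [Module (KLRW n N) X] {i : Word n N} {v : X}
    (hv : SatisfiesStandardRelations i v) (K : List (Fin (N - 1))) :
    e (topWord i K) • psiProd n K • v = psiProd n K • v := by
  induction K with
  | nil => simpa [psiProd, topWord] using hv.1
  | cons k K ih =>
    rw [psiProd_cons, mul_smul]
    exact e_smul_psi_smul k ih

/-- A diagram in which two red strands cross vanishes. -/
theorem psiProd_smul_eq_zero_of_red {X : Type*} [AddCommGroup X] [Module (KLRW n N) X]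
    {i : Word n N} {v : X} (hv : SatisfiesStandardRelations i v) {p q : Fin N} (hpq : p < q)
    (hp : IsRed (i p)) (hq : IsRed (i q)) (K : List (Fin (N - 1))) (hK : wordPerm K q < wordPerm K p) :
    psiProd n K • v = 0 := by
  induction K with
  | nil => exact absurd hpq (not_lt_of_gt hK)
  | cons k K ih =>
    rw [psiProd_cons, mul_smul]
    rcases lt_or_gt_of_ne ((wordPerm K).injective.ne hpq.ne) with h | h
    · have hcross : wordPerm K p = lo k ∧ wordPerm K q = hi k := by
        rw [wordPerm_cons] at hK
        simp only [Equiv.Perm.mul_apply, Fin.lt_def, adj_val] at hK h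
        simp only [lo, hi, Fin.ext_iff]
        split_ifs at hK <;> omega
      have h1 : topWord i K (lo k) = i p := by rw [← hcross.1, topWord_apply]
      have h2 : topWord i K (hi k) = i q := by rw [← hcross.2, topWord_apply]
      refine psi_smul_of_red (e_topWord_smul hv K) ?_ (h1 ▸ hp)
      rw [h1, h2]
      exact Fin.ext (by simp only [IsRed] at hp hq; omega)
    · rw [ih h, smul_zero]

section Straightening

variable {X : Type*} [AddCommGroup X] [Module (KLRW n N) X] [Module ℂ X]
  (i : Word n N) (v : X)

/-- The span of the vectors `ψ_K v` for diagrams `ψ_K e(i)` of degree `d` with top `j` which have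
less than `m` crossings. -/
def crossingSpan (m : ℕ) (d : ℤ) (j : Word n N) : Submodule ℂ X :=
  Submodule.span ℂ {x | ∃ K : List (Fin (N - 1)), K.length < m ∧ degree i K = d ∧
    topWord i K = j ∧ psiProd n K • v = x}

variable {i v}

theorem crossingSpan_mono {m m' : ℕ} (h : m ≤ m') (d : ℤ) (j : Word n N) :
    crossingSpan i v m d j ≤ crossingSpan i v m' d j :=
  Submodule.span_mono fun _ ⟨K, h1, h2⟩ => ⟨K, h1.trans_le h, h2⟩

theorem psiProd_smul_mem {K : List (Fin (N - 1))} {m : ℕ} (h : K.length < m) {d : ℤ}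
    {j : Word n N} (hd : degree i K = d) (hj : topWord i K = j) :
    psiProd n K • v ∈ crossingSpan i v m d j :=
  Submodule.subset_span ⟨K, h, hd, hj, rfl⟩

variable [IsScalarTower ℂ (KLRW n N) X]

theorem psi_smul_mem {m : ℕ} {d : ℤ} {j : Word n N} (k : Fin (N - 1)) {x : X}
    (hx : x ∈ crossingSpan i v m d j) :
    psi n k • x ∈ crossingSpan i v (m + 1) (d + crossDeg (j (lo k)) (j (hi k))) (j.swap k) := by
  have := IsScalarTower.to_smulCommClass' (R := ℂ) (A := KLRW n N) (M := X)
  induction hx using Submodule.span_induction with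
  | mem x hx =>
    obtain ⟨K, h1, rfl, rfl, rfl⟩ := hx
    rw [smul_smul, ← psiProd_cons]
    exact psiProd_smul_mem (by simpa using h1) rfl rfl
  | zero => rw [smul_zero]; exact Submodule.zero_mem _
  | add x y _ _ hx hy => rw [smul_add]; exact Submodule.add_mem _ hx hy
  | smul c x _ hx => rw [smul_comm]; exact Submodule.smul_mem _ c hx

theorem crossingSpan_psi_sub {k : Fin (N - 1)} {K K' : List (Fin (N - 1))} {m : ℕ}
    (h : psiProd n K • v - psiProd n K' • v ∈ crossingSpan i v m (degree i K) (topWord i K)) :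
    psiProd n (k :: K) • v - psiProd n (k :: K') • v ∈
      crossingSpan i v (m + 1) (degree i (k :: K)) (topWord i (k :: K)) := by
  rw [psiProd_cons, psiProd_cons, mul_smul, mul_smul, ← smul_sub]
  exact psi_smul_mem k h

section Relations

variable (hv : SatisfiesStandardRelations i v)
include hv

/-- A dot on a diagram can be moved to the bottom, where it vanishes, at the cost of diagrams with
fewer crossings. -/
theorem y_smul_psiProd_smul_mem (l : Fin N) (K : List (Fin (N - 1))) :
    y n l • psiProd n K • v ∈ crossingSpan i v K.length (degree i K + 2) (topWord i K) := by
  induction K generalizing l with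
  | nil => simp [psiProd, hv.2.2 l]
  | cons k K ih =>
    have hx := e_topWord_smul hv K
    have hmem : ∀ l : Fin N, psi n k • y n l • psiProd n K • v ∈
        crossingSpan i v (k :: K).length (degree i (k :: K) + 2) (topWord i (k :: K)) := by
      intro l
      have := psi_smul_mem k (ih l)
      rwa [show degree i K + 2 + crossDeg (topWord i K (lo k)) (topWord i K (hi k)) =
        degree i (k :: K) + 2 by rw [degree]; ring] at this
    rw [psiProd_cons, mul_smul]
    by_cases h : topWord i K (lo k) = topWord i K (hi k)
    · by_cases hr : IsRed (topWord i K (lo k))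
      · rw [psi_smul_of_red hx h hr, smul_zero]
        exact Submodule.zero_mem _
      have hlow : psiProd n K • v ∈
          crossingSpan i v (k :: K).length (degree i (k :: K) + 2) (topWord i (k :: K)) := by
        refine psiProd_smul_mem (by simp) ?_ ?_
        · rw [degree, crossDeg, if_pos h]; ring
        · rw [topWord, swap_eq_self k _ h]
      by_cases h1 : l = lo k
      · subst h1
        rw [y_lo_smul_psi_smul_of_eq hx h hr]
        exact Submodule.add_mem _ (hmem _) hlow
      by_cases h2 : l = hi k
      · subst h2
        rw [y_hi_smul_psi_smul_of_eq hx h hr]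
        exact Submodule.sub_mem _ (hmem _) hlow
      rw [← psi_smul_y_smul_far h1 h2]
      exact hmem l
    · by_cases h1 : l = lo k
      · subst h1
        rw [y_lo_smul_psi_smul_of_ne hx h]
        exact hmem _
      by_cases h2 : l = hi k
      · subst h2
        rw [y_hi_smul_psi_smul_of_ne hx h]
        exact hmem _
      rw [← psi_smul_y_smul_far h1 h2]
      exact hmem l

/-- The bigon relation, combined with moving dots to the bottom. -/
theorem psi_smul_psi_smul_mem (k : Fin (N - 1)) (K : List (Fin (N - 1))) :
    psi n k • psi n k • psiProd n K • v ∈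
      crossingSpan i v (K.length + 2) (degree i (k :: k :: K)) (topWord i (k :: k :: K)) := by
  have hx := e_topWord_smul hv K
  have htop : topWord i (k :: k :: K) = topWord i K := by simp [topWord]
  rw [htop]
  set w := topWord i K with hw
  have hdeg : degree i (k :: k :: K) = degree i K + crossDeg (w (lo k)) (w (hi k)) +
      crossDeg (w (hi k)) (w (lo k)) := by
    simp [degree, topWord, ← hw]
  have hy : ∀ l : Fin N, degree i (k :: k :: K) = degree i K + 2 → y n l • psiProd n K • v ∈
      crossingSpan i v (K.length + 2) (degree i (k :: k :: K)) w := fun l hl =>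
    hl ▸ crossingSpan_mono (by omega) _ _ (y_smul_psiProd_smul_mem hv l K)
  by_cases h : w (lo k) = w (hi k)
  · rw [psi_smul_psi_smul_of_eq hx h]
    exact Submodule.zero_mem _
  by_cases h₁ : IsSucc (w (lo k)) (w (hi k))
  · rw [psi_smul_psi_smul_of_up hx h₁]
    have : degree i (k :: k :: K) = degree i K + 2 := by
      rw [hdeg]
      simp only [crossDeg, if_neg h, if_neg (Ne.symm h), h₁, true_or, or_true, if_true]; ring
    exact Submodule.sub_mem _ (hy _ this) (hy _ this)
  by_cases h₂ : IsSucc (w (hi k)) (w (lo k))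
  · rw [psi_smul_psi_smul_of_down hx h₂]
    have : degree i (k :: k :: K) = degree i K + 2 := by
      rw [hdeg]
      simp only [crossDeg, if_neg h, if_neg (Ne.symm h), h₂, true_or, or_true, if_true]; ring
    exact Submodule.sub_mem _ (hy _ this) (hy _ this)
  rw [psi_smul_psi_smul_of_far hx h h₁ h₂]
  refine psiProd_smul_mem (by omega) ?_ rfl
  rw [hdeg, crossDeg, crossDeg, if_neg h, if_neg (Ne.symm h), if_neg (by tauto), if_neg (by tauto)]
  ring

/-- The triple point relation modulo diagrams with fewer crossings. -/
theorem psi_braid_mem {k l : Fin (N - 1)} (hkl : (k : ℕ) + 1 = l) (K : List (Fin (N - 1))) :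
    psi n k • psi n l • psi n k • psiProd n K • v - psi n l • psi n k • psi n l • psiProd n K • v ∈
      crossingSpan i v (K.length + 3) (degree i (k :: l :: k :: K))
        (topWord i (k :: l :: k :: K)) := by
  have hx := e_topWord_smul hv K
  set w := topWord i K with hw
  have hl : lo l = hi k := lo_eq_hi hkl
  have d1 : lo k ≠ hi l := by simp [lo, hi, Fin.ext_iff]; omega
  have d2 : hi k ≠ hi l := by rw [← hl]; exact lo_ne_hi l
  have d3 : lo k ≠ lo l := by rw [hl]; exact lo_ne_hi k
  have v1 : (w.swap k) (lo l) = w (lo k) := by rw [hl, swap_hi]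
  have v2 : (w.swap k) (hi l) = w (hi l) := swap_of_ne k w _ d1.symm d2.symm
  have v3 : ((w.swap k).swap l) (lo k) = w (hi k) := by
    rw [swap_of_ne l _ _ d3 d1, swap_lo]
  have v4 : ((w.swap k).swap l) (hi k) = w (hi l) := by
    rw [← hl, swap_lo, v2]
  have u1 : (w.swap l) (lo k) = w (lo k) := swap_of_ne l w _ d3 d1
  have u2 : (w.swap l) (hi k) = w (hi l) := by rw [← hl, swap_lo]
  have u3 : ((w.swap l).swap k) (lo l) = w (lo k) := by rw [hl, swap_hi, u1]
  have u4 : ((w.swap l).swap k) (hi l) = w (hi k) := by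
    rw [swap_of_ne k _ _ d1.symm d2.symm, swap_hi, hl]
  have hdeg : degree i (k :: l :: k :: K) = degree i K + crossDeg (w (lo k)) (w (hi k)) +
      crossDeg (w (lo k)) (w (hi l)) + crossDeg (w (hi k)) (w (hi l)) := by
    simp only [degree, topWord, ← hw, v1, v2, v3, v4]
  have fk := e_smul_psi_smul k hx
  have fl := e_smul_psi_smul l hx
  have fkl := e_smul_psi_smul l fk
  have flk := e_smul_psi_smul k fl
  -- if two of the three strands are red, then both diagrams contain a crossing of them
  by_cases h₁ : w (lo k) = w (lo l) ∧ IsRed (w (lo k))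
  · rw [psi_smul_of_red hx (by rw [← hl]; exact h₁.1) h₁.2,
      psi_smul_of_red flk (by rw [u3, u4, ← hl]; exact h₁.1) (by rw [u3]; exact h₁.2)]
    simp
  by_cases h₂ : w (lo k) = w (hi l) ∧ IsRed (w (lo k))
  · rw [psi_smul_of_red fk (by rw [v1, v2]; exact h₂.1) (by rw [v1]; exact h₂.2),
      psi_smul_of_red fl (by rw [u1, u2]; exact h₂.1) (by rw [u1]; exact h₂.2)]
    simp
  by_cases h₃ : w (lo l) = w (hi l) ∧ IsRed (w (lo l))
  · rw [psi_smul_of_red fkl (by rw [v3, v4, ← hl]; exact h₃.1) (by rw [v3, ← hl]; exact h₃.2),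
      psi_smul_of_red hx h₃.1 h₃.2]
    simp
  rw [psi_braid_smul hkl hx h₁ h₂ h₃, algebraMap_smul]
  by_cases hb : w (lo k) = w (hi l) ∧
      (IsSucc (w (lo l)) (w (lo k)) ∨ IsSucc (w (lo k)) (w (lo l)))
  · obtain ⟨hac, hb⟩ := hb
    refine Submodule.smul_mem _ _ (psiProd_smul_mem (by omega) ?_ ?_)
    · have hne : w (lo k) ≠ w (hi k) := by
        rw [← hl]; intro h; rw [h] at hb; simp [IsSucc] at hb
      rw [hl] at hb
      rw [hdeg, ← hac]
      simp only [crossDeg, if_true, if_neg hne, if_neg hne.symm, if_pos hb, if_pos hb.symm]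
      ring
    · have : ((w.swap k).swap l).swap k = w := by
        funext x
        by_cases x1 : x = lo k
        · rw [x1, swap_lo, v4, hac]
        by_cases x2 : x = hi k
        · rw [x2, swap_hi, v3]
        by_cases x3 : x = hi l
        · rw [x3, swap_of_ne k _ _ d1.symm d2.symm, swap_hi, v1, hac]
        rw [swap_of_ne k _ _ x1 x2, swap_of_ne l _ _ (hl ▸ x2) x3, swap_of_ne k _ _ x1 x2]
      rw [topWord, topWord, topWord, ← hw, this]
  · have : braidCoeff (w (lo k)) (w (lo l)) (w (hi l)) = 0 := by
      rw [braidCoeff, if_neg (by tauto), if_neg (by tauto)]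
    rw [this, zero_smul]
    exact Submodule.zero_mem _

/-- Two reduced words of the same permutation give the same vector up to diagrams with fewer
crossings. This is the argument of Matsumoto's theorem: if the words begin with different
letters, then both of these are descents, and one passes between two words that begin with the
two sides of a braid relation. -/
theorem psiProd_sub_mem (m : ℕ) : ∀ K K' : List (Fin (N - 1)), K.length = m → Reduced K →
    Reduced K' → wordPerm K = wordPerm K' →
    psiProd n K • v - psiProd n K' • v ∈ crossingSpan i v m (degree i K) (topWord i K) := by
  induction m with
  | zero =>
    intro K K' hK h1 h2 h
    obtain rfl := List.length_eq_zero_iff.mp hK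
    have : K'.length = 0 := by rw [← h2, ← h, h1, hK]
    obtain rfl := List.length_eq_zero_iff.mp this
    rw [sub_self]
    exact Submodule.zero_mem _
  | succ m ih =>
    -- words with the same first letter
    have hsame : ∀ (k : Fin (N - 1)) (K K' : List (Fin (N - 1))), (k :: K).length = m + 1 →
        Reduced (k :: K) → Reduced (k :: K') → wordPerm (k :: K) = wordPerm (k :: K') →
        psiProd n (k :: K) • v - psiProd n (k :: K') • v ∈
          crossingSpan i v (m + 1) (degree i (k :: K)) (topWord i (k :: K)) := by
      intro k K K' hm h1 h2 h
      exact crossingSpan_psi_sub (ih K K' (by simpa using hm) (reduced_cons_iff.mp h1).1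
        (reduced_cons_iff.mp h2).1 (by simpa using h))
    -- it suffices to find two intermediate words
    have htrans : ∀ (k l : Fin (N - 1)) (K L L' K' : List (Fin (N - 1))), (k :: K).length = m + 1 →
        Reduced (k :: K) → Reduced (l :: K') → wordPerm (k :: K) = wordPerm (l :: K') →
        Reduced (k :: L) → Reduced (l :: L') → wordPerm (k :: L) = wordPerm (k :: K) →
        wordPerm (l :: L') = wordPerm (k :: K) →
        psiProd n (k :: L) • v - psiProd n (l :: L') • v ∈
          crossingSpan i v (m + 1) (degree i (k :: L)) (topWord i (k :: L)) →
        psiProd n (k :: K) • v - psiProd n (l :: K') • v ∈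
          crossingSpan i v (m + 1) (degree i (k :: K)) (topWord i (k :: K)) := by
      intro k l K L L' K' hm h1 h2 h h3 h4 h5 h6 h7
      have e1 := hsame k K L hm h1 h3 h5.symm
      have hm' : (l :: L').length = m + 1 := by rw [← h4, h6, h1, hm]
      have e2 := hsame l L' K' hm' h4 h2 (h6.trans h)
      rw [h3.degree_congr h1 h5, topWord_congr h5] at h7
      rw [h4.degree_congr h1 h6, topWord_congr h6] at e2
      have := Submodule.add_mem _ (Submodule.add_mem _ e1 h7) e2
      rwa [sub_add_sub_cancel, sub_add_sub_cancel] at this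
    have hfar : ∀ (k l : Fin (N - 1)) (K K' : List (Fin (N - 1))), (k : ℕ) + 1 < l →
        (k :: K).length = m + 1 → Reduced (k :: K) → Reduced (l :: K') →
        wordPerm (k :: K) = wordPerm (l :: K') →
        psiProd n (k :: K) • v - psiProd n (l :: K') • v ∈
          crossingSpan i v (m + 1) (degree i (k :: K)) (topWord i (k :: K)) := by
      intro k l K K' hkl hm h1 h2 h
      have n1 : lo l ≠ lo k := by simp [lo, Fin.ext_iff]; omega
      have n2 : lo l ≠ hi k := by simp [lo, hi, Fin.ext_iff]; omega
      have n3 : hi l ≠ lo k := by simp [lo, hi, Fin.ext_iff]; omega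
      have n4 : hi l ≠ hi k := by simp [hi, Fin.ext_iff]; omega
      have dk := h1.descent
      have dl := h2.descent
      rw [← h] at dl
      set π := wordPerm (k :: K)
      obtain ⟨L, hL, hL'⟩ := exists_reduced (adj l * (adj k * π))
      obtain ⟨a1, a2⟩ := Reduced.cons (k := l) (π := adj k * π)
        (by rwa [adj_mul_inv_of_ne π n3 n4, adj_mul_inv_of_ne π n1 n2]) hL hL'
      obtain ⟨b1, b2⟩ := Reduced.cons (k := k) (π := adj l * π)
        (by rwa [adj_mul_inv_of_ne π n2.symm n4.symm, adj_mul_inv_of_ne π n1.symm n3.symm]) hL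
        (by rw [hL', ← mul_assoc, ← mul_assoc, adj_mul_adj_of_far hkl])
      obtain ⟨a3, a4⟩ := Reduced.cons dk a1 a2
      obtain ⟨b3, b4⟩ := Reduced.cons dl b1 b2
      refine htrans k l K (l :: L) (k :: L) K' hm h1 h2 h a3 b3 a4 b4 ?_
      simp only [psiProd_cons, mul_smul, psi_smul_psi_smul_far hkl, sub_self]
      exact Submodule.zero_mem _
    have hadj : ∀ (k l : Fin (N - 1)) (K K' : List (Fin (N - 1))), (k : ℕ) + 1 = l →
        (k :: K).length = m + 1 → Reduced (k :: K) → Reduced (l :: K') →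
        wordPerm (k :: K) = wordPerm (l :: K') →
        psiProd n (k :: K) • v - psiProd n (l :: K') • v ∈
          crossingSpan i v (m + 1) (degree i (k :: K)) (topWord i (k :: K)) := by
      intro k l K K' hkl hm h1 h2 h
      have hl : lo l = hi k := lo_eq_hi hkl
      have n1 : hi l ≠ lo k := by simp [lo, hi, Fin.ext_iff]; omega
      have n2 : hi l ≠ hi k := by rw [← hl]; exact (lo_ne_hi l).symm
      have n3 : lo k ≠ lo l := by rw [hl]; exact lo_ne_hi k
      have dk := h1.descent
      have dl := h2.descent
      rw [← h] at dl
      set π := wordPerm (k :: K)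
      obtain ⟨L, hL, hL'⟩ := exists_reduced (adj k * (adj l * (adj k * π)))
      have hL'' : wordPerm L = adj l * (adj k * (adj l * π)) := by
        rw [hL']; simp only [← mul_assoc]; rw [adj_braid hkl]
      have e1 : (adj k * π)⁻¹ (hi l) = π⁻¹ (hi l) := adj_mul_inv_of_ne π n1 n2
      have e2 : (adj l * π)⁻¹ (lo k) = π⁻¹ (lo k) := adj_mul_inv_of_ne π n3 n1.symm
      obtain ⟨a1, a2⟩ := Reduced.cons (k := k) (π := adj l * (adj k * π)) (by
        rw [← hl, adj_mul_inv_lo, e1, adj_mul_inv_of_ne _ n3 n1.symm, adj_mul_inv_lo, ← hl]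
        exact dl) hL hL'
      obtain ⟨a3, a4⟩ := Reduced.cons (k := l) (π := adj k * π) (by
        rw [e1, hl, adj_mul_inv_hi]
        rw [hl] at dl
        exact dl.trans dk) a1 a2
      obtain ⟨b1, b2⟩ := Reduced.cons (k := l) (π := adj k * (adj l * π)) (by
        rw [adj_mul_inv_of_ne _ n1 n2, adj_mul_inv_hi, hl, adj_mul_inv_hi, e2]
        exact dk) hL hL''
      obtain ⟨b3, b4⟩ := Reduced.cons (k := k) (π := adj l * π) (by
        rw [e2, ← hl, adj_mul_inv_lo]
        rw [← hl] at dk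
        exact dl.trans dk) b1 b2
      obtain ⟨a5, a6⟩ := Reduced.cons dk a3 a4
      obtain ⟨b5, b6⟩ := Reduced.cons dl b3 b4
      refine htrans k l K (l :: k :: L) (k :: l :: L) K' hm h1 h2 h a5 b5 a6 b6 ?_
      have hlen : (k :: l :: k :: L).length = m + 1 :=
        (a5.symm.trans ((congrArg inv a6).trans h1)).trans hm
      have := psi_braid_mem hv hkl L
      rw [show L.length + 3 = m + 1 from hlen] at this
      simpa only [psiProd_cons, mul_smul] using this
    intro K K' hm h1 h2 h
    have hm' : K'.length = m + 1 := by rw [← h2, ← h, h1, hm]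
    match K, K', hm, hm' with
    | k :: K, l :: K', hm, hm' =>
      have hswap : psiProd n (l :: K') • v - psiProd n (k :: K) • v ∈
          crossingSpan i v (m + 1) (degree i (l :: K')) (topWord i (l :: K')) →
          psiProd n (k :: K) • v - psiProd n (l :: K') • v ∈
          crossingSpan i v (m + 1) (degree i (k :: K)) (topWord i (k :: K)) := fun hmem => by
        rw [h1.degree_congr h2 h, topWord_congr h, ← neg_sub]
        exact Submodule.neg_mem _ hmem
      rcases lt_trichotomy (k : ℕ) l with hkl | hkl | hkl
      · rcases (Nat.succ_le_of_lt hkl).eq_or_lt with hkl | hkl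
        · exact hadj k l K K' hkl hm h1 h2 h
        · exact hfar k l K K' hkl hm h1 h2 h
      · obtain rfl := Fin.ext hkl
        exact hsame k K K' hm h1 h2 h
      · rcases (Nat.succ_le_of_lt hkl).eq_or_lt with hkl | hkl
        · exact hswap (hadj l k K' K hkl hm' h2 h1 h.symm)
        · exact hswap (hfar l k K' K hkl hm' h2 h1 h.symm)

/-- A word which is not reduced gives a combination of diagrams with fewer crossings. -/
theorem psiProd_smul_mem_of_not_reduced (K : List (Fin (N - 1))) (hK : ¬ Reduced K) :
    psiProd n K • v ∈ crossingSpan i v K.length (degree i K) (topWord i K) := by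
  induction K with
  | nil => exact absurd reduced_nil hK
  | cons k K ih =>
    by_cases h : Reduced K
    · have hlt : (wordPerm K)⁻¹ (hi k) < (wordPerm K)⁻¹ (lo k) := by
        refine lt_of_le_of_ne (not_lt.mp fun hlt => hK (reduced_cons_iff.mpr ⟨h, hlt⟩)) ?_
        exact (inv_lo_ne_inv_hi _ k).symm
      obtain ⟨L, hL, hL'⟩ := exists_reduced (adj k * wordPerm K)
      obtain ⟨h1, h2⟩ := Reduced.cons hlt hL hL'
      have h3 := crossingSpan_psi_sub (k := k) (psiProd_sub_mem hv _ K (k :: L) rfl h h1 h2.symm)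
      have h4 := psi_smul_psi_smul_mem hv k L
      have hlen : L.length + 2 = (k :: K).length := by
        have : (k :: L).length = K.length := by rw [← h1, h2, h]
        simpa using this
      have hdeg : degree i (k :: k :: L) = degree i (k :: K) := by
        rw [degree, degree.eq_2 i k K, h1.degree_congr h h2, topWord_congr h2]
      have htop : topWord i (k :: k :: L) = topWord i (k :: K) := by
        rw [topWord, topWord.eq_2 i k K, topWord_congr h2]
      rw [hlen, hdeg, htop, smul_smul, smul_smul, mul_assoc, ← psiProd_cons, ← psiProd_cons] at h4
      have := Submodule.add_mem _ h3 h4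
      rwa [sub_add_cancel] at this
    · rw [psiProd_cons, mul_smul]
      exact psi_smul_mem k (ih h)

/-- A vector `ψ_K v` is a combination of vectors `ψ_L v` of the same degree and with the same top
such that `L` is a reduced word of a permutation which keeps the order of neighbours in a segment
and of red strands. -/
theorem psiProd_smul_mem_span (K : List (Fin (N - 1))) :
    psiProd n K • v ∈ Submodule.span ℂ {x | ∃ L : List (Fin (N - 1)), Reduced L ∧
      (∀ k : Fin (N - 1), IsSucc (i (hi k)) (i (lo k)) →
        wordPerm L (lo k) < wordPerm L (hi k)) ∧
      (∀ p q, p < q → IsRed (i p) → IsRed (i q) → wordPerm L p < wordPerm L q) ∧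
      degree i L = degree i K ∧ topWord i L = topWord i K ∧ psiProd n L • v = x} := by
  induction hm : K.length using Nat.strong_induction_on generalizing K with
  | _ m ih =>
    subst hm
    have hshort : crossingSpan i v K.length (degree i K) (topWord i K) ≤ _ :=
      Submodule.span_le.mpr fun x ⟨L, h1, h2, h3, h4⟩ => by
        have := ih L.length h1 L rfl
        rw [h2, h3, h4] at this
        exact this
    by_cases hK : Reduced K
    · by_cases hlink : ∀ k : Fin (N - 1), IsSucc (i (hi k)) (i (lo k)) →
          wordPerm K (lo k) < wordPerm K (hi k)
      · by_cases hred : ∀ p q, p < q → IsRed (i p) → IsRed (i q) → wordPerm K p < wordPerm K q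
        · exact Submodule.subset_span ⟨K, hK, hlink, hred, rfl, rfl, rfl⟩
        · push Not at hred
          obtain ⟨p, q, hpq, hp, hq, hle⟩ := hred
          rw [psiProd_smul_eq_zero_of_red hv hpq hp hq K
            (lt_of_le_of_ne hle ((wordPerm K).injective.ne hpq.ne'))]
          exact Submodule.zero_mem _
      · push Not at hlink
        obtain ⟨k, hk, hle⟩ := hlink
        -- choose a reduced word which ends in `k`, where `ψ_k v = 0`
        have hlt := inv_mul_adj_of_gt
          (lt_of_le_of_ne hle ((wordPerm K).injective.ne (lo_ne_hi k).symm))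
        obtain ⟨L, hL, hL'⟩ := exists_reduced (wordPerm K * adj k)
        have h1 : wordPerm (L ++ [k]) = wordPerm K := by
          rw [wordPerm, List.map_append, List.prod_append]
          change wordPerm L * wordPerm [k] = _
          rw [hL', wordPerm_cons, wordPerm_nil, mul_one, mul_assoc, adj, Equiv.swap_mul_self,
            mul_one]
        have h2 : Reduced (L ++ [k]) := by
          rw [Reduced, h1, ← hlt, ← hL', hL, List.length_append, List.length_singleton]
        have h3 := psiProd_sub_mem hv _ K (L ++ [k]) rfl hK h2 h1.symm
        rw [psiProd_append, psiProd_cons, mul_smul, mul_smul, psiProd_nil, one_smul,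
          hv.2.1 k hk, smul_zero, sub_zero] at h3
        exact hshort h3
    · exact hshort (psiProd_smul_mem_of_not_reduced hv K hK)

end Relations
end Straightening

/-! ### The unique simple quotient of a standard module -/

/-- The span of the diagrams from `i` to `i` of degree at most `-m`. -/
noncomputable def negativePart (i : Word n N) (m : ℕ) : Submodule ℂ (KLRW n N) :=
  Submodule.span ℂ {a | ∃ K : List (Fin (N - 1)), topWord i K = i ∧ degree i K ≤ -(m : ℤ) ∧
    psiProd n K * e i = a}

theorem e_topWord_mul (i : Word n N) (K : List (Fin (N - 1))) :
    e (topWord i K) * (psiProd n K * e i) = psiProd n K * e i := by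
  induction K with
  | nil => rw [psiProd_nil, one_mul, topWord, e_mul_e, if_pos rfl]
  | cons k K ih =>
    rw [psiProd_cons, topWord, mul_assoc, ← mul_assoc (e _), ← psi_mul_e, mul_assoc, ih]

theorem mul_mem_negativePart {i : Word n N} {m m' : ℕ} {a b : KLRW n N}
    (ha : a ∈ negativePart i m) (hb : b ∈ negativePart i m') :
    a * b ∈ negativePart i (m + m') := by
  have h := Submodule.mul_mem_mul ha hb
  rw [negativePart, negativePart, Submodule.span_mul_span] at h
  refine Submodule.span_le.mpr ?_ h
  rintro _ ⟨_, ⟨K, h1, h2, rfl⟩, _, ⟨K', h1', h2', rfl⟩, rfl⟩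
  obtain ⟨h3, h4⟩ := degree_append K K' h1'
  refine Submodule.subset_span ⟨K ++ K', h3.trans h1, by rw [h4]; push_cast; omega, ?_⟩
  have := e_topWord_mul i K'
  rw [h1'] at this
  simp only [psiProd_append, mul_assoc, this]

theorem pow_mem_negativePart {i : Word n N} {a : KLRW n N} (ha : a ∈ negativePart i 1) (m : ℕ) :
    a ^ (m + 1) ∈ negativePart i (m + 1) := by
  induction m with
  | zero => simpa using ha
  | succ m ih => rw [pow_succ]; exact mul_mem_negativePart ih ha

section

variable {X : Type*} [AddCommGroup X] [Module (KLRW n N) X] [Module ℂ X]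
  [IsScalarTower ℂ (KLRW n N) X] {i : Word n N} {v : X}
  (hi : IsSorted i) (hv : SatisfiesStandardRelations i v)
include hi hv

/-- A diagram from `i` to `i` applied to `v` is a combination of vectors `ψ_L v` for reduced
diagrams of the same degree whose permutations are shuffles.  Such a permutation is the identity
or has negative degree, bounded below by the number of crossings. -/
theorem psiProd_smul_induction {K : List (Fin (N - 1))} (hK : topWord i K = i)
    {S : Submodule ℂ X} (h₀ : degree i K = 0 → v ∈ S)
    (h₁ : degree i K < 0 → -(2 * N ^ 2 : ℤ) ≤ degree i K →
      ∀ L : List (Fin (N - 1)), psiProd n L • v ∈ S) : psiProd n K • v ∈ S := by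
  refine Submodule.span_le.mpr ?_ (psiProd_smul_mem_span hv K)
  rintro _ ⟨L, hL, hlink, hred, hdeg, htop, rfl⟩
  have hsh : IsShuffle i (wordPerm L) := by
    refine ⟨fun p => ?_, fun p q hpq hs => ?_, hred⟩
    · rw [← topWord_apply i L p, htop, hK]
    · have h1 : lo ⟨p, by omega⟩ = p := Fin.ext rfl
      have h2 : KLRW.hi ⟨p, by omega⟩ = q := Fin.ext hpq
      have := hlink ⟨p, by omega⟩
      rw [h1, h2] at this
      exact this hs
  by_cases h1 : wordPerm L = 1
  · obtain rfl : L = [] := by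
      rw [← List.length_eq_zero_iff, ← hL, h1, inv_one]
    rw [psiProd_nil, one_smul]
    exact h₀ hdeg.symm
  · have hneg := hsh.sum_crossDeg_neg hi h1
    rw [← hL.degree_eq, hdeg] at hneg
    refine h₁ hneg ?_ L
    have hge : ∀ x ∈ inversions (wordPerm L), (-2 : ℤ) ≤ crossDeg (i x.1) (i x.2) := by
      intro x _
      rw [crossDeg]
      split_ifs <;> omega
    have h2 := Finset.card_nsmul_le_sum _ _ _ hge
    have h3 := Finset.card_le_univ (inversions (wordPerm L))
    rw [Fintype.card_prod, Fintype.card_fin] at h3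
    have h4 : ((inversions (wordPerm L)).card : ℤ) ≤ N ^ 2 := by
      rw [pow_two]; exact_mod_cast h3
    rw [← hL.degree_eq, hdeg, nsmul_eq_mul] at h2
    omega

theorem negativePart_smul_eq_zero {a : KLRW n N} (ha : a ∈ negativePart i (2 * N ^ 2 + 1)) :
    a • v = 0 := by
  induction ha using Submodule.span_induction with
  | mem a ha =>
    obtain ⟨K, h1, h2, rfl⟩ := ha
    rw [mul_smul, hv.1, ← Submodule.mem_bot ℂ]
    push_cast at h2
    exact psiProd_smul_induction hi hv h1 (fun h => by exfalso; nlinarith) (fun _ h => by omega)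
  | zero => rw [zero_smul]
  | add a b _ _ ha hb => rw [add_smul, ha, hb, add_zero]
  | smul c a _ ha => rw [smul_assoc, ha, smul_zero]

theorem pow_smul_eq_zero {a : KLRW n N} (ha : a ∈ negativePart i 1) :
    a ^ (2 * N ^ 2 + 1) • v = 0 :=
  negativePart_smul_eq_zero hi hv (pow_mem_negativePart ha _)

/-- The part of the word `i` in a module generated by `v` consists of multiples of `v` and of vectors
of negative degree. -/
theorem exists_e_smul_eq (hspan : Submodule.span (KLRW n N) {v} = ⊤) (x : X) :
    ∃ c : ℂ, ∃ a ∈ negativePart i 1, e i • x = c • v + a • v := by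
  let T : Submodule ℂ X := Submodule.span ℂ (Set.range fun K : List (Fin (N - 1)) => psiProd n K • v)
  have hcomm := IsScalarTower.to_smulCommClass' (R := ℂ) (A := KLRW n N) (M := X)
  have hstep : ∀ a : KLRW n N, (∀ K : List (Fin (N - 1)), a • psiProd n K • v ∈ T) →
      ∀ x ∈ T, a • x ∈ T := by
    intro a ha x hx
    induction hx using Submodule.span_induction with
    | mem x hx => obtain ⟨K, rfl⟩ := hx; exact ha K
    | zero => rw [smul_zero]; exact T.zero_mem
    | add x y _ _ hx hy => rw [smul_add]; exact T.add_mem hx hy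
    | smul c x _ hx => rw [smul_comm]; exact T.smul_mem c hx
  have hT : ∀ (a : KLRW n N), ∀ x ∈ T.toAddSubgroup, a • x ∈ T.toAddSubgroup := by
    refine smul_mem_of_generators T.toAddSubgroup (fun c x hx => ?_)
      (fun w => hstep _ fun K => ?_) (fun l => hstep _ fun K => ?_) (fun k => hstep _ fun K => ?_)
    · rw [algebraMap_smul]; exact T.smul_mem c hx
    · by_cases hw : w = topWord i K
      · rw [hw, e_topWord_smul hv]; exact Submodule.subset_span ⟨K, rfl⟩
      · rw [e_smul_of_ne (e_topWord_smul hv K) hw]; exact T.zero_mem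
    · refine Submodule.span_mono ?_ (y_smul_psiProd_smul_mem hv l K)
      rintro _ ⟨L, -, -, -, h⟩
      exact ⟨L, h⟩
    · rw [smul_smul, ← psiProd_cons]; exact Submodule.subset_span ⟨_, rfl⟩
  have hx : x ∈ T := by
    obtain ⟨a, rfl⟩ := Submodule.mem_span_singleton.mp (hspan ▸ Submodule.mem_top : x ∈ _)
    exact hT a v (Submodule.subset_span ⟨[], by simp [psiProd_nil]⟩)
  have hzero : (0 : KLRW n N) ∈ negativePart i 1 := Submodule.zero_mem _
  induction hx using Submodule.span_induction with
  | mem x hx =>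
    obtain ⟨K, rfl⟩ := hx
    dsimp only
    by_cases hK : topWord i K = i
    · have hfix := e_topWord_smul hv K
      rw [hK] at hfix
      rw [hfix]
      by_cases hd : degree i K ≤ -1
      · exact ⟨0, _, Submodule.subset_span ⟨K, hK, by exact_mod_cast hd, rfl⟩, by
          rw [zero_smul, zero_add, mul_smul, hv.1]⟩
      · have := psiProd_smul_induction hi hv hK (S := Submodule.span ℂ {v})
          (fun _ => Submodule.mem_span_singleton_self v) (fun h => by omega)
        obtain ⟨c, hc⟩ := Submodule.mem_span_singleton.mp this
        exact ⟨c, 0, hzero, by rw [hc, zero_smul, add_zero]⟩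
    · refine ⟨0, 0, hzero, ?_⟩
      rw [e_smul_of_ne (e_topWord_smul hv K) (Ne.symm hK), zero_smul, zero_smul, add_zero]
  | zero => exact ⟨0, 0, hzero, by simp⟩
  | add x y _ _ hx hy =>
    obtain ⟨c, a, ha, h1⟩ := hx
    obtain ⟨d, b, hb, h2⟩ := hy
    exact ⟨c + d, a + b, Submodule.add_mem _ ha hb, by
      rw [smul_add, h1, h2, add_smul, add_smul]; abel⟩
  | smul c x _ hx =>
    obtain ⟨d, a, ha, h1⟩ := hx
    exact ⟨c * d, c • a, Submodule.smul_mem _ c ha, by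
      rw [smul_comm, h1, smul_add, mul_smul, smul_assoc]⟩

/-- The module generated by `v` has a unique simple quotient: as the negative part acts
nilpotently on `v`, a vector `v + a v` with `a` in the negative part is again a generator. -/
theorem hasUniqueSimpleQuotient_of_isSorted (hspan : Submodule.span (KLRW n N) {v} = ⊤)
    (h0 : v ≠ 0) : HasUniqueSimpleQuotient (KLRW n N) X := by
  let S : AddSubgroup X :=
    { carrier := {x | ∃ a ∈ negativePart i 1, a • v = x}
      zero_mem' := ⟨0, Submodule.zero_mem _, zero_smul _ _⟩
      add_mem' := by
        rintro _ _ ⟨a, ha, rfl⟩ ⟨b, hb, rfl⟩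
        exact ⟨a + b, Submodule.add_mem _ ha hb, add_smul _ _ _⟩
      neg_mem' := by
        rintro _ ⟨a, ha, rfl⟩
        exact ⟨-a, Submodule.neg_mem _ ha, neg_smul _ _⟩ }
  refine hasUniqueSimpleQuotient_of_smul_mem hspan (e i) S ?_ ?_
  · rintro ⟨a, ha, hav⟩
    rw [hv.1] at hav
    have hpow : ∀ m : ℕ, a ^ m • v = v := fun m => by
      induction m with
      | zero => rw [pow_zero, one_smul]
      | succ m ih => rw [pow_succ, mul_smul, hav, ih]
    exact h0 ((hpow _).symm.trans (pow_smul_eq_zero hi hv ha))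
  · intro K hvK x hx
    obtain ⟨c, a, ha, h1⟩ := exists_e_smul_eq hi hv hspan x
    by_cases hc : c = 0
    · exact ⟨a, ha, by rw [h1, hc, zero_smul, zero_add]⟩
    exfalso
    apply hvK
    set b := -(c⁻¹ • a) with hb
    have hbn : b ∈ negativePart i 1 := Submodule.neg_mem _ (Submodule.smul_mem _ _ ha)
    have hmem : v - b • v ∈ K := by
      have := K.smul_mem (algebraMap ℂ (KLRW n N) c⁻¹) (K.smul_mem (e i) hx)
      rw [h1, algebraMap_smul, smul_add, smul_smul, inv_mul_cancel₀ hc, one_smul, ← smul_assoc]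
        at this
      rwa [hb, neg_smul, sub_neg_eq_add]
    -- the geometric series in `b`
    have hgeom : ∀ m : ℕ, v - b ^ m • v ∈ K := fun m => by
      induction m with
      | zero => rw [pow_zero, one_smul, sub_self]; exact K.zero_mem
      | succ m ih =>
        have := K.add_mem ih (K.smul_mem (b ^ m) hmem)
        rwa [smul_sub, sub_add_sub_cancel, smul_smul, ← pow_succ] at this
    have := hgeom (2 * N ^ 2 + 1)
    rwa [pow_smul_eq_zero hi hv hbn, sub_zero] at this

end

/-! ### The submodule generated by an evaluation functional -/

/-- A functional on the polynomial representation as a linear map. -/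
def PolyDual.toLinearMap (ξ : PolyDual n N) : Poly n N →ₗ[ℂ] ℂ := ξ

theorem PolyDual.ext {ξ η : PolyDual n N}
    (h : ∀ w f, ξ.toLinearMap (Poly.single w f) = η.toLinearMap (Poly.single w f)) : ξ = η :=
  LinearMap.pi_ext (φ := fun _ : Word n N => MvPolynomial (Fin N) ℂ) h

theorem PolyDual.smul_apply (a : KLRW n N) (ξ : PolyDual n N) (p : Poly n N) :
    (a • ξ).toLinearMap p = ξ.toLinearMap (polyRep n N (MulOpposite.unop (flip n N a)) p) := rfl

theorem PolyDual.zero_apply (p : Poly n N) : (0 : PolyDual n N).toLinearMap p = 0 := rfl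

theorem PolyDual.add_apply (ξ η : PolyDual n N) (p : Poly n N) :
    (ξ + η).toLinearMap p = ξ.toLinearMap p + η.toLinearMap p := rfl

theorem PolyDual.neg_apply (ξ : PolyDual n N) (p : Poly n N) :
    (-ξ).toLinearMap p = -ξ.toLinearMap p := rfl

theorem PolyDual.algebraMap_smul_apply (c : ℂ) (ξ : PolyDual n N) (p : Poly n N) :
    (algebraMap ℂ (KLRW n N) c • ξ).toLinearMap p = c * ξ.toLinearMap p := by
  rw [smul_apply, AlgHom.commutes, MulOpposite.algebraMap_apply, MulOpposite.unop_op,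
    AlgHom.commutes, Module.algebraMap_end_apply, map_smul, smul_eq_mul]

theorem PolyDual.e_smul_apply (w : Word n N) (ξ : PolyDual n N) (v : Word n N)
    (f : MvPolynomial (Fin N) ℂ) : (e w • ξ).toLinearMap (Poly.single v f) =
      if w = v then ξ.toLinearMap (Poly.single v f) else 0 := by
  rw [smul_apply, flip_e, MulOpposite.unop_op, polyRep_e, polyGen_e]
  split_ifs <;> simp

theorem PolyDual.y_smul_apply (k : Fin N) (ξ : PolyDual n N) (v : Word n N)
    (f : MvPolynomial (Fin N) ℂ) : (y n k • ξ).toLinearMap (Poly.single v f) =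
      ξ.toLinearMap (Poly.single v (MvPolynomial.X k * f)) := by
  rw [smul_apply, flip_y, MulOpposite.unop_op, polyRep_y, polyGen_y]

theorem PolyDual.psi_smul_apply (k : Fin (N - 1)) (ξ : PolyDual n N) (v : Word n N)
    (f : MvPolynomial (Fin N) ℂ) : (psi n k • ξ).toLinearMap (Poly.single v f) =
      ξ.toLinearMap (Poly.single (v.swap k) (cross (v (lo k)) (v (hi k)) (lo k) (hi k) f)) := by
  rw [smul_apply, flip_psi, MulOpposite.unop_op, polyRep_psi, polyGen_psi]

theorem ev_apply (i w : Word n N) (f : MvPolynomial (Fin N) ℂ) :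
    (ev i).toLinearMap (Poly.single w f) =
      if i = w then MvPolynomial.aeval (fun _ : Fin N => (0 : ℂ)) f else 0 := by
  change MvPolynomial.aeval (fun _ : Fin N => (0 : ℂ)) (Poly.coeff i (Poly.single w f)) = _
  rw [Poly.coeff_single]
  split_ifs <;> simp

/-- The evaluation functional satisfies the relations of the standard module, for any word: a
crossing of `i_k` and `i_{k+1} = i_k - 1` acts on the polynomial representation by a multiple of
`Y_k - Y_{k+1}`, which vanishes at the origin. -/
theorem satisfiesStandardRelations_ev (i : Word n N) : SatisfiesStandardRelations i (ev i) := by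
  refine ⟨PolyDual.ext fun w f => ?_, fun k hk => PolyDual.ext fun w f => ?_,
    fun k => PolyDual.ext fun w f => ?_⟩
  · rw [PolyDual.e_smul_apply, ev_apply]
    split_ifs <;> rfl
  · rw [PolyDual.psi_smul_apply, ev_apply, PolyDual.zero_apply]
    split_ifs with h
    · subst h
      rw [swap_lo, swap_hi] at hk
      have hne : w (lo k) ≠ w (hi k) := by intro h; rw [h] at hk; simp [IsSucc] at hk
      rw [cross_diff hne, factor, if_pos hk]
      simp
    · rfl
  · rw [PolyDual.y_smul_apply, ev_apply, PolyDual.zero_apply]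
    simp

/-- The ideal of polynomials without constant term. -/
noncomputable def originIdeal (N : ℕ) : Ideal (MvPolynomial (Fin N) ℂ) := Ideal.span (Set.range MvPolynomial.X)

theorem X_mem_originIdeal (k : Fin N) : MvPolynomial.X k ∈ originIdeal N :=
  Ideal.subset_span ⟨k, rfl⟩

theorem swapVar_mem_pow (p q : Fin N) (D : ℕ) {f : MvPolynomial (Fin N) ℂ}
    (hf : f ∈ originIdeal N ^ D) : swapVar p q f ∈ originIdeal N ^ D := by
  have h1 : (originIdeal N).map (swapVar p q) ≤ originIdeal N := by
    rw [originIdeal, Ideal.map_span, Ideal.span_le]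
    rintro _ ⟨_, ⟨k, rfl⟩, rfl⟩
    rw [swapVar_X]
    exact X_mem_originIdeal _
  have h2 := Ideal.mem_map_of_mem (swapVar p q) hf
  rw [Ideal.map_pow] at h2
  exact Ideal.pow_right_mono h1 D h2

theorem divDiff_mem_pow {p q : Fin N} (h : p ≠ q) (D : ℕ) {f : MvPolynomial (Fin N) ℂ}
    (hf : f ∈ originIdeal N ^ (D + 1)) : divDiff p q f ∈ originIdeal N ^ D := by
  induction D generalizing f with
  | zero => simp
  | succ D ih =>
    rw [pow_succ] at hf
    induction hf using Submodule.mul_induction_on' with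
    | mem_mul_mem a ha b hb =>
      rw [divDiff_mul h]
      refine Ideal.add_mem _ (Ideal.mul_mem_right _ _ (swapVar_mem_pow p q _ ha)) ?_
      rw [pow_succ]
      exact Ideal.mul_mem_mul (ih ha) hb
    | add a _ b _ ha hb => rw [map_add]; exact Ideal.add_mem _ ha hb

theorem cross_mem_pow {p q : Fin N} (h : p ≠ q) (a b : Fin n) (D : ℕ)
    {f : MvPolynomial (Fin N) ℂ} (hf : f ∈ originIdeal N ^ (D + 1)) :
    cross a b p q f ∈ originIdeal N ^ D := by
  by_cases hab : a = b
  · subst hab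
    by_cases hr : IsRed a
    · rw [cross_red hr]; exact Ideal.zero_mem _
    · rw [cross_same hr]; exact divDiff_mem_pow h D hf
  · rw [cross_diff hab]
    exact Ideal.mul_mem_left _ _ (Ideal.pow_le_pow_right (Nat.le_succ D) (swapVar_mem_pow p q _ hf))

/-- A functional which vanishes on polynomials of order at least `D`. -/
def PolyDual.VanishesAbove (D : ℕ) (ξ : PolyDual n N) : Prop :=
  ∀ w, ∀ f ∈ originIdeal N ^ D, ξ.toLinearMap (Poly.single w f) = 0

theorem PolyDual.VanishesAbove.mono {D D' : ℕ} (h : D ≤ D') {ξ : PolyDual n N}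
    (hξ : ξ.VanishesAbove D) : ξ.VanishesAbove D' :=
  fun w f hf => hξ w f (Ideal.pow_le_pow_right h hf)

theorem exists_vanishesAbove {i : Word n N} {ξ : PolyDual n N} (hξ : ξ ∈ preCanonical i) :
    ∃ D, ξ.VanishesAbove D := by
  let S : AddSubgroup (PolyDual n N) :=
    { carrier := {ξ | ∃ D, ξ.VanishesAbove D}
      zero_mem' := ⟨0, fun _ _ _ => rfl⟩
      add_mem' := by
        rintro ξ η ⟨D, hξ⟩ ⟨D', hη⟩
        refine ⟨max D D', fun w f hf => ?_⟩
        rw [PolyDual.add_apply, hξ.mono (le_max_left _ _) w f hf,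
          hη.mono (le_max_right _ _) w f hf, add_zero]
      neg_mem' := by
        rintro ξ ⟨D, hξ⟩
        exact ⟨D, fun w f hf => by rw [PolyDual.neg_apply, hξ w f hf, neg_zero]⟩ }
  obtain ⟨a, rfl⟩ := Submodule.mem_span_singleton.mp hξ
  refine smul_mem_of_generators S ?_ ?_ ?_ ?_ a (ev i) ⟨1, fun w f hf => ?_⟩
  · rintro c ξ ⟨D, hξ⟩
    exact ⟨D, fun w f hf => by rw [PolyDual.algebraMap_smul_apply, hξ w f hf, mul_zero]⟩
  · rintro w ξ ⟨D, hξ⟩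
    refine ⟨D, fun v f hf => ?_⟩
    rw [PolyDual.e_smul_apply, hξ v f hf, ite_self]
  · rintro k ξ ⟨D, hξ⟩
    exact ⟨D, fun v f hf => by
      rw [PolyDual.y_smul_apply, hξ v _ (Ideal.mul_mem_left _ _ hf)]⟩
  · rintro k ξ ⟨D, hξ⟩
    exact ⟨D + 1, fun v f hf => by
      rw [PolyDual.psi_smul_apply, hξ _ _ (cross_mem_pow (lo_ne_hi k) _ _ D hf)]⟩
  · rw [ev_apply]
    split_ifs with h
    · rw [pow_one] at hf
      have hle : originIdeal N ≤
          RingHom.ker (MvPolynomial.aeval (R := ℂ) (fun _ : Fin N => (0 : ℂ))) := by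
        rw [originIdeal, Ideal.span_le]
        rintro _ ⟨k, rfl⟩
        simp [RingHom.mem_ker]
      exact hle hf
    · rfl

theorem preCanonicalGen_coe (i : Word n N) : (preCanonicalGen i : PolyDual n N) = ev i := rfl

theorem satisfiesStandardRelations_preCanonicalGen (i : Word n N) :
    SatisfiesStandardRelations i (preCanonicalGen i) :=
  have h := satisfiesStandardRelations_ev i
  ⟨Subtype.ext h.1, fun k hk => Subtype.ext (h.2.1 k hk), fun k => Subtype.ext (h.2.2 k)⟩

theorem span_preCanonicalGen (i : Word n N) :
    Submodule.span (KLRW n N) {preCanonicalGen i} = ⊤ := by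
  rw [eq_top_iff]
  rintro ⟨x, hx⟩ -
  obtain ⟨a, rfl⟩ := Submodule.mem_span_singleton.mp hx
  exact Submodule.mem_span_singleton.mpr ⟨a, rfl⟩

theorem preCanonicalGen_ne_zero (i : Word n N) : preCanonicalGen i ≠ 0 := by
  intro h
  have h1 := congrArg (fun ξ : preCanonical i =>
    (ξ : PolyDual n N).toLinearMap (Poly.single i 1)) h
  simp [preCanonicalGen_coe, ev_apply, PolyDual.zero_apply] at h1

/-- The functional `ev_i` is up to scalars the only functional on the summand of `i` which is
killed by all dots. -/
theorem eq_smul_ev {i : Word n N} {ξ : PolyDual n N} (hξ : e i • ξ = ξ)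
    (hy : ∀ k : Fin N, y n k • ξ = 0) :
    ξ = algebraMap ℂ (KLRW n N) (ξ.toLinearMap (Poly.single i 1)) • ev i := by
  refine PolyDual.ext fun w f => ?_
  rw [PolyDual.algebraMap_smul_apply, ev_apply]
  by_cases h : i = w
  · subst h
    rw [if_pos rfl]
    induction f using MvPolynomial.induction_on with
    | C a =>
      rw [MvPolynomial.C_eq_smul_one, map_smul, map_smul, map_smul]
      simp [mul_comm]
    | add f g hf hg => rw [map_add, map_add, map_add, hf, hg, mul_add]
    | mul_X f k _ =>
      rw [mul_comm f, ← PolyDual.y_smul_apply, hy, PolyDual.zero_apply]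
      simp
  · rw [if_neg h, mul_zero, ← hξ, PolyDual.e_smul_apply, if_neg h]

/-- A submodule of `N'(i)` in which the word `i` occurs contains the generator: the dots are
nilpotent on its elements, and `ev_i` spans the vectors of the word `i` killed by all dots. -/
theorem preCanonicalGen_mem {i : Word n N} {K : Submodule (KLRW n N) (preCanonical i)} (D : ℕ) :
    ∀ x ∈ K, e i • x = x → x ≠ 0 → (x : PolyDual n N).VanishesAbove D → preCanonicalGen i ∈ K := by
  induction D with
  | zero =>
    intro x _ _ h0 hD
    exact absurd (Subtype.ext (PolyDual.ext fun w f => hD w f (by simp))) h0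
  | succ D ih =>
    intro x hx hi h0 hD
    by_cases hy : ∃ k : Fin N, y n k • x ≠ 0
    · obtain ⟨k, hk⟩ := hy
      refine ih _ (K.smul_mem _ hx) (e_smul_y_smul k hi) hk fun w f hf => ?_
      rw [Submodule.coe_smul, PolyDual.y_smul_apply]
      refine hD _ _ ?_
      rw [pow_succ, mul_comm (MvPolynomial.X k)]
      exact Ideal.mul_mem_mul hf (X_mem_originIdeal k)
    · push Not at hy
      have h1 := eq_smul_ev (ξ := (x : PolyDual n N)) (congrArg Subtype.val hi)
        (fun k => congrArg Subtype.val (hy k))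
      set c := (x : PolyDual n N).toLinearMap (Poly.single i 1)
      have h2 : x = algebraMap ℂ (KLRW n N) c • preCanonicalGen i := Subtype.ext h1
      have hc : c ≠ 0 := by
        intro hc
        rw [hc, map_zero, zero_smul] at h2
        exact h0 h2
      have := K.smul_mem (algebraMap ℂ (KLRW n N) c⁻¹) hx
      rwa [h2, smul_smul, ← map_mul, inv_mul_cancel₀ hc, map_one, one_smul] at this

theorem hasUniqueSimpleQuotient_preCanonical (i : Word n N) :
    HasUniqueSimpleQuotient (KLRW n N) (preCanonical i) := by
  refine hasUniqueSimpleQuotient_of_smul_mem (span_preCanonicalGen i) (e i) ⊥ ?_ ?_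
  · rw [(satisfiesStandardRelations_preCanonicalGen i).1]
    exact preCanonicalGen_ne_zero i
  · intro K hK x hx
    by_contra hne
    obtain ⟨D, hD⟩ := exists_vanishesAbove (e i • x).2
    exact hK (preCanonicalGen_mem D _ (K.smul_mem _ hx) (e_smul_e_smul i x) hne hD)

theorem SatisfiesStandardRelations.map {X Y : Type*} [AddCommGroup X] [Module (KLRW n N) X]
    [AddCommGroup Y] [Module (KLRW n N) Y] {i : Word n N} {v : X}
    (hv : SatisfiesStandardRelations i v) (f : X →ₗ[KLRW n N] Y) :
    SatisfiesStandardRelations i (f v) :=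
  ⟨by rw [← map_smul, hv.1], fun k hk => by rw [← map_smul, hv.2.1 k hk, map_zero],
    fun k => by rw [← map_smul, hv.2.2 k, map_zero]⟩

theorem satisfiesStandardRelations_canonicalGen (i : Word n N) :
    SatisfiesStandardRelations i (canonicalGen i) :=
  (satisfiesStandardRelations_preCanonicalGen i).map (Submodule.mkQ _)

theorem isSimpleModule_canonical (i : Word n N) : IsSimpleModule (KLRW n N) (Canonical i) :=
  (hasUniqueSimpleQuotient_preCanonical i).isSimpleModule_head

/-- The generator of the standard module. -/
noncomputable def standardGen (i : Word n N) : Standard i := Submodule.Quotient.mk 1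

theorem smul_standardGen (i : Word n N) (a : KLRW n N) :
    a • standardGen i = Submodule.Quotient.mk a := by
  rw [standardGen, ← Submodule.Quotient.mk_smul, smul_eq_mul, mul_one]

theorem span_standardGen (i : Word n N) : Submodule.span (KLRW n N) {standardGen i} = ⊤ := by
  rw [eq_top_iff]
  rintro x -
  obtain ⟨a, rfl⟩ := Submodule.Quotient.mk_surjective _ x
  exact Submodule.mem_span_singleton.mpr ⟨a, smul_standardGen i a⟩

theorem satisfiesStandardRelations_standardGen (i : Word n N) :
    SatisfiesStandardRelations i (standardGen i) := by
  refine ⟨?_, fun k hk => ?_, fun k => ?_⟩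
  · rw [smul_standardGen, standardGen, Submodule.Quotient.eq]
    exact Submodule.subset_span (Or.inl (Or.inl rfl))
  · rw [smul_standardGen, Submodule.Quotient.mk_eq_zero]
    exact Submodule.subset_span (Or.inl (Or.inr ⟨k, hk, rfl⟩))
  · rw [smul_standardGen, Submodule.Quotient.mk_eq_zero]
    exact Submodule.subset_span (Or.inr ⟨k, rfl⟩)

/-- The universal property of the standard module. -/
theorem exists_standard_hom {X : Type*} [AddCommGroup X] [Module (KLRW n N) X] {i : Word n N}
    {v : X} (hv : SatisfiesStandardRelations i v) :
    ∃ f : Standard i →ₗ[KLRW n N] X, f (standardGen i) = v := by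
  refine ⟨(standardIdeal i).liftQ (LinearMap.toSpanSingleton (KLRW n N) X v) ?_, ?_⟩
  · rw [standardIdeal, Submodule.span_le]
    rintro x ((hx | ⟨k, hk, rfl⟩) | ⟨k, rfl⟩)
    · rw [Set.mem_singleton_iff.mp hx]
      simp [sub_smul, hv.1]
    · simp [hv.2.1 k hk]
    · simp [hv.2.2 k]
  · rw [standardGen, Submodule.liftQ_apply]
    simp

theorem standardGen_ne_zero (i : Word n N) : standardGen i ≠ 0 := by
  obtain ⟨f, hf⟩ := exists_standard_hom (satisfiesStandardRelations_preCanonicalGen i)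
  intro h
  rw [h, map_zero] at hf
  exact preCanonicalGen_ne_zero i hf.symm

theorem hasUniqueSimpleQuotient_standard {i : Word n N} (hi : IsSorted i) :
    HasUniqueSimpleQuotient (KLRW n N) (Standard i) :=
  hasUniqueSimpleQuotient_of_isSorted hi (satisfiesStandardRelations_standardGen i)
    (span_standardGen i) (standardGen_ne_zero i)

/-- A simple module which contains a nonzero vector satisfying the relations of a standard module
of a sorted word is the simple quotient of this standard module. -/
theorem exists_simpleHead_equiv {X : Type*} [AddCommGroup X] [Module (KLRW n N) X]
    [IsSimpleModule (KLRW n N) X] {i : Word n N} (hi : IsSorted i) {v : X}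
    (hv : SatisfiesStandardRelations i v) (h0 : v ≠ 0) :
    ∃ φ : SimpleHead i ≃ₗ[KLRW n N] X, φ (simpleHeadGen i) = v := by
  obtain ⟨f, hf⟩ := exists_standard_hom hv
  have hne : f ≠ 0 := by
    rintro rfl
    exact h0 hf.symm
  obtain ⟨φ, hφ⟩ := (hasUniqueSimpleQuotient_standard hi).exists_head_equiv
    (LinearMap.surjective_of_ne_zero hne)
  exact ⟨φ, (hφ _).trans hf⟩

theorem canonicalGen_ne_zero (i : Word n N) : canonicalGen i ≠ 0 := by
  intro h
  have := isSimpleModule_canonical i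
  have hnt := IsSimpleModule.nontrivial (KLRW n N) (Canonical i)
  have hmem : preCanonicalGen i ∈ Module.jacobson (KLRW n N) (preCanonical i) :=
    (Submodule.Quotient.mk_eq_zero _).mp h
  rw [← Submodule.span_singleton_le_iff_mem, span_preCanonicalGen] at hmem
  exact not_subsingleton _ (Submodule.Quotient.subsingleton_iff.mpr (top_le_iff.mp hmem))

/-! ### Symmetric polynomials in the dots -/

/-- The values on polynomials of the dots. -/
noncomputable def dotPoly (n N : ℕ) : MvPolynomial (Fin N) ℂ →ₐ[ℂ] KLRW n N :=
  have hcomm : ∀ a ∈ Set.range (y n), ∀ b ∈ Set.range (y n (N := N)), a * b = b * a := by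
    rintro _ ⟨k, rfl⟩ _ ⟨l, rfl⟩
    simpa only [map_mul, mk_fy] using mk_rel (Rel.y_y (n := n) k l)
  letI : CommRing (Algebra.adjoin ℂ (Set.range (y n (N := N)))) :=
    { (inferInstance : Ring (Algebra.adjoin ℂ (Set.range (y n (N := N))))) with
      mul_comm := (Algebra.isMulCommutative_adjoin ℂ hcomm).is_comm.comm }
  (Algebra.adjoin ℂ (Set.range (y n (N := N)))).val.comp
    (MvPolynomial.aeval fun k => ⟨y n k, Algebra.subset_adjoin ⟨k, rfl⟩⟩)

@[simp] theorem dotPoly_X (k : Fin N) : dotPoly n N (MvPolynomial.X k) = y n k := by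
  simp [dotPoly]

section

variable {X : Type*} [AddCommGroup X] [Module (KLRW n N) X]

theorem e_commute_dotPoly (w : Word n N) (f : MvPolynomial (Fin N) ℂ) :
    Commute (e w) (dotPoly n N f) := by
  induction f using MvPolynomial.induction_on with
  | C c => rw [← MvPolynomial.algebraMap_eq, AlgHom.commutes]; exact (Algebra.commutes c _).symm
  | add f g hf hg => rw [map_add]; exact hf.add_right hg
  | mul_X f k hf => rw [map_mul, dotPoly_X]; exact hf.mul_right (e_mul_y k w)

theorem e_smul_dotPoly_smul {w : Word n N} {x : X} (hx : e w • x = x)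
    (f : MvPolynomial (Fin N) ℂ) : e w • dotPoly n N f • x = dotPoly n N f • x := by
  rw [smul_smul, (e_commute_dotPoly w f).eq, mul_smul, hx]

/-- Moving a polynomial in the dots through a crossing of strands with different labels. -/
theorem psi_smul_dotPoly_smul_of_ne {k : Fin (N - 1)} {w : Word n N} (h : w (lo k) ≠ w (hi k))
    (f : MvPolynomial (Fin N) ℂ) : ∀ x : X, e w • x = x →
    psi n k • dotPoly n N f • x = dotPoly n N (swapVar (lo k) (hi k) f) • psi n k • x := by
  induction f using MvPolynomial.induction_on with
  | C c =>
    intro x _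
    rw [← MvPolynomial.algebraMap_eq, AlgHom.commutes, AlgHom.commutes, AlgHom.commutes, smul_smul,
      smul_smul, Algebra.commutes]
  | add f g hf hg =>
    intro x hx
    rw [map_add, map_add, map_add, add_smul, add_smul, smul_add, hf x hx, hg x hx]
  | mul_X f l hf =>
    intro x hx
    rw [map_mul, map_mul, map_mul, mul_smul, mul_smul, swapVar_X, dotPoly_X, dotPoly_X,
      hf _ (e_smul_y_smul l hx)]
    congr 1
    by_cases h1 : l = lo k
    · rw [h1, Equiv.swap_apply_left, y_hi_smul_psi_smul_of_ne hx h]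
    by_cases h2 : l = hi k
    · rw [h2, Equiv.swap_apply_right, y_lo_smul_psi_smul_of_ne hx h]
    rw [Equiv.swap_apply_of_ne_of_ne h1 h2, psi_smul_y_smul_far h1 h2]

/-- Moving a polynomial in the dots through a crossing of black strands with equal labels. -/
theorem psi_smul_dotPoly_smul_of_eq {k : Fin (N - 1)} {w : Word n N} (h : w (lo k) = w (hi k))
    (hr : ¬ IsRed (w (lo k))) (f : MvPolynomial (Fin N) ℂ) : ∀ x : X, e w • x = x →
    psi n k • dotPoly n N f • x = dotPoly n N (swapVar (lo k) (hi k) f) • psi n k • x +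
      dotPoly n N (divDiff (lo k) (hi k) f) • x := by
  have hlh := lo_ne_hi k
  induction f using MvPolynomial.induction_on with
  | C c =>
    intro x _
    have h0 : divDiff (lo k) (hi k) (MvPolynomial.C c : MvPolynomial (Fin N) ℂ) = 0 :=
      divDiff_of_symm hlh (by rw [← MvPolynomial.algebraMap_eq, AlgHom.commutes])
    rw [h0, map_zero, zero_smul, add_zero, ← MvPolynomial.algebraMap_eq, AlgHom.commutes,
      AlgHom.commutes, AlgHom.commutes, smul_smul, smul_smul, Algebra.commutes]
  | add f g hf hg =>
    intro x hx
    rw [map_add, map_add, map_add, map_add, map_add, add_smul, add_smul, add_smul, smul_add,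
      hf x hx, hg x hx]
    abel
  | mul_X f l hf =>
    intro x hx
    have key : psi n k • y n l • x = dotPoly n N (swapVar (lo k) (hi k) (MvPolynomial.X l)) •
        psi n k • x + dotPoly n N (divDiff (lo k) (hi k) (MvPolynomial.X l)) • x := by
      rw [swapVar_X, dotPoly_X]
      by_cases h1 : l = lo k
      · rw [h1, Equiv.swap_apply_left, divDiff_X_left hlh, map_one, one_smul,
          y_hi_smul_psi_smul_of_eq hx h hr, sub_add_cancel]
      by_cases h2 : l = hi k
      · rw [h2, Equiv.swap_apply_right, divDiff_X_right hlh, map_neg, map_one, neg_one_smul,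
          y_lo_smul_psi_smul_of_eq hx h hr, add_neg_cancel_right]
      rw [divDiff_of_symm hlh (by rw [swapVar_X, Equiv.swap_apply_of_ne_of_ne h1 h2]),
        Equiv.swap_apply_of_ne_of_ne h1 h2, psi_smul_y_smul_far h1 h2, map_zero, zero_smul,
        add_zero]
    rw [map_mul, mul_smul, dotPoly_X, hf _ (e_smul_y_smul l hx), key, divDiff_mul hlh, map_mul,
      map_mul, map_add, map_mul, map_mul, dotPoly_X, add_smul, mul_smul, mul_smul, mul_smul,
      smul_add, add_assoc]

end

/-- Symmetric polynomials in the dots are central. -/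
theorem commute_dotPoly_of_isSymmetric {f : MvPolynomial (Fin N) ℂ} (hf : f.IsSymmetric)
    (a : KLRW n N) : Commute a (dotPoly n N f) := by
  refine commute_of_generators (fun w => e_commute_dotPoly w f) (fun k => ?_) (fun k => ?_) a
  · rw [← dotPoly_X, Commute, SemiconjBy, ← map_mul, mul_comm, map_mul]
  · have hs : swapVar (lo k) (hi k) f = f := hf _
    have key : ∀ w : Word n N, psi n k * dotPoly n N f * e w = dotPoly n N f * psi n k * e w := by
      intro w
      have hw : e w • e w = e w := by rw [smul_eq_mul, e_mul_e, if_pos rfl]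
      rw [mul_assoc, mul_assoc]
      by_cases h : w (lo k) = w (hi k)
      · by_cases hr : IsRed (w (lo k))
        · have h1 := psi_smul_of_red (e_smul_dotPoly_smul hw f) h hr
          have h2 := psi_smul_of_red hw h hr
          simp only [smul_eq_mul] at h1 h2
          rw [h1, h2, mul_zero]
        · have h1 := psi_smul_dotPoly_smul_of_eq h hr f _ hw
          rw [hs, divDiff_of_symm (lo_ne_hi k) hs, map_zero, zero_smul, add_zero] at h1
          exact h1
      · have h1 := psi_smul_dotPoly_smul_of_ne h f _ hw
        rw [hs] at h1
        exact h1
    have h1 := Finset.sum_congr rfl fun w (_ : w ∈ Finset.univ) => key w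
    rwa [← Finset.mul_sum, ← Finset.mul_sum, sum_e, mul_one, mul_one] at h1

/-! ### Graded simple modules -/

section Graded

variable {R M : Type*} [Ring R] [AddCommGroup M] [Module R M] {A : ℤ → AddSubgroup M}

/-- Raising the degree by `s` shifts the homogeneous components. -/
theorem decompose_smul_of_shift [DirectSum.Decomposition A] {z : R} {s : ℤ}
    (hz : ∀ d, ∀ m ∈ A d, z • m ∈ A (d + s)) (d : ℤ) (x : M) :
    (DirectSum.decompose A (z • x) (d + s) : M) = z • (DirectSum.decompose A x d : M) := by
  induction x using DirectSum.Decomposition.inductionOn A with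
  | zero => simp
  | @homogeneous c m =>
    by_cases h : c = d
    · subst h
      rw [DirectSum.decompose_of_mem_same A (hz _ _ m.2), DirectSum.decompose_of_mem_same A m.2]
    · rw [DirectSum.decompose_of_mem_ne A (hz _ _ m.2) (by simpa using h),
        DirectSum.decompose_of_mem_ne A m.2 h, smul_zero]
  | add x x' hx hx' =>
    rw [smul_add, DirectSum.decompose_add, DirectSum.decompose_add, DirectSum.add_apply,
      DirectSum.add_apply, AddSubgroup.coe_add, AddSubgroup.coe_add, hx, hx', smul_add]

/-- A central element of positive degree acts by zero on a graded simple module: otherwise both `z`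
and `1 + z` act by automorphisms, but for a homogeneous vector `m` the equation `m = x + z x` has
no solution with finitely many homogeneous components. -/
theorem smul_eq_zero_of_shift [IsSimpleModule R M] (hA : DirectSum.IsInternal A) {z : R}
    (hc : ∀ a, Commute a z) {s : ℤ} (hs : 0 < s) (hz : ∀ d, ∀ m ∈ A d, z • m ∈ A (d + s))
    (x : M) : z • x = 0 := by
  classical
  let := hA.chooseDecomposition
  let f : M →ₗ[R] M :=
    { toFun := fun x => z • x
      map_add' := smul_add z
      map_smul' := fun a x => by rw [smul_smul, smul_smul, ← (hc a).eq]; rfl }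
  obtain hf | hf := f.bijective_or_eq_zero
  swap
  · exact LinearMap.congr_fun hf x
  exfalso
  have hinj : ∀ m : M, z • m = 0 → m = 0 := fun m hm => hf.1 (hm.trans (map_zero f).symm)
  have hM := IsSimpleModule.nontrivial R M
  obtain ⟨m, d, hm, hm0⟩ : ∃ (m : M) (d : ℤ), m ∈ A d ∧ m ≠ 0 := by
    obtain ⟨x, hx⟩ := exists_ne (0 : M)
    by_contra! h
    refine hx ?_
    rw [← DirectSum.sum_support_decompose A x]
    exact Finset.sum_eq_zero fun d _ => h _ d (Subtype.mem _)
  have hcomp : ∀ x : M, x + z • x = m → False := by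
    intro x hx
    -- the components of `x`
    obtain ⟨p, hp, hfin⟩ : ∃ p : ℤ → M,
        (∀ c, p (c + s) + z • p c = if c + s = d then m else 0) ∧ p.support.Finite := by
      refine ⟨fun c => DirectSum.decompose A x c, fun c => ?_,
        (DirectSum.decompose A x).support.finite_toSet.subset fun c hc => ?_⟩
      · rw [← decompose_smul_of_shift hz, ← AddSubgroup.coe_add, ← DirectSum.add_apply,
          ← DirectSum.decompose_add, hx]
        split_ifs with h
        · rw [h, DirectSum.decompose_of_mem_same A hm]
        · rw [DirectSum.decompose_of_mem_ne A hm (Ne.symm h)]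
      · simpa [DFinsupp.mem_support_iff] using hc
    have hinf : ∀ g : ℕ → ℤ, Function.Injective g → ¬ ∀ k, p (g k) ≠ 0 := fun g hg h =>
      Set.infinite_range_of_injective hg (hfin.subset (by rintro _ ⟨k, rfl⟩; exact h k))
    by_cases h0 : p d = 0
    -- the component of degree `d - s` is nonzero, hence so are those of degrees `d - k s`
    · refine hinf (fun k => d - (k + 1) * s) (fun k l h => ?_) fun k => ?_
      · have := mul_right_cancel₀ hs.ne' (sub_right_injective h)
        exact_mod_cast add_right_cancel this
      · induction k with
        | zero =>
          intro h
          have := hp (d - s)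
          rw [sub_add_cancel, h0, zero_add, if_pos rfl] at this
          simp only [Nat.cast_zero, zero_add, one_mul] at h
          rw [h, smul_zero] at this
          exact hm0 this.symm
        | succ k ih =>
          intro h
          have := hp (d - ((k + 1 : ℕ) + 1) * s)
          rw [h, smul_zero, add_zero, if_neg (by push_cast; nlinarith)] at this
          refine ih ?_
          convert this using 2
          push_cast
          ring
    -- the components of degrees `d + k s` are nonzero
    · refine hinf (fun k => d + k * s) (fun k l h => ?_) fun k => ?_
      · have := mul_right_cancel₀ hs.ne' (add_left_cancel h)
        exact_mod_cast this
      · induction k with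
        | zero => simpa using h0
        | succ k ih =>
          intro h
          have := hp (d + k * s)
          have he : d + k * s + s = d + (k + 1 : ℕ) * s := by push_cast; ring
          rw [he, h, zero_add, if_neg (by push_cast; nlinarith)] at this
          exact ih (hinj _ this)
  obtain hg | hg := (LinearMap.id + f).bijective_or_eq_zero
  · obtain ⟨x, hx⟩ := hg.2 m
    exact hcomp x hx
  · have h1 : m + z • m = 0 := LinearMap.congr_fun hg m
    have h2 := decompose_smul_of_shift hz d m
    rw [← neg_eq_of_add_eq_zero_right h1, DirectSum.decompose_of_mem_same A hm,
      DirectSum.decompose_of_mem_ne A (neg_mem hm) (by omega)] at h2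
    exact hm0 (hinj m h2.symm)

end Graded

section

variable {M : Type*} [AddCommGroup M] [Module (KLRW n N) M]

theorem dotPoly_esymm_smul_mem {A : ℤ → AddSubgroup M}
    (hy : ∀ (d : ℤ) (k : Fin N), ∀ m ∈ A d, y n k • m ∈ A (d + 2)) (j : ℕ) (d : ℤ) (m : M)
    (hm : m ∈ A d) : dotPoly n N (MvPolynomial.esymm (Fin N) ℂ j) • m ∈ A (d + 2 * j) := by
  have hprod : ∀ t : Finset (Fin N),
      dotPoly n N (∏ k ∈ t, MvPolynomial.X k) • m ∈ A (d + 2 * t.card) := by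
    intro t
    induction t using Finset.induction_on with
    | empty => simpa using hm
    | insert k t hk ih =>
      rw [Finset.prod_insert hk, map_mul, mul_smul, dotPoly_X, Finset.card_insert_of_notMem hk]
      have := hy _ k _ ih
      rwa [add_assoc, ← mul_add_one, ← Nat.cast_add_one] at this
  rw [MvPolynomial.esymm, map_sum, Finset.sum_smul]
  refine sum_mem fun t ht => ?_
  rw [← (Finset.mem_powersetCard.mp ht).2]
  exact hprod t

/-- The dots are nilpotent on a gradeable simple module: `Y_k` is a root of the polynomial with
the roots `Y_1, ..., Y_N`, whose lower coefficients are central of positive degree. -/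
theorem IsGradeableSimple.y_pow_smul (hM : IsGradeableSimple n N M) (k : Fin N) (x : M) :
    y n k ^ N • x = 0 := by
  obtain ⟨hsimple, A, hA, -, -, hy, -⟩ := hM
  have hcard : Multiset.card
      ((Finset.univ : Finset (Fin N)).val.map (MvPolynomial.X (R := ℂ))) = N := by simp
  have h := congrArg (Polynomial.eval (MvPolynomial.X k)) (Multiset.prod_X_sub_X_eq_sum_esymm
    ((Finset.univ : Finset (Fin N)).val.map (MvPolynomial.X (R := ℂ))))
  rw [Polynomial.eval_multiset_prod, Multiset.map_map, Multiset.map_map,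
    Multiset.prod_eq_zero (Multiset.mem_map.mpr ⟨k, Finset.mem_univ k, by simp⟩), hcard,
    Polynomial.eval_finsetSum, Finset.sum_range_succ'] at h
  simp only [Polynomial.eval_mul, Polynomial.eval_pow, Polynomial.eval_neg, Polynomial.eval_one,
    Polynomial.eval_C, Polynomial.eval_X, ← MvPolynomial.esymm_eq_multiset_esymm, pow_zero,
    one_mul, Nat.sub_zero] at h
  have h0 := congrArg (fun f => dotPoly n N f • x) h
  simp only [map_zero, zero_smul, map_add, add_smul, map_sum, Finset.sum_smul] at h0
  rw [Finset.sum_eq_zero, zero_add] at h0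
  · simpa [← MvPolynomial.esymm_eq_multiset_esymm] using h0.symm
  · intro j _
    rw [mul_left_comm, map_mul, mul_smul]
    exact smul_eq_zero_of_shift hA
      (commute_dotPoly_of_isSymmetric (MvPolynomial.esymm_isSymmetric _ _ _))
      (s := 2 * (j + 1 : ℕ)) (by positivity) (fun d m hm => dotPoly_esymm_smul_mem hy _ d m hm) _

/-- If the dots are nilpotent, then every nonzero `e(i) M` contains a nonzero vector killed by
all of them. -/
theorem Occurs.exists_ne_zero {i : Word n N} (hi : Occurs M i)
    (hnil : ∀ (k : Fin N) (x : M), y n k ^ N • x = 0) :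
    ∃ v : M, v ≠ 0 ∧ e i • v = v ∧ ∀ k : Fin N, y n k • v = 0 := by
  suffices h : ∀ t : Finset (Fin N), ∃ v : M, v ≠ 0 ∧ e i • v = v ∧ ∀ k ∈ t, y n k • v = 0 by
    simpa using h Finset.univ
  intro t
  induction t using Finset.induction_on with
  | empty =>
    obtain ⟨m, hm⟩ := hi
    exact ⟨_, hm, e_smul_e_smul i m, by simp⟩
  | insert k t hk ih =>
    obtain ⟨v, hv0, hvi, hvt⟩ := ih
    classical
    have hex : ∃ r, y n k ^ r • v = 0 := ⟨N, hnil k v⟩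
    obtain ⟨r, hr⟩ : ∃ r, Nat.find hex = r + 1 := by
      refine Nat.exists_eq_succ_of_ne_zero fun h => hv0 ?_
      simpa [h] using Nat.find_spec hex
    have hei : ∀ r : ℕ, e i • y n k ^ r • v = y n k ^ r • v := by
      intro r
      induction r with
      | zero => simpa using hvi
      | succ r ih => rw [pow_succ', mul_smul, e_smul_y_smul k ih]
    have hyt : ∀ l ∈ t, ∀ r : ℕ, y n l • y n k ^ r • v = 0 := by
      intro l hl r
      induction r with
      | zero => simpa using hvt l hl
      | succ r ih => rw [pow_succ', mul_smul, y_smul_y_smul, ih, smul_zero]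
    refine ⟨y n k ^ r • v, Nat.find_min hex (by omega), hei r, fun l hl => ?_⟩
    obtain rfl | hl := Finset.mem_insert.mp hl
    · rw [smul_smul, ← pow_succ', ← hr]
      exact Nat.find_spec hex
    · exact hyt l hl r

theorem swap_lt {i : Word n N} {k : Fin (N - 1)} (h : i (hi k) < i (lo k)) :
    toLex (i.swap k) < toLex i := by
  refine ⟨lo k, fun p hp => ?_, ?_⟩
  · have hp : (p : ℕ) < k := hp
    exact swap_of_ne k i p (by simp [lo, Fin.ext_iff]; omega) (by simp [hi, Fin.ext_iff]; omega)
  · change i.swap k (lo k) < i (lo k)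
    rwa [swap_lo]

/-- The minimal word of a gradeable simple module contributes a vector satisfying the relations of
the standard module: the forbidden crossings lead to smaller words. -/
theorem IsGradeableSimple.exists_satisfiesStandardRelations (hM : IsGradeableSimple n N M)
    {i : Word n N} (hi : Occurs M i) (hmin : ∀ j : Word n N, Occurs M j → toLex i ≤ toLex j) :
    ∃ v : M, v ≠ 0 ∧ SatisfiesStandardRelations i v := by
  obtain ⟨v, h0, hv, hy⟩ := hi.exists_ne_zero hM.y_pow_smul
  refine ⟨v, h0, hv, fun k hk => ?_, hy⟩
  by_contra hne
  refine absurd (hmin (i.swap k) ⟨psi n k • v, ?_⟩) (not_le_of_gt (swap_lt ?_))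
  · rwa [e_smul_psi_smul k hv]
  · rw [Fin.lt_def, ← hk]; exact Nat.lt_succ_self _

theorem exists_minimal_word [Nontrivial M] :
    ∃ i : Word n N, Occurs M i ∧ ∀ j : Word n N, Occurs M j → toLex i ≤ toLex j := by
  have hne : {i : Word n N | Occurs M i}.Nonempty := by
    obtain ⟨m, hm⟩ := exists_ne (0 : M)
    by_contra! h
    refine hm ?_
    rw [← one_smul (KLRW n N) m, ← sum_e, Finset.sum_smul]
    refine Finset.sum_eq_zero fun w _ => ?_
    by_contra hw
    exact (h ▸ (⟨m, hw⟩ : w ∈ {i : Word n N | Occurs M i}) : w ∈ (∅ : Set (Word n N)))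
  obtain ⟨i, hi, hmin⟩ := Set.exists_min_image {i : Word n N | Occurs M i} toLex
    (Set.toFinite _) hne
  exact ⟨i, hi, hmin⟩

variable {M' : Type*} [AddCommGroup M'] [Module (KLRW n N) M']

theorem Occurs.of_equiv (φ : M ≃ₗ[KLRW n N] M') {i : Word n N} (h : Occurs M i) :
    Occurs M' i := by
  obtain ⟨m, hm⟩ := h
  exact ⟨φ m, by rwa [← map_smul, ne_eq, φ.map_eq_zero_iff]⟩

theorem Gradeable.of_equiv (φ : M ≃ₗ[KLRW n N] M') (h : Gradeable n N M) : Gradeable n N M' := by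
  obtain ⟨A, hA, hC, he, hy, hpsi⟩ := h
  let f : M →+ M' := φ.toLinearMap.toAddMonoidHom
  refine ⟨fun d => (A d).map f, ?_, ?_, ?_, ?_, ?_⟩
  · have hb : Function.Bijective (DirectSum.map fun d => f.addSubgroupMap (A d)) :=
      ⟨(DirectSum.map_injective _).mpr fun d x x' hx =>
          Subtype.ext (φ.injective (congrArg Subtype.val hx)),
        (DirectSum.map_surjective _).mpr fun d => f.addSubgroupMap_surjective (A d)⟩
    have hcomp : (DirectSum.coeAddMonoidHom fun d => (A d).map f).comp
        (DirectSum.map fun d => f.addSubgroupMap (A d)) =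
        f.comp (DirectSum.coeAddMonoidHom A) := by
      ext d x
      simp
    refine (Function.Bijective.of_comp_iff _ hb).mp ?_
    have := φ.bijective.comp hA
    convert this
    exact congrArg DFunLike.coe hcomp
  · rintro d c _ ⟨m, hm, rfl⟩
    exact ⟨_, hC d c m hm, map_smul φ _ _⟩
  · rintro d w _ ⟨m, hm, rfl⟩
    exact ⟨_, he d w m hm, map_smul φ _ _⟩
  · rintro d k _ ⟨m, hm, rfl⟩
    exact ⟨_, hy d k m hm, map_smul φ _ _⟩
  · rintro d k w _ ⟨m, hm, rfl⟩
    exact ⟨_, hpsi d k w m hm, map_smul φ _ _⟩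

/-! ### Red-good words and canonical modules -/

/-- For a sorted word, a nonzero vector satisfying the relations of the standard module exhibits a
simple module as the canonical module. -/
theorem nonempty_equiv_canonical [IsSimpleModule (KLRW n N) M] {i : Word n N} (hi : IsSorted i)
    {v : M} (h0 : v ≠ 0) (hv : SatisfiesStandardRelations i v) :
    Nonempty (M ≃ₗ[KLRW n N] Canonical i) := by
  have := isSimpleModule_canonical i
  obtain ⟨φ, -⟩ := exists_simpleHead_equiv hi hv h0
  obtain ⟨χ, -⟩ := exists_simpleHead_equiv hi (satisfiesStandardRelations_canonicalGen i)
    (canonicalGen_ne_zero i)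
  exact ⟨φ.symm.trans χ⟩

theorem RedGood.isSorted {i : Word n N} (h : RedGood i) : IsSorted i := by
  obtain ⟨M, _, _, -, hi, hmin⟩ := h
  exact isSorted_of_minimal hi hmin

theorem IsGradeableSimple.exists_redGood (hM : IsGradeableSimple n N M) :
    ∃ i : Word n N, RedGood i ∧ Nonempty (M ≃ₗ[KLRW n N] Canonical i) := by
  have := hM.1
  have := IsSimpleModule.nontrivial (KLRW n N) M
  obtain ⟨i, hi, hmin⟩ := exists_minimal_word (n := n) (N := N) (M := M)
  obtain ⟨v, h0, hv⟩ := hM.exists_satisfiesStandardRelations hi hmin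
  obtain ⟨φ⟩ := nonempty_equiv_canonical (isSorted_of_minimal hi hmin) h0 hv
  exact ⟨i, ⟨Canonical i, inferInstance, inferInstance,
    ⟨isSimpleModule_canonical i, hM.2.of_equiv φ⟩, hi.of_equiv φ,
    fun j hj => hmin j (hj.of_equiv φ.symm)⟩, ⟨φ⟩⟩

end

end KLRW

theorem mainTheorem3 (n N : ℕ) :
    (∀ i : KLRW.Word n N, KLRW.HasUniqueSimpleQuotient (KLRW n N) (KLRW.preCanonical i)) ∧
    (∀ i : KLRW.Word n N, KLRW.RedGood i →
      KLRW.SatisfiesStandardRelations i (KLRW.canonicalGen i) ∧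
      KLRW.HasUniqueSimpleQuotient (KLRW n N) (KLRW.Standard i) ∧
      ∃ φ : KLRW.SimpleHead i ≃ₗ[KLRW n N] KLRW.Canonical i,
        φ (KLRW.simpleHeadGen i) = KLRW.canonicalGen i) ∧
    (∀ (M : Type*) [AddCommGroup M] [Module (KLRW n N) M], KLRW.IsGradeableSimple n N M →
      ∃ i : KLRW.Word n N, KLRW.RedGood i ∧ Nonempty (M ≃ₗ[KLRW n N] KLRW.Canonical i)) := by
  refine ⟨KLRW.hasUniqueSimpleQuotient_preCanonical, fun i hi => ?_, fun M _ _ hM =>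
    hM.exists_redGood⟩
  have := KLRW.isSimpleModule_canonical i
  exact ⟨KLRW.satisfiesStandardRelations_canonicalGen i,
    KLRW.hasUniqueSimpleQuotient_standard hi.isSorted,
    KLRW.exists_simpleHead_equiv hi.isSorted (KLRW.satisfiesStandardRelations_canonicalGen i)
      (KLRW.canonicalGen_ne_zero i)⟩
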